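/- **Setting.** Let $(M,g)$ be a Lorentzian manifold of signature $(+,-,\dots,-)$ (for instance a globally hyperbolic space-time) with volume measure $\mathrm{dvol}$, let $\mathscr E=C^\infty(M,\mathbb R^n)$ (row vectors), and let $L$ be the free Lagrangian, $L(f)[\phi]=\int f\,\tfrac12\sum_a\big(\langle d\phi_a,d\phi_a\rangle-m^2\phi_a^2\big)\,\mathrm{dvol}$ for $f\in\mathscr D(M)$. *Local functionals* $F\in\mathscr F_{\rm loc}$ are the functionals $F[\phi]=\int\hat F(x,j_x\phi)\,\mathrm{dvol}(x)$ with $\hat F$ smooth, real, compactly supported in $x$ and polynomial in the jet of $\phi$; a family $F_s$ of local functionals is smooth if locally in $s$ it is given by such $\hat F_s$, jointly smooth in $(s,x,j_x\phi)$, with a common compact support in $x$ and bounded jet order and degree. The support of $F$ is the complement of the set of points $x$ having a neighbourhood $U$ such that $F[\phi+\eta]=F[\phi]$ for all $\phi$ and all $\eta\in\mathscr E$ vanishing outside $U$. For $k\ge 0$, $\mathscr F_{k\text{-loc}}$ is the span of $k$-fold pointwise products of local functionals vanishing at $\phi=0$. *Symmetries.* $\mathcal G_c(M)$ is the group of compactly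 supported automorphisms of the affine bundle $M\times\mathbb R^n$, i.e. of the transformations $\mathsf g:\phi\mapsto(\phi\circ\rho)A+\psi$ with $\rho$ a diffeomorphism, $A\in C^\infty(M,GL(n,\mathbb R))$, $\psi\in C^\infty(M,\mathbb R^n)$, trivial outside a compact set, with product $(\mathsf g\mathsf h)(\phi)=\mathsf h(\mathsf g(\phi))$. Put $\mathsf g_*F[\phi]=F[\mathsf g(\phi)]$ and $\mathsf g_LF=\delta_{\mathsf g}L+\mathsf g_*F$, where $\delta_{\mathsf g}L=\mathsf g_*L(f)-L(f)$ for any $f\in\mathscr D(M)$ with $f=1$ on $\operatorname{supp}\mathsf g$. $\mathrm{Lie}\,\mathcal G_c(M)$ consists of the compactly supported triples $X=(a,p,v)$ ($a$ matrix-valued, $p$ $\mathbb R^n$-valued, $v$ a vector field), acting by $\phi X=\phi a+v^\mu\partial_\mu\phi+p$, with bracket $$[(a,p,v),(b,q,w)]=([a,b]+w^\nu\partial_\nu a-v^\nu\partial_\nu b,\;pb-qa+w^\nu\partial_\nu p-v^\nu\partial_\nu q,\;w^\nu\partial_\nu v-v^\nu\partial_\nu w).$$ Put $\partial_XF[\phi]=\langle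 F'[\phi],\phi X\rangle$ and $\partial_XL=\partial_X(L(f))$ for any $f\in\mathscr D(M)$ with $f=1$ on $\operatorname{supp}X$. Smooth families in $\mathcal G_c(M)$ are those with jointly smooth $\rho,A,\psi$ and supports in a common compact set. *Renormalization group.* A formal power series is a sequence $z=(z_k)_{k\ge0}$ of linear maps $z_k:\mathscr F_{k\text{-loc}}\to\mathscr F_{\rm loc}$, written $z(F)=\sum_k\frac1{k!}z_k\big((F-F[0])^k\big)$; in particular $z(F+c)=z(F)$ for constants $c$. All identities between formal power series are understood order by order in $F$. $\mathrm{Lie}\,\mathscr R_c$ is the set of all $z$ with $z_0=0$ such that: $\mathrm{id}+\lambda z_1$ is invertible on $\mathscr F_{\rm loc}$ for small $\lambda$; $z(F+G)=z(F)+z(G)$ if $\operatorname{supp}F\cap\operatorname{supp}G=\emptyset$; $z(F+\langle\Phi,\psi\rangle)=z(F)$ for $\psi\in\mathscr D(M,\mathbb R^n)$; $\frac{\delta}{\delta\phi}z(F)=\langle z'(F),\frac{\delta F}{\delta\phi}\rangle$; there is a compact $N$ with $z(F+G)=z(G)$ whenever $\operatorname{supp}F\cap N=\emptyset$. $\mathscr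 R_c$ is the set of $Z=\mathrm{id}+z$ such that: $\mathrm{id}+z_1$ is invertible on $\mathscr F_{\rm loc}$; $Z(F+G+H)=Z(F+G)-Z(G)+Z(G+H)$ if $\operatorname{supp}F\cap\operatorname{supp}H=\emptyset$; $Z(F+\langle\Phi,\psi\rangle)=Z(F)+\langle\Phi,\psi\rangle$ for $\psi\in\mathscr D(M,\mathbb R^n)$; $\frac{\delta}{\delta\phi}Z(F)=\langle Z'(F),\frac{\delta F}{\delta\phi}\rangle$; and there is a compact $N$ with $Z(F+G)=F+Z(G)$ whenever $\operatorname{supp}F\cap N=\emptyset$. (A constant $Z(0)\neq0$ is allowed.) For formal power series $z,w$ and $X\in\mathrm{Lie}\,\mathcal G_c(M)$ put $$[z,w](F)=\langle z'(F),w(F)\rangle-\langle w'(F),z(F)\rangle,\qquad(\partial_Xz)(F)=\partial_X(z(F))-\langle z'(F),\partial_X(F+L)\rangle .$$ **Theorem.** Let $\zeta:\mathcal G_c(M)\to\mathscr R_c$ be smooth (for every $k$, the $k$-th coefficient of $\zeta_{\mathsf g}-\mathrm{id}$ sends smooth families of symmetries together with products of $k$ smooth families of local functionals vanishing at $\phi=0$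 to smooth families of local functionals), with $\zeta_{\mathsf e}=\mathrm{id}$, satisfying the cocycle relation $$\zeta_{\mathsf g\mathsf h}=\zeta_{\mathsf h}\,\mathsf h_L^{-1}\,\zeta_{\mathsf g}\,\mathsf h_L$$ in the sense of formal power series: as $\mathsf h_L$ is affine, with inhomogeneous term $\delta_{\mathsf h}L$, this means that for all smooth finite-dimensional families $\mathsf g_s,\mathsf h_s$ with $\mathsf h_0=\mathsf e$ and all $F\in\mathscr F_{\rm loc}$, both sides for $(\mathsf g_s,\mathsf h_s)$, evaluated at $\kappa F$ and at any configuration, have the same expansion in $(s,\kappa)$ at $0$ to every order (for each $N$, replacing every series by its partial sum of order $N$, the two sides differ by $O(\|(s,\kappa)\|^{N+1})$). Let $\Delta:\mathrm{Lie}\,\mathcal G_c(M)\to\mathrm{Lie}\,\mathscr R_c$ be the infinitesimal anomaly, $\Delta X=\frac{d}{d\lambda}\big|_{\lambda=0}\zeta_{\mathsf g^\lambda}$ (coefficientwise) for every smooth curve $\mathsf g^\lambda$ in $\mathcal G_c(M)$ with $\mathsf g^0=\mathsf e$ and tangent vector $X$ at $\lambda=0$. Then $\Delta$ is linear, and for all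 $X,Y\in\mathrm{Lie}\,\mathcal G_c(M)$ and $F\in\mathscr F_{\rm loc}$, order by order in $F$, $$\Delta([X,Y])(F)=-[\Delta X,\Delta Y](F)+(\partial_X\Delta Y)(F)-(\partial_Y\Delta X)(F),$$ that is, $\Delta$ satisfies the extended Wess–Zumino condition $$\begin{aligned}\Delta([X,Y])(F)=\;&\langle(\Delta Y)'(F),\Delta X(F)\rangle-\langle(\Delta X)'(F),\Delta Y(F)\rangle+\partial_X(\Delta Y(F))-\partial_Y(\Delta X(F))\\&-\langle(\Delta Y)'(F),\partial_X(L+F)\rangle+\langle(\Delta X)'(F),\partial_Y(L+F)\rangle.\end{aligned}$$ -/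

import Mathlib

open scoped Manifold ContDiff Topology Matrix
open MeasureTheory

noncomputable section

namespace AMWI

/-! ### Smooth functions, field configurations, space-times -/

section Geometry

variable (d n : ℕ) (M : Type*) [TopologicalSpace M] [ChartedSpace (EuclideanSpace ℝ (Fin d)) M]

/-- The algebra `C^∞(M, ℝ)` of smooth functions on the `d`-dimensional manifold `M`. -/
abbrev Smooth := C^∞⟮𝓡 d, M; 𝓘(ℝ), ℝ⟯

/-- The configuration space `𝓔(M, ℝⁿ)`: smooth `ℝⁿ`-valued functions, given by their components
and treated as row vectors. -/
abbrev Conf := Fin n → Smooth d M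

/-- (Not necessarily local) functionals on the configuration space. -/
abbrev Functional := Conf d n M → ℝ

variable {d n M}

/-- The differential of a real function at `x`, as a covector. -/
def dAt (f : M → ℝ) (x : M) : TangentSpace (𝓡 d) x →L[ℝ] ℝ :=
  mfderiv (𝓡 d) 𝓘(ℝ) f x

/-- A field configuration (or the field part of a symmetry) with compact support. -/
def CompactlySupported (φ : Conf d n M) : Prop :=
  ∃ K : Set M, IsCompact K ∧ ∀ x ∉ K, ∀ i, φ i x = 0

variable (d M)

/-- A smooth Lorentzian metric of signature `(+,-,…,-)` on `M`, given by the inner product it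
induces on covectors, together with its volume measure. -/
structure Spacetime [MeasurableSpace M] where
  /-- the inverse metric at `x` -/
  coMetric : ∀ x : M, LinearMap.BilinForm ℝ (TangentSpace (𝓡 d) x →L[ℝ] ℝ)
  symm : ∀ x α β, coMetric x α β = coMetric x β α
  lorentzian : ∀ x, ∃ b : Module.Basis (Fin d) ℝ (TangentSpace (𝓡 d) x →L[ℝ] ℝ), ∀ i j,
    coMetric x (b i) (b j) = if i = j then (if (i : ℕ) = 0 then 1 else -1) else 0
  smooth : ∀ f h : Smooth d M,
    ContMDiff (𝓡 d) 𝓘(ℝ) ∞ (fun x => coMetric x (dAt f x) (dAt h x))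
  /-- the Lorentzian volume measure; in every chart it is
  `|det g_{ij}|^{1/2} dy = |det g^{ij}|^{-1/2} dy` -/
  vol : Measure M
  vol_chart : ∀ e ∈ IsManifold.maximalAtlas (𝓡 d) ∞ M,
    Measure.map e (vol.restrict e.source) =
      ((volume : Measure (EuclideanSpace ℝ (Fin d))).restrict e.target).withDensity
        (fun y => ENNReal.ofReal (Real.sqrt |(Matrix.of fun i j : Fin d =>
          coMetric (e.symm y) (dAt (fun z => e z i) (e.symm y))
            (dAt (fun z => e z j) (e.symm y))).det|)⁻¹)

end Geometry

/-! ### Local functionals -/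

section Local

variable {d n : ℕ} {M : Type*} [TopologicalSpace M] [ChartedSpace (EuclideanSpace ℝ (Fin d)) M]

/-- The maximal ideal `𝔪_x` of smooth functions vanishing at `x`. -/
def vanishingIdeal (x : M) : Ideal (Smooth d M) :=
  RingHom.ker (ContMDiffMap.evalRingHom (I := 𝓡 d) (I' := 𝓘(ℝ)) (n := ∞) (R := ℝ) x)

/-- The `r`-jet of `φ` at `x` vanishes, where the space of `r`-jets at `x` is
`C^∞(M) / 𝔪_x^{r+1}` for every component. -/
def JetVanishes (r : ℕ) (x : M) (φ : Conf d n M) : Prop :=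
  ∀ i, φ i ∈ vanishingIdeal (d := d) x ^ (r + 1)

/-- A family of configurations that is jointly smooth in the parameter and the point. -/
def IsSmoothConfFamily {Q : Type*} [NormedAddCommGroup Q] [NormedSpace ℝ Q]
    (φ : Q → Conf d n M) : Prop :=
  ∀ i, ContMDiff (𝓘(ℝ, Q).prod (𝓡 d)) 𝓘(ℝ) ∞ (fun q : Q × M => φ q.1 i q.2)

/-- A smooth family `s ↦ D s` of homogeneous polynomial densities of degree `k` on a jet space of
`M × ℝⁿ`, in polarized form: `D s (φ₁,…,φ_k)(x)` depends on the `φᵢ` only through their `r`-jets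
at `x`, it vanishes for `x` outside a compact set, and it is smooth in all variables. -/
def IsDensityFamily {P : Type} [NormedAddCommGroup P] [NormedSpace ℝ P] {k : ℕ}
    (D : P → MultilinearMap ℝ (fun _ : Fin k => Conf d n M) (Smooth d M)) : Prop :=
  (∃ r : ℕ, ∀ s x φ i, JetVanishes r x (φ i) → D s φ x = 0) ∧
  (∃ K : Set M, IsCompact K ∧ ∀ s φ, ∀ x ∉ K, D s φ x = 0) ∧
  ∀ (Q : Type) [NormedAddCommGroup Q] [NormedSpace ℝ Q] [FiniteDimensional ℝ Q]
    (φ : Fin k → Q → Conf d n M), (∀ i, IsSmoothConfFamily (φ i)) →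
    ContMDiff (𝓘(ℝ, P × Q).prod (𝓡 d)) 𝓘(ℝ) ∞
      (fun q : (P × Q) × M => D q.1.1 (fun i => φ i q.1.2) q.2)

variable [MeasurableSpace M] (S : Spacetime d M)

/-- A smooth family of polynomial local functionals: locally in the parameter,
`F_s[φ] = ∫ F̂(s, x, j_x φ) dvol(x)` with `F̂` smooth, compactly supported in `x`, and polynomial
in the jet of `φ`. -/
def IsLocalFamily {P : Type} [NormedAddCommGroup P] [NormedSpace ℝ P]
    (F : P → Functional d n M) : Prop :=
  ∀ s₀ : P, ∃ (m : ℕ)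
    (D : ∀ k : ℕ, P → MultilinearMap ℝ (fun _ : Fin k => Conf d n M) (Smooth d M)),
    (∀ k, IsDensityFamily (D k)) ∧
    ∀ᶠ s in 𝓝 s₀, ∀ φ, F s φ = ∑ k ∈ Finset.range m, ∫ x, D k s (fun _ => φ) x ∂S.vol

variable (n)

/-- The space `𝓕_loc(M)` of local functionals. -/
def Floc : Submodule ℝ (Functional d n M) :=
  Submodule.span ℝ {F | IsLocalFamily S (fun _ : ℝ => F)}

/-- The space of `k`-local functionals: the span of the `k`-fold pointwise products of local
functionals that vanish at the zero configuration. -/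
def Fnloc (k : ℕ) : Submodule ℝ (Functional d n M) :=
  Submodule.span ℝ {G | ∃ F : Fin k → Functional d n M,
    (∀ i, F i ∈ Floc n S ∧ F i 0 = 0) ∧ G = ∏ i, F i}

variable {n}

/-- The complement of the support of `F`: points with a neighbourhood such that `F` does not
react to changes of the field in that neighbourhood. -/
def fsupport (F : Functional d n M) : Set M :=
  {x | ∃ U : Set M, IsOpen U ∧ x ∈ U ∧
    ∀ φ η : Conf d n M, (∀ y ∉ U, ∀ i, η i y = 0) → F (φ + η) = F φ}ᶜ

/-- `⟨Φ, ψ⟩` for a test function `ψ`. -/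
def pairing (ψ : Conf d n M) : Functional d n M :=
  fun φ => ∫ x, ∑ i, φ i x * ψ i x ∂S.vol

/-- The directional derivative `⟨F'[φ], η φ⟩` along a `φ`-dependent direction `η`. -/
def dirDer (η : Conf d n M → Conf d n M) (F : Functional d n M) : Functional d n M :=
  fun φ => deriv (fun t : ℝ => F (φ + t • η φ)) 0

/-- `F - F[0]`. -/
def reduced (F : Functional d n M) : Functional d n M := fun φ => F φ - F 0

end Local

/-! ### Formal power series of local functionals and the renormalization group -/

section Formal

variable {d n : ℕ} {M : Type*} [TopologicalSpace M] [ChartedSpace (EuclideanSpace ℝ (Fin d)) M]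
  [MeasurableSpace M] (S : Spacetime d M)

variable (n) in
/-- Formal power series `z(F) = ∑_k z_k(F^k)/k!` with linear maps `z_k` from `k`-local to local
functionals. -/
abbrev FormalSeries := ∀ k : ℕ, Fnloc n S k →ₗ[ℝ] Floc n S

variable {S}

open Classical in
/-- The value `z_k(G)` for a `k`-local functional `G` (it is only used for such `G`). -/
def FormalSeries.app (z : FormalSeries n S) (k : ℕ) (G : Functional d n M) : Functional d n M :=
  if h : G ∈ Fnloc n S k then (z k ⟨G, h⟩ : Functional d n M) else 0

/-- The component `z_k(F^k)/k!` of order `k` of `z(F)`. The maps `z_k` are defined on products of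
functionals vanishing at `0`; constants are ignored, `z(F + c) = z(F)`. -/
def FormalSeries.comp (z : FormalSeries n S) (k : ℕ) (F : Functional d n M) :
    Functional d n M :=
  ((k.factorial : ℝ)⁻¹) • z.app k (reduced F ^ k)

/-- The component of order `k` in `F` of the derivative `⟨z'(F), G⟩`, where `G = ∑_l G l` is a
formal series whose term `G l` is of order `l` in `F`:
`∑_{j+l=k} z_{j+1}(F^j · G l)/j!`. -/
def FormalSeries.der (z : FormalSeries n S) (F : Functional d n M)
    (G : ℕ → Functional d n M) (k : ℕ) : Functional d n M :=
  ∑ p ∈ Finset.HasAntidiagonal.antidiagonal k,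
    ((p.1.factorial : ℝ)⁻¹) • z.app (p.1 + 1) (reduced F ^ p.1 * reduced (G p.2))

/-- Invariance under source terms: `z(F + ⟨Φ,ψ⟩) = z(F)` for test functions `ψ`. -/
def FormalSeries.ShiftInvariant (z : FormalSeries n S) : Prop :=
  ∀ F ∈ Floc n S, ∀ ψ : Conf d n M, CompactlySupported ψ → ∀ k,
    z.comp k (F + pairing S ψ) = z.comp k F

/-- Field independence `δ/δφ z(F) = ⟨z'(F), δF/δφ⟩`, smeared with test functions `η`. -/
def FormalSeries.FieldIndependent (z : FormalSeries n S) : Prop :=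
  ∀ F ∈ Floc n S, ∀ η : Conf d n M, CompactlySupported η → ∀ k,
    dirDer (fun _ => η) (z.comp k F) = z.der F (fun l => if l = 1 then dirDer (fun _ => η) F else 0) k

/-- Compact support: there is a compact `N` with `z(F + G) = z(G)` for `supp F ∩ N = ∅`. -/
def FormalSeries.CompactSupport (z : FormalSeries n S) : Prop :=
  ∃ N : Set M, IsCompact N ∧ ∀ F ∈ Floc n S, ∀ G ∈ Floc n S,
    Disjoint (fsupport F) N → ∀ k, z.comp k (F + G) = z.comp k G

variable (n S)

/-- The group `𝓡_c` of renormalization group maps of compact support. An element `Z = (Z_k)` is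
given by the formal power series `pert = Z - id`, that is `Z_1 = id + pert_1` and
`Z_k = pert_k` for `k ≠ 1`; in these terms `Z(F + c) = Z(F) + c` is built in, and
`Z(F + ⟨Φ,ψ⟩) = Z(F) + ⟨Φ,ψ⟩`, `δZ(F)/δφ = ⟨Z'(F), δF/δφ⟩` and `Z(F + G) = F + Z(G)` for `F`
supported away from `supp Z` are the listed conditions for `pert`. A field independent constant
`Z(0)` is admitted: conjugation with affine maps of `𝓕_loc` does not preserve `Z(0) = 0`. -/
structure Rc where
  pert : FormalSeries n S
  invertible : Set.BijOn (fun F => F + pert.comp 1 F) (Floc n S : Set (Functional d n M))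
    (Floc n S)
  /-- `Z(F + G + H) = Z(F + G) - Z(G) + Z(G + H)` if `F` and `H` have disjoint supports -/
  additive : ∀ F ∈ Floc n S, ∀ G ∈ Floc n S, ∀ H ∈ Floc n S,
    Disjoint (fsupport F) (fsupport H) → ∀ k,
      pert.comp k (F + G + H) = pert.comp k (F + G) - pert.comp k G + pert.comp k (G + H)
  shift : pert.ShiftInvariant
  field : pert.FieldIndependent
  support : pert.CompactSupport

/-- The Lie algebra `Lie 𝓡_c`: formal power series `z(F) = ∑_{k ≥ 1} z_k(F^k)/k!` with the five
properties listed. -/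
structure LieRc where
  series : FormalSeries n S
  zero : series 0 = 0
  invertible : ∃ ε > 0, ∀ l : ℝ, |l| < ε →
    Set.BijOn (fun F => F + l • series.comp 1 F) (Floc n S : Set (Functional d n M)) (Floc n S)
  additive : ∀ F ∈ Floc n S, ∀ G ∈ Floc n S, Disjoint (fsupport F) (fsupport G) → ∀ k,
    series.comp k (F + G) = series.comp k F + series.comp k G
  shift : series.ShiftInvariant
  field : series.FieldIndependent
  support : series.CompactSupport

variable {n S}

/-- The partial sum of order `N` of the formal power series `Z(F)`, `Z ∈ 𝓡_c`. -/
def Rc.partialSum (Z : Rc n S) (N : ℕ) (F : Functional d n M) : Functional d n M :=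
  F + ∑ k ∈ Finset.range (N + 1), Z.pert.comp k F

/-- The Lie bracket of `Lie 𝓡_c`, `[z,w](F) = ⟨z'(F), w(F)⟩ - ⟨w'(F), z(F)⟩`, order by order. -/
def lieBracket (z w : FormalSeries n S) (F : Functional d n M) (k : ℕ) : Functional d n M :=
  z.der F (fun l => w.comp l F) k - w.der F (fun l => z.comp l F) k

end Formal

/-! ### The symmetry group and its Lie algebra -/

section Group

variable {d n : ℕ} {M : Type*} [TopologicalSpace M] [ChartedSpace (EuclideanSpace ℝ (Fin d)) M]

/-- Pullback `f ↦ f ∘ ρ`. -/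
def pull (ρ : Diffeomorph (𝓡 d) (𝓡 d) M M ∞) : Smooth d M →+* Smooth d M where
  toFun f := f.comp (ρ : C^∞⟮𝓡 d, M; 𝓡 d, M⟯)
  map_one' := by ext; rfl
  map_mul' _ _ := by ext; rfl
  map_zero' := by ext; rfl
  map_add' _ _ := by ext; rfl

@[simp] theorem pull_apply (ρ : Diffeomorph (𝓡 d) (𝓡 d) M M ∞) (f : Smooth d M) (x : M) :
    pull ρ f x = f (ρ x) := rfl

variable (d n M) in
/-- The group `𝓖_c(M)` of compactly supported automorphisms of the affine bundle `M × ℝⁿ`; the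
triple `(ρ, A, ψ)` stands for the transformation `φ ↦ (φ ∘ ρ) A + ψ` of configurations. -/
@[ext] structure Gc where
  ρ : Diffeomorph (𝓡 d) (𝓡 d) M M ∞
  A : GL (Fin n) (Smooth d M)
  ψ : Conf d n M
  compact : ∃ K : Set M, IsCompact K ∧ ∀ x ∉ K,
    ρ x = x ∧ (∀ i j, A.val i j x = (1 : Matrix (Fin n) (Fin n) ℝ) i j) ∧ ∀ i, ψ i x = 0

/-- The action `φ ↦ (φ ∘ ρ) A + ψ` on configurations. -/
def Gc.act (g : Gc d n M) (φ : Conf d n M) : Conf d n M :=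
  (fun i => pull g.ρ (φ i)) ᵥ* g.A.val + g.ψ

namespace Gc

/-- Pullback of an invertible matrix of functions. -/
def pullGL (ρ : Diffeomorph (𝓡 d) (𝓡 d) M M ∞) : GL (Fin n) (Smooth d M) →* GL (Fin n) (Smooth d M) :=
  Matrix.GeneralLinearGroup.map (pull ρ)

/-- The value of a matrix of functions at a point. -/
def evalGL (x : M) : GL (Fin n) (Smooth d M) →* GL (Fin n) ℝ :=
  Matrix.GeneralLinearGroup.map
    (ContMDiffMap.evalRingHom (I := 𝓡 d) (I' := 𝓘(ℝ)) (n := ∞) (R := ℝ) x)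

theorem evalGL_eq_one_iff (x : M) (A : GL (Fin n) (Smooth d M)) :
    evalGL x A = 1 ↔ ∀ i j, A.val i j x = (1 : Matrix (Fin n) (Fin n) ℝ) i j := by
  rw [Units.ext_iff]
  exact Matrix.ext_iff.symm

theorem evalGL_pullGL (x : M) (ρ : Diffeomorph (𝓡 d) (𝓡 d) M M ∞) (A : GL (Fin n) (Smooth d M)) :
    evalGL x (pullGL ρ A) = evalGL (ρ x) A := Units.ext (Matrix.ext fun _ _ => rfl)

theorem vecMul_eq_zero_at (x : M) (φ : Conf d n M) (A : Matrix (Fin n) (Fin n) (Smooth d M))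
    (h : ∀ i, φ i x = 0) (j : Fin n) : (φ ᵥ* A) j x = 0 := by
  have key := RingHom.map_vecMul
    (ContMDiffMap.evalRingHom (I := 𝓡 d) (I' := 𝓘(ℝ)) (n := ∞) (R := ℝ) x) A φ j
  have h0 : (fun i => (ContMDiffMap.evalRingHom (I := 𝓡 d) (I' := 𝓘(ℝ)) (n := ∞) (R := ℝ) x)
      (φ i)) = 0 := funext h
  change (ContMDiffMap.evalRingHom (I := 𝓡 d) (I' := 𝓘(ℝ)) (n := ∞) (R := ℝ) x) _ = 0
  rw [key]
  have h1 : (⇑(ContMDiffMap.evalRingHom (I := 𝓡 d) (I' := 𝓘(ℝ)) (n := ∞) (R := ℝ) x) ∘ φ) = 0 := h0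
  rw [h1, Matrix.zero_vecMul]; rfl

instance : One (Gc d n M) where
  one := ⟨Diffeomorph.refl (𝓡 d) M ∞, 1, 0, ∅, isCompact_empty, fun x _ =>
    ⟨rfl, (evalGL_eq_one_iff x _).1 (map_one _), fun _ => rfl⟩⟩

/-- The product `g h` is "first `g`, then `h`" on configurations, see `act_mul`. -/
instance : Mul (Gc d n M) where
  mul g h := ⟨h.ρ.trans g.ρ, pullGL h.ρ g.A * h.A,
    (fun i => pull h.ρ (g.ψ i)) ᵥ* h.A.val + h.ψ, by
    obtain ⟨K, hK, hg⟩ := g.compact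
    obtain ⟨L, hL, hh⟩ := h.compact
    refine ⟨K ∪ L, hK.union hL, fun x hx => ?_⟩
    obtain ⟨hg1, hg2, hg3⟩ := hg x (fun h' => hx (Or.inl h'))
    obtain ⟨hh1, hh2, hh3⟩ := hh x (fun h' => hx (Or.inr h'))
    refine ⟨?_, ?_, fun i => ?_⟩
    · simp [hh1, hg1]
    · rw [← evalGL_eq_one_iff] at hg2 hh2 ⊢
      rw [map_mul, evalGL_pullGL, hh1, hg2, hh2, one_mul]
    · have h1 := vecMul_eq_zero_at x (fun i => pull h.ρ (g.ψ i)) h.A.val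
        (fun i => by rw [pull_apply, hh1, hg3]) i
      change ((fun i => pull h.ρ (g.ψ i)) ᵥ* h.A.val) i x + h.ψ i x = 0
      rw [h1, hh3, add_zero]⟩

instance : Inv (Gc d n M) where
  inv g := ⟨g.ρ.symm, pullGL g.ρ.symm g.A⁻¹,
    - ((fun i => pull g.ρ.symm (g.ψ i)) ᵥ* (pullGL g.ρ.symm g.A⁻¹).val), by
    obtain ⟨K, hK, hg⟩ := g.compact
    refine ⟨K, hK, fun x hx => ?_⟩
    obtain ⟨hg1, hg2, hg3⟩ := hg x hx
    have hs : g.ρ.symm x = x := by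
      conv_lhs => rw [← hg1]
      exact g.ρ.symm_apply_apply x
    refine ⟨hs, ?_, fun i => ?_⟩
    · rw [← evalGL_eq_one_iff] at hg2 ⊢
      rw [evalGL_pullGL, hs, map_inv, hg2, inv_one]
    · have h1 := vecMul_eq_zero_at x (fun i => pull g.ρ.symm (g.ψ i))
        (pullGL g.ρ.symm g.A⁻¹).val (fun i => by rw [pull_apply, hs, hg3]) i
      change - (((fun i => pull g.ρ.symm (g.ψ i)) ᵥ* (pullGL g.ρ.symm g.A⁻¹).val) i x) = 0
      rw [h1, neg_zero]⟩

theorem mul_ρ (g h : Gc d n M) : (g * h).ρ = h.ρ.trans g.ρ := rfl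
theorem mul_A (g h : Gc d n M) : (g * h).A = pullGL h.ρ g.A * h.A := rfl
theorem mul_ψ (g h : Gc d n M) :
    (g * h).ψ = (fun i => pull h.ρ (g.ψ i)) ᵥ* h.A.val + h.ψ := rfl

theorem pull_vecMul (ρ : Diffeomorph (𝓡 d) (𝓡 d) M M ∞) (φ : Conf d n M)
    (A : GL (Fin n) (Smooth d M)) :
    (fun i => pull ρ ((φ ᵥ* A.val) i)) = (fun i => pull ρ (φ i)) ᵥ* (pullGL ρ A).val :=
  funext fun i => RingHom.map_vecMul (pull ρ) A.val φ i

theorem act_mul (g h : Gc d n M) (φ : Conf d n M) : (g * h).act φ = h.act (g.act φ) := by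
  have h1 : (fun i => pull h.ρ (g.act φ i)) =
      (fun i => pull h.ρ (pull g.ρ (φ i))) ᵥ* (pullGL h.ρ g.A).val +
        (fun i => pull h.ρ (g.ψ i)) := by
    rw [← pull_vecMul]
    exact funext fun i => map_add (pull h.ρ) _ _
  simp only [act] at h1 ⊢
  rw [h1, mul_ψ, mul_A, Matrix.add_vecMul, Units.val_mul, Matrix.vecMul_vecMul, add_assoc]
  rfl

instance : Group (Gc d n M) :=
  Group.ofLeftAxioms
    (by
      intro g h k
      have h1 : (fun i => pull k.ρ ((g * h).ψ i)) =
          (fun i => pull k.ρ (pull h.ρ (g.ψ i))) ᵥ* (pullGL k.ρ h.A).val +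
            (fun i => pull k.ρ (h.ψ i)) := by
        rw [← pull_vecMul]
        exact funext fun i => map_add (pull k.ρ) _ _
      apply Gc.ext
      · rfl
      · simp only [mul_A, map_mul, mul_assoc]
        rfl
      · rw [mul_ψ (g * h) k, h1, mul_ψ, mul_ψ, mul_A, Matrix.add_vecMul, Units.val_mul,
          Matrix.vecMul_vecMul, add_assoc]
        rfl)
    (by
      intro g
      apply Gc.ext
      · exact Diffeomorph.ext fun _ => rfl
      · rw [mul_A]
        change pullGL g.ρ 1 * g.A = g.A
        rw [map_one, one_mul]
      · rw [mul_ψ]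
        have h1 : (fun i => pull g.ρ ((1 : Gc d n M).ψ i)) = 0 := rfl
        rw [h1, Matrix.zero_vecMul, zero_add])
    (by
      intro g
      have hA : pullGL g.ρ (pullGL g.ρ.symm g.A⁻¹) = g.A⁻¹ := by
        refine Units.ext (Matrix.ext fun i j => ContMDiffMap.ext fun x => ?_)
        change (g.A⁻¹).val i j (g.ρ.symm (g.ρ x)) = _
        rw [g.ρ.symm_apply_apply]
      have hψ : (fun i => pull g.ρ (pull g.ρ.symm (g.ψ i))) = g.ψ := by
        refine funext fun i => ContMDiffMap.ext fun x => ?_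
        change g.ψ i (g.ρ.symm (g.ρ x)) = _
        rw [g.ρ.symm_apply_apply]
      apply Gc.ext
      · exact Diffeomorph.ext fun x => g.ρ.symm_apply_apply x
      · rw [mul_A]
        change pullGL g.ρ (pullGL g.ρ.symm g.A⁻¹) * g.A = 1
        rw [hA, inv_mul_cancel]
      · rw [mul_ψ]
        have h1 : (fun i => pull g.ρ ((g⁻¹).ψ i)) = - (g.ψ ᵥ* (g.A⁻¹).val) := by
          have h2 := pull_vecMul g.ρ (fun i => pull g.ρ.symm (g.ψ i)) (pullGL g.ρ.symm g.A⁻¹)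
          rw [hA, hψ] at h2
          rw [← h2]
          exact funext fun i => map_neg (pull g.ρ) _
        rw [h1, Matrix.neg_vecMul, Matrix.vecMul_vecMul, ← Units.val_mul, inv_mul_cancel,
          Units.val_one, Matrix.vecMul_one, neg_add_cancel]
        rfl)

end Gc

/-- A smooth family of symmetries: `ρ`, `A`, `ψ` are jointly smooth in the parameter and the
point, with supports in a common compact set (smoothness of the family of inverses is automatic
and only spelled out). -/
def IsSmoothSymFamily {P : Type} [NormedAddCommGroup P] [NormedSpace ℝ P]
    (g : P → Gc d n M) : Prop :=
  (∃ K : Set M, IsCompact K ∧ ∀ s, ∀ x ∉ K, (g s).ρ x = x ∧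
    (∀ i j, (g s).A.val i j x = (1 : Matrix (Fin n) (Fin n) ℝ) i j) ∧ ∀ i, (g s).ψ i x = 0) ∧
  ∀ h : P → Gc d n M, (h = g ∨ h = fun s => (g s)⁻¹) →
    ContMDiff (𝓘(ℝ, P).prod (𝓡 d)) (𝓡 d) ∞ (fun q : P × M => (h q.1).ρ q.2) ∧
    (∀ i j, ContMDiff (𝓘(ℝ, P).prod (𝓡 d)) 𝓘(ℝ) ∞ (fun q : P × M => (h q.1).A.val i j q.2)) ∧
    (∀ i, ContMDiff (𝓘(ℝ, P).prod (𝓡 d)) 𝓘(ℝ) ∞ (fun q : P × M => (h q.1).ψ i q.2))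

variable (d n M) in
/-- The vector space of triples `(a, p, v)` with compact support, where `a` is a matrix-valued
function, `p` an `ℝⁿ`-valued function, and `v` a smooth vector field, i.e. a derivation of
`C^∞(M)`. -/
def lieGcSubmodule : Submodule ℝ (Matrix (Fin n) (Fin n) (Smooth d M) × Conf d n M ×
    Derivation ℝ (Smooth d M) (Smooth d M)) where
  carrier := {X | ∃ K : Set M, IsCompact K ∧ ∀ x ∉ K,
    (∀ i j, X.1 i j x = 0) ∧ (∀ i, X.2.1 i x = 0) ∧ ∀ f, X.2.2 f x = 0}
  zero_mem' := ⟨∅, isCompact_empty, fun _ _ => ⟨fun _ _ => rfl, fun _ => rfl, fun _ => rfl⟩⟩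
  add_mem' := by
    rintro X Y ⟨K, hK, hX⟩ ⟨L, hL, hY⟩
    refine ⟨K ∪ L, hK.union hL, fun x hx => ?_⟩
    obtain ⟨h1, h2, h3⟩ := hX x (fun h => hx (Or.inl h))
    obtain ⟨k1, k2, k3⟩ := hY x (fun h => hx (Or.inr h))
    refine ⟨fun i j => ?_, fun i => ?_, fun f => ?_⟩
    · change X.1 i j x + Y.1 i j x = 0
      rw [h1, k1, add_zero]
    · change X.2.1 i x + Y.2.1 i x = 0
      rw [h2, k2, add_zero]
    · change X.2.2 f x + Y.2.2 f x = 0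
      rw [h3, k3, add_zero]
  smul_mem' := by
    rintro c X ⟨K, hK, hX⟩
    refine ⟨K, hK, fun x hx => ?_⟩
    obtain ⟨h1, h2, h3⟩ := hX x hx
    refine ⟨fun i j => ?_, fun i => ?_, fun f => ?_⟩
    · change c * X.1 i j x = 0
      rw [h1, mul_zero]
    · change c * X.2.1 i x = 0
      rw [h2, mul_zero]
    · change c * X.2.2 f x = 0
      rw [h3, mul_zero]

variable (d n M) in
/-- The Lie algebra `Lie 𝓖_c(M)` of compactly supported infinitesimal symmetries `(a, p, v)`. -/
abbrev LieGc := ↥(lieGcSubmodule d n M)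

namespace LieGc

/-- The linear part of an infinitesimal symmetry. -/
def a (X : LieGc d n M) : Matrix (Fin n) (Fin n) (Smooth d M) := X.val.1

/-- The translation part of an infinitesimal symmetry. -/
def p (X : LieGc d n M) : Conf d n M := X.val.2.1

/-- The vector field of an infinitesimal symmetry. -/
def v (X : LieGc d n M) : Derivation ℝ (Smooth d M) (Smooth d M) := X.val.2.2

/-- `φ X = φ a + v^μ ∂_μ φ + p`. -/
def act (X : LieGc d n M) (φ : Conf d n M) : Conf d n M :=
  φ ᵥ* X.a + (fun i => X.v (φ i)) + X.p

/-- `[(a,p,v),(b,q,w)] =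
([a,b] + w^ν∂_ν a - v^ν∂_ν b, p b - q a + w^ν∂_ν p - v^ν∂_ν q, w^ν∂_ν v - v^ν∂_ν w)`. -/
instance : Bracket (LieGc d n M) (LieGc d n M) where
  bracket X Y := ⟨(X.a * Y.a - Y.a * X.a + Matrix.map X.a Y.v - Matrix.map Y.a X.v,
    X.p ᵥ* Y.a - Y.p ᵥ* X.a + (fun i => Y.v (X.p i)) - (fun i => X.v (Y.p i)), ⁅Y.v, X.v⁆), by
    obtain ⟨K, hK, hX⟩ := X.property
    obtain ⟨L, hL, hY⟩ := Y.property
    refine ⟨K ∪ L, hK.union hL, fun x hx => ?_⟩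
    obtain ⟨h1, h2, h3⟩ := hX x (fun h => hx (Or.inl h))
    obtain ⟨k1, k2, k3⟩ := hY x (fun h => hx (Or.inr h))
    have hp : ∀ i, (X.p ᵥ* Y.a) i x = 0 := Gc.vecMul_eq_zero_at x X.p Y.a h2
    have hq : ∀ i, (Y.p ᵥ* X.a) i x = 0 := Gc.vecMul_eq_zero_at x Y.p X.a k2
    have hab : ∀ i j, (X.a * Y.a) i j x = 0 := fun i j =>
      Gc.vecMul_eq_zero_at x (X.a i) Y.a (h1 i) j
    have hba : ∀ i j, (Y.a * X.a) i j x = 0 := fun i j =>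
      Gc.vecMul_eq_zero_at x (Y.a i) X.a (k1 i) j
    refine ⟨fun i j => ?_, fun i => ?_, fun f => ?_⟩
    · change (X.a * Y.a) i j x - (Y.a * X.a) i j x + Y.v (X.a i j) x - X.v (Y.a i j) x = 0
      have e1 : X.v (Y.a i j) x = 0 := h3 _
      have e2 : Y.v (X.a i j) x = 0 := k3 _
      rw [hab, hba, e1, e2]; simp
    · change (X.p ᵥ* Y.a) i x - (Y.p ᵥ* X.a) i x + Y.v (X.p i) x - X.v (Y.p i) x = 0
      have e1 : X.v (Y.p i) x = 0 := h3 _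
      have e2 : Y.v (X.p i) x = 0 := k3 _
      rw [hp, hq, e1, e2]; simp
    · change (⁅Y.v, X.v⁆ : Derivation ℝ (Smooth d M) (Smooth d M)) f x = 0
      rw [Derivation.commutator_apply]
      have e1 : X.v (Y.v f) x = 0 := h3 _
      have e2 : Y.v (X.v f) x = 0 := k3 _
      change Y.v (X.v f) x - X.v (Y.v f) x = 0
      rw [e1, e2, sub_zero]⟩

end LieGc

end Group

/-! ### Action on functionals and the free Lagrangian -/

section Action

variable {d n : ℕ} {M : Type*} [TopologicalSpace M] [ChartedSpace (EuclideanSpace ℝ (Fin d)) M]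
  [MeasurableSpace M] (S : Spacetime d M) (m : ℝ)

/-- The free Lagrangian density with mass `m` (with respect to the volume measure):
`½ ∑_a (⟨dφ_a, dφ_a⟩ - m² φ_a²)`. -/
def lagr (φ : Conf d n M) (x : M) : ℝ :=
  (1 / 2) * ∑ i, (S.coMetric x (dAt (φ i) x) (dAt (φ i) x) - m ^ 2 * φ i x ^ 2)

/-- `δ_g L = g_* L(f) - L(f)`, where `L(f)[φ] = ∫ f · lagr φ dvol` and `f` is any test function
with `f = 1` on `supp g`; the difference of the densities vanishes off `supp g`. -/
def deltaL (g : Gc d n M) : Functional d n M :=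
  fun φ => ∫ x, (lagr S m (g.act φ) x - lagr S m φ x) ∂S.vol

/-- The action `g_L F = δ_g L + g_* F` with `g_* F[φ] = F[g φ]`. -/
def actL (g : Gc d n M) (F : Functional d n M) : Functional d n M :=
  fun φ => deltaL S m g φ + F (g.act φ)

/-- `∂_X F[φ] = ⟨F'[φ], φ X⟩`. -/
def partialX (X : LieGc d n M) (F : Functional d n M) : Functional d n M :=
  dirDer X.act F

/-- `∂_X L = ∂_X (L(f))` for any test function `f` with `f = 1` on `supp X`; the derivative of
the density along `φ X` vanishes off `supp X`. -/
def partialXL (X : LieGc d n M) : Functional d n M :=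
  fun φ => ∫ x, deriv (fun t : ℝ => lagr S m (φ + t • X.act φ) x) 0 ∂S.vol

/-- `∂_X (F + L)` as a formal series in `F`: `∂_X L` is of order `0`, `∂_X F` of order `1`. -/
def partialXFL (X : LieGc d n M) (F : Functional d n M) : ℕ → Functional d n M :=
  fun l => if l = 0 then partialXL S m X else if l = 1 then partialX X F else 0

variable {S}

/-- `(∂_X z)(F) = ∂_X (z(F)) - ⟨z'(F), ∂_X (F + L)⟩`, order by order. -/
def covDer (X : LieGc d n M) (z : FormalSeries n S) (F : Functional d n M) (k : ℕ) :
    Functional d n M :=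
  partialX X (z.comp k F) - z.der F (partialXFL S m X F) k

/-! ### Anomaly maps -/

/-- Smoothness of `ζ : 𝓖_c(M) → 𝓡_c`: the coefficients send smooth families of symmetries and of
local functionals (vanishing at `0`) to smooth families of local functionals. -/
def IsSmoothAnomaly (ζ : Gc d n M → Rc n S) : Prop :=
  ∀ (P : Type) [NormedAddCommGroup P] [NormedSpace ℝ P] [FiniteDimensional ℝ P]
    (g : P → Gc d n M), IsSmoothSymFamily g →
    ∀ (k : ℕ) (F : Fin k → P → Functional d n M),
      (∀ i, IsLocalFamily S (F i)) → (∀ i s, F i s 0 = 0) →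
      IsLocalFamily S (fun s => (ζ (g s)).pert.app k (∏ i, F i s))

/-- The cocycle relation `ζ_{gh} = ζ_h h_L⁻¹ ζ_g h_L` of formal power series. Since `h_L` is
affine with inhomogeneous term `δ_h L`, the right-hand side is a power series in `F` and `δ_h L`,
and the relation is one of formal power series in `F` and in the parameters of `h`: for all smooth
families `g_s`, `h_s` with `h_0 = e`, both sides, evaluated at `κ F`, have the same expansion in
`(s, κ)` at `0` to every order. -/
def IsCocycle (ζ : Gc d n M → Rc n S) : Prop :=
  ∀ (P : Type) [NormedAddCommGroup P] [NormedSpace ℝ P] [FiniteDimensional ℝ P]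
    (g h : P → Gc d n M), IsSmoothSymFamily g → IsSmoothSymFamily h → h 0 = 1 →
    ∀ F ∈ Floc n S, ∀ (φ : Conf d n M) (N : ℕ),
      (fun q : P × ℝ =>
        (ζ (g q.1 * h q.1)).partialSum N (q.2 • F) φ -
        (ζ (h q.1)).partialSum N (actL S m (h q.1)⁻¹
          ((ζ (g q.1)).partialSum N (actL S m (h q.1) (q.2 • F)))) φ)
      =O[𝓝 0] (fun q => ‖q‖ ^ (N + 1))

/-- `X` is the tangent vector at `0` of the curve `g` in `𝓖_c(M)`, `g 0 = e`. -/
def IsTangent (g : ℝ → Gc d n M) (X : LieGc d n M) : Prop :=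
  g 0 = 1 ∧ ∀ x : M,
    (∀ i j, HasDerivAt (fun l => (g l).A.val i j x) (X.a i j x) 0) ∧
    (∀ i, HasDerivAt (fun l => (g l).ψ i x) (X.p i x) 0) ∧
    ∀ f : Smooth d M, HasDerivAt (fun l => f ((g l).ρ x)) (X.v f x) 0

/-- `Δ X = d/dλ ζ_{g^λ}` at `λ = 0` for every smooth curve `g^λ` through `e` with tangent vector
`X`, coefficient by coefficient. -/
def IsInfinitesimalAnomaly (ζ : Gc d n M → Rc n S) (Δ : LieGc d n M → LieRc n S) : Prop :=
  ∀ (X : LieGc d n M) (g : ℝ → Gc d n M), IsSmoothSymFamily g → IsTangent g X →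
    ∀ (k : ℕ) (G : Functional d n M), G ∈ Fnloc n S k → ∀ φ,
      HasDerivAt (fun l => (ζ (g l)).pert.app k G φ) ((Δ X).series.app k G φ) 0

end Action

end AMWI

end

open scoped Manifold ContDiff Topology Matrix
open MeasureTheory

noncomputable section

set_option linter.unusedSectionVars false

namespace AMWI

/-! ### Differentiation under integrals over compact subsets of a manifold -/

section ParametricIntegral

variable {E : Type*} [NormedAddCommGroup E] [NormedSpace ℝ E]
  {EX : Type*} [NormedAddCommGroup EX] [NormedSpace ℝ EX] {HX : Type*} [TopologicalSpace HX]
  {J : ModelWithCorners ℝ EX HX} {X : Type*} [TopologicalSpace X] [ChartedSpace HX X]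

/-! The Wess–Zumino condition is the cocycle relation differentiated once in each of two group
parameters. Let `g`, `h` be curves through the unit with tangent vectors `X`, `Y`. The element `g_s
h_t` is a product in two ways: of `g_s` and `h_t`, and of `h_t` and the conjugate `h_t⁻¹ g_s h_t`.
Apply the cocycle relation to both and take `∂_t ∂_s` at the origin (`mixedDeriv_cocycle`). The
first factorization gives `⟨(ΔY)'(F), ΔX(F)⟩ + ⟨(ΔX)'(F), ∂_Y(F+L)⟩ - ∂_Y(ΔX(F))`. The second gives
the same with `X` and `Y` exchanged, plus the mixed derivative of `ζ` along the conjugate. The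
conjugate has tangent vector `X + t W_t` with `W_0 = [X,Y]` (`exists_isTangent_conj`), so this extra
term is `Δ[X,Y](F)`. Since mixed derivatives commute, the two results agree, and this is the claim
(`wessZumino`).

The individual terms come from `h_L⁻¹ ζ_g h_L(F) = F + U`, where `U` is the perturbation part of
`ζ_g` at `h_L F`, evaluated at `h⁻¹φ`. Differentiating `ζ_g` produces the infinitesimal anomaly,
differentiating `h_L F` produces `∂(F+L)`, and differentiating `h⁻¹` produces minus the derivative
along the field. The outer map `ζ_h` contributes, by the product rule, the term `⟨Δ'(F), Δ(F)⟩`.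

The cocycle relation is only an estimate for truncated series at `κF`. The truncation defect
`E(s,t,κ)` is smooth and vanishes for `s = 0` and for `t = 0`, so `E = s t R` with `R` smooth by
Hadamard's lemma. On the curve `s = t = κ^(k+1)` a defect of order `3k+3` forces `R(0,0,κ) =
O(κ^(k+1))`; thus `∂_t ∂_s E` is a polynomial in `κ` whose coefficients up to order `k` vanish
(`isBigO_deriv_deriv_of_isBigO`, `coeff_eq_of_isBigO`). The same argument with one parameter shows
that `Δ` is additive.

The remaining work is to justify the derivatives. No topology on functionals is used: Hadamard
quotients of smooth families of local functionals are again such families (`IsLocalFamily.dslope`),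
which makes derivatives local and turns every product rule into algebra. Symmetries preserve local
families (`IsLocalFamily.act`), which requires a smooth Jacobian for the volume measure
(`map_diffeomorph_vol`). Every smooth family of infinitesimal symmetries is tangent to a smooth
family of curves (`hasCurves_of_isSmoothLieFamily`); the parameter is needed to see that `Δ(W_t)` is
continuous in `t`. -/

theorem contMDiff_prod_iff_contDiff {F G : Type*} [NormedAddCommGroup F] [NormedSpace ℝ F]
    [NormedAddCommGroup G] [NormedSpace ℝ G] {f : E × F → G} :
    ContMDiff (𝓘(ℝ, E).prod 𝓘(ℝ, F)) 𝓘(ℝ, G) ∞ f ↔ ContDiff ℝ ∞ f := by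
  rw [← contMDiff_iff_contDiff, modelWithCornersSelf_prod, ← chartedSpaceSelf_prod]

theorem contMDiff_slice {f : E → X → ℝ}
    (hf : ContMDiff (𝓘(ℝ, E).prod J) 𝓘(ℝ) ∞ (fun q : E × X => f q.1 q.2)) (x : X) :
    ContDiff ℝ ∞ (fun e => f e x) := by
  rw [← contMDiff_iff_contDiff]
  exact hf.comp (contMDiff_id.prodMk contMDiff_const)

variable [IsManifold J 1 X]

/-- Partial derivatives of jointly smooth functions are jointly smooth. -/
theorem contMDiff_partialDeriv {f : E → X → ℝ}
    (hf : ContMDiff (𝓘(ℝ, E).prod J) 𝓘(ℝ) ∞ (fun q : E × X => f q.1 q.2)) (v : E) :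
    ContMDiff (𝓘(ℝ, E).prod J) 𝓘(ℝ) ∞
      (fun q : E × X => fderiv ℝ (fun e => f e q.2) q.1 v) := by
  intro q
  have h1 : ContMDiffAt ((𝓘(ℝ, E).prod J).prod 𝓘(ℝ, E)) 𝓘(ℝ) ∞
      (Function.uncurry (fun (q : E × X) (e : E) => f e q.2)) (q, q.1) := by
    have : ContMDiff ((𝓘(ℝ, E).prod J).prod 𝓘(ℝ, E)) (𝓘(ℝ, E).prod J) ∞
        (fun r : (E × X) × E => (r.2, r.1.2)) :=
      contMDiff_snd.prodMk (contMDiff_snd.comp contMDiff_fst)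
    exact (hf.comp this) _
  have h2 := ContMDiffAt.mfderiv (m := ∞) (fun (q : E × X) (e : E) => f e q.2) Prod.fst h1
    contMDiffAt_fst le_rfl
  -- Between vector spaces the tangent coordinate changes are trivial, so the derivative in tangent
  -- coordinates is the plain derivative.
  have h4 := inTangentCoordinates_model_space (I := 𝓘(ℝ, E)) (I' := 𝓘(ℝ, ℝ))
    (Prod.fst : E × X → E) (fun x => f x.1 x.2)
    (fun x => mfderiv 𝓘(ℝ, E) 𝓘(ℝ, ℝ) (fun e => f e x.2) x.1) q
  rw [h4] at h2
  have h3 := h2.clm_apply (contMDiffAt_const (c := v))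
  simpa only [mfderiv_eq_fderiv] using h3

variable [MeasurableSpace X] [OpensMeasurableSpace X]

/-- The derivative of the integrand is bounded on the compact product of a closed unit ball with
`K`, so dominated differentiation applies. The derivative is given through its values on vectors
because these are again integrals of jointly smooth functions. -/
theorem hasFDerivAt_setIntegral [FiniteDimensional ℝ E] {f : E → X → ℝ}
    (hf : ContMDiff (𝓘(ℝ, E).prod J) 𝓘(ℝ) ∞ (fun q : E × X => f q.1 q.2))
    {μ : Measure X} {K : Set X} (hK : IsCompact K) (hKm : MeasurableSet K) (hμ : μ K < ⊤) (e : E) :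
    ∃ L : E →L[ℝ] ℝ, HasFDerivAt (fun e => ∫ x in K, f e x ∂μ) L e ∧
      ∀ v, L v = ∫ x in K, fderiv ℝ (fun e => f e x) e v ∂μ := by
  classical
  have : IsFiniteMeasure (μ.restrict K) := ⟨by simpa using hμ⟩
  have hdc : ∀ v, Continuous (fun q : E × X => fderiv ℝ (fun e => f e q.2) q.1 v) := fun v =>
    (contMDiff_partialDeriv hf v).continuous
  have hd : Continuous (fun q : E × X => fderiv ℝ (fun e => f e q.2) q.1) :=
    continuous_clm_apply.2 hdc
  have hcpt : IsCompact (Metric.closedBall e 1 ×ˢ K) := (isCompact_closedBall e 1).prod hK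
  obtain ⟨C, hC⟩ := (hcpt.image_of_continuousOn hd.norm.continuousOn).bddAbove
  have hint : ∀ {g : X → ℝ}, Continuous g → Integrable g (μ.restrict K) := fun hg =>
    hg.continuousOn.integrableOn_of_subset_isCompact hK hKm subset_rfl hμ.ne
  have hslice : ∀ e, Continuous (fun x => f e x) := fun e =>
    hf.continuous.comp (Continuous.prodMk_right e)
  have hF' : AEStronglyMeasurable (fun x => fderiv ℝ (fun e => f e x) e) (μ.restrict K) :=
    (hd.comp (Continuous.prodMk_right e)).aestronglyMeasurable
  have hbd : ∀ᵐ x ∂(μ.restrict K), ∀ e' ∈ Metric.ball e 1,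
      ‖fderiv ℝ (fun e => f e x) e'‖ ≤ C := by
    filter_upwards [ae_restrict_mem hKm] with x hx e' he'
    exact hC ⟨(e', x), ⟨Metric.ball_subset_closedBall he', hx⟩, rfl⟩
  have key := hasFDerivAt_integral_of_dominated_of_fderiv_le (μ := μ.restrict K) (𝕜 := ℝ)
    (F := fun e x => f e x) (F' := fun e' x => fderiv ℝ (fun e => f e x) e') (x₀ := e)
    (bound := fun _ => C) (Metric.ball_mem_nhds e one_pos)
    (Filter.Eventually.of_forall fun e' => (hslice e').aestronglyMeasurable)
    (hint (hslice e)) hF' hbd (integrable_const C)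
    (Filter.Eventually.of_forall fun x e' _ =>
      ((contMDiff_slice hf x).differentiable (by simp) e').hasFDerivAt)
  refine ⟨_, key, fun v => ?_⟩
  have hi : Integrable (fun x => fderiv ℝ (fun e => f e x) e) (μ.restrict K) :=
    (integrable_const C).mono' hF' (by
      filter_upwards [hbd] with x hx using hx e (Metric.mem_ball_self one_pos))
  exact ContinuousLinearMap.integral_apply hi v

/-- Induction on the order of differentiability for all integrands at once: each directional
derivative is an integral of the same type, with the integrand replaced by its partial derivative.
-/
theorem contDiff_setIntegral [FiniteDimensional ℝ E] {f : E → X → ℝ}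
    (hf : ContMDiff (𝓘(ℝ, E).prod J) 𝓘(ℝ) ∞ (fun q : E × X => f q.1 q.2))
    {μ : Measure X} {K : Set X} (hK : IsCompact K) (hKm : MeasurableSet K) (hμ : μ K < ⊤) :
    ContDiff ℝ ∞ (fun e => ∫ x in K, f e x ∂μ) := by
  rw [contDiff_infty]
  intro k
  induction k generalizing f with
  | zero =>
    rw [Nat.cast_zero, contDiff_zero]
    exact continuous_iff_continuousAt.2 fun e =>
      (hasFDerivAt_setIntegral hf hK hKm hμ e).choose_spec.1.continuousAt
  | succ k ih =>
    rw [Nat.cast_succ, contDiff_succ_iff_fderiv_apply]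
    refine ⟨fun e => (hasFDerivAt_setIntegral hf hK hKm hμ e).choose_spec.1.differentiableAt,
      by simp, fun v => ?_⟩
    have : (fun e => fderiv ℝ (fun e => ∫ x in K, f e x ∂μ) e v) =
        fun e => ∫ x in K, fderiv ℝ (fun e => f e x) e v ∂μ := funext fun e => by
      obtain ⟨L, hL, hv⟩ := hasFDerivAt_setIntegral hf hK hKm hμ e
      rw [hL.fderiv, hv]
    rw [this]
    exact ih (f := fun e x => fderiv ℝ (fun e => f e x) e v) (contMDiff_partialDeriv hf v)

end ParametricIntegral

/-! ### Hadamard's lemma with parameters -/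

section Dslope

/-- Hadamard's lemma for functions on a vector space. -/
theorem contDiff_dslope {E : Type*} [NormedAddCommGroup E] [NormedSpace ℝ E]
    [FiniteDimensional ℝ E] {f : ℝ → E → ℝ}
    (hf : ContDiff ℝ ∞ (fun q : ℝ × E => f q.1 q.2)) :
    ContDiff ℝ ∞ (fun q : ℝ × E => dslope (fun s => f s q.2) 0 q.1) := by
  have hs : ∀ x, ContDiff ℝ ∞ (fun s => f s x) := fun x =>
    hf.comp (contDiff_id.prodMk contDiff_const)
  have hd : ContDiff ℝ ∞ (fun q : ℝ × E => deriv (fun s => f s q.2) q.1) := by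
    have := contMDiff_partialDeriv (J := 𝓘(ℝ, E)) (f := f)
      (contMDiff_prod_iff_contDiff.2 hf) 1
    exact contMDiff_prod_iff_contDiff.1 this
  -- The quotient is the average of the derivative over the segment from `0` to `s`. Unlike the
  -- quotient, this formula also covers `s = 0`, and it is a parametric integral.
  have h1 : (fun q : ℝ × E => dslope (fun s => f s q.2) 0 q.1) =
      fun q : ℝ × E => ∫ t in Set.Icc (0 : ℝ) 1, deriv (fun s => f s q.2) (t * q.1) := by
    funext ⟨s, x⟩
    rw [integral_Icc_eq_integral_Ioc, ← intervalIntegral.integral_of_le zero_le_one]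
    rcases eq_or_ne s 0 with rfl | h0
    · simp
    · have h2 := intervalIntegral.integral_comp_mul_right (a := 0) (b := 1)
        (fun u => deriv (fun s => f s x) u) h0
      simp only [dslope_of_ne _ h0, slope_def_field, sub_zero]
      rw [h2, intervalIntegral.integral_deriv_eq_sub]
      · simp [div_eq_inv_mul]
      · exact fun u _ => (hs x).differentiable (by simp) u
      · exact ((hs x).continuous_deriv (by simp)).intervalIntegrable _ _
  rw [h1]
  refine contDiff_setIntegral (J := 𝓘(ℝ, ℝ)) (E := ℝ × E)
    (f := fun q t => deriv (fun s => f s q.2) (t * q.1)) ?_ isCompact_Icc measurableSet_Icc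
    (by simp)
  refine contMDiff_prod_iff_contDiff.2 ?_
  exact (hd.comp ((contDiff_snd.mul (contDiff_fst.comp contDiff_fst)).prodMk
    (contDiff_snd.comp contDiff_fst)))


/-- Hadamard's lemma with parameters in a manifold. -/
theorem contMDiff_dslope {E : Type*} [NormedAddCommGroup E] [NormedSpace ℝ E]
    [FiniteDimensional ℝ E] {H : Type*} [TopologicalSpace H] {I : ModelWithCorners ℝ E H}
    [I.Boundaryless] {N : Type*} [TopologicalSpace N] [ChartedSpace H N] [IsManifold I ∞ N]
    {f : ℝ → N → ℝ}
    (hf : ContMDiff (𝓘(ℝ).prod I) 𝓘(ℝ) ∞ (fun q : ℝ × N => f q.1 q.2)) :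
    ContMDiff (𝓘(ℝ).prod I) 𝓘(ℝ) ∞ (fun q : ℝ × N => dslope (fun s => f s q.2) 0 q.1) := by
  rintro ⟨s₀, n₀⟩
  set c := extChartAt I n₀ with hc
  have htar : c.target ∈ 𝓝 (c n₀) := extChartAt_target_mem_nhds n₀
  have hopen : IsOpen c.target := isOpen_extChartAt_target n₀
  obtain ⟨ε, hε, hball⟩ := Metric.nhds_basis_closedBall.mem_iff.1 htar
  -- Multiplying by a bump function supported in the chart target extends the coordinate expression
  -- by zero to the whole vector space, where the previous version applies.
  let β : ContDiffBump (c n₀) := ⟨ε / 2, ε, by linarith, by linarith⟩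
  have hβ : tsupport β ⊆ c.target := by rw [β.tsupport_eq]; exact hball
  have hg : ContDiff ℝ ∞ (fun q : ℝ × E => β q.2 * f q.1 (c.symm q.2)) := by
    rw [contDiff_iff_contDiffAt]
    rintro ⟨s, u⟩
    by_cases hu : u ∈ c.target
    · have h1 : ContMDiffAt (𝓘(ℝ).prod 𝓘(ℝ, E)) 𝓘(ℝ) ∞
          (fun q : ℝ × E => f q.1 (c.symm q.2)) (s, u) := by
        have h2 : ContMDiffAt 𝓘(ℝ, E) I ∞ c.symm u :=
          (contMDiffOn_extChartAt_symm n₀).contMDiffAt (hopen.mem_nhds hu)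
        exact hf.contMDiffAt.comp (s, u) (contMDiffAt_fst.prodMk
          (ContMDiffAt.comp (s, u) h2 contMDiffAt_snd))
      have h3 : ContDiffAt ℝ ∞ (fun q : ℝ × E => f q.1 (c.symm q.2)) (s, u) := by
        rw [← contMDiffAt_iff_contDiffAt, modelWithCornersSelf_prod, ← chartedSpaceSelf_prod]
        exact h1
      exact (β.contDiff.comp contDiff_snd).contDiffAt.mul h3
    · have h1 : ∀ᶠ q : ℝ × E in 𝓝 (s, u), β q.2 * f q.1 (c.symm q.2) = 0 := by
        have h2 : (tsupport β)ᶜ ∈ 𝓝 u :=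
          (isClosed_tsupport _).isOpen_compl.mem_nhds fun h => hu (hβ h)
        filter_upwards [continuousAt_snd.preimage_mem_nhds h2] with q hq
        rw [image_eq_zero_of_notMem_tsupport hq, zero_mul]
      exact contDiffAt_const.congr_of_eventuallyEq h1
  have h1 : ∀ᶠ q : ℝ × N in 𝓝 (s₀, n₀), dslope (fun s => f s q.2) 0 q.1 =
      dslope (fun s => β (c q.2) * f s (c.symm (c q.2))) 0 q.1 := by
    have h2 : ∀ᶠ n in 𝓝 n₀, n ∈ c.source := extChartAt_source_mem_nhds n₀
    have h3 : ∀ᶠ n in 𝓝 n₀, β (c n) = 1 :=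
      (continuousAt_extChartAt n₀).eventually β.eventuallyEq_one
    filter_upwards [continuousAt_snd.eventually h2, continuousAt_snd.eventually h3] with q h4 h5
    rw [h5, c.left_inv h4]
    simp
  refine ContMDiffAt.congr_of_eventuallyEq ?_ h1
  have h2 := contMDiff_prod_iff_contDiff.2 (contDiff_dslope (f := fun s u => β u * f s (c.symm u)) hg)
  exact h2.contMDiffAt.comp (s₀, n₀) (f := fun q : ℝ × N => (q.1, c q.2))
    (contMDiffAt_fst.prodMk (ContMDiffAt.comp (s₀, n₀)
      (contMDiffAt_extChartAt (I := I) (n := ∞)) contMDiffAt_snd))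

end Dslope

/-! ### Diagonal and mixed derivatives, orders of vanishing -/

section Calculus

variable {E : Type*} [NormedAddCommGroup E] [NormedSpace ℝ E]

theorem contDiff_deriv_zero [FiniteDimensional ℝ E] {f : ℝ → E → ℝ}
    (hf : ContDiff ℝ ∞ (fun q : ℝ × E => f q.1 q.2)) :
    ContDiff ℝ ∞ (fun e => deriv (fun s => f s e) 0) := by
  have := (contDiff_dslope hf).comp (contDiff_const (c := (0 : ℝ)).prodMk contDiff_id)
  simpa [Function.comp_def, dslope_same] using this

theorem hasDerivAt_of_contDiff {f : ℝ → ℝ} (hf : ContDiff ℝ ∞ f) (x : ℝ) :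
    HasDerivAt f (deriv f x) x :=
  (hf.differentiable (by simp) x).hasDerivAt

/-- The form of the chain rule used throughout: when a parameter occurs in two places, differentiate
in each place with the other frozen at `0`. -/
theorem deriv_diag {f : ℝ → ℝ → ℝ} (hf : ContDiff ℝ ∞ (fun q : ℝ × ℝ => f q.1 q.2)) :
    deriv (fun t => f t t) 0 = deriv (fun t => f t 0) 0 + deriv (fun t => f 0 t) 0 := by
  have hd := (hf.differentiable (by simp) (0, 0)).hasFDerivAt
  have h1 : HasDerivAt (fun t : ℝ => (t, t)) ((1 : ℝ), (1 : ℝ)) 0 :=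
    (hasDerivAt_id _).prodMk (hasDerivAt_id _)
  have h2 : HasDerivAt (fun t : ℝ => (t, (0 : ℝ))) ((1 : ℝ), (0 : ℝ)) 0 :=
    (hasDerivAt_id _).prodMk (hasDerivAt_const _ _)
  have h3 : HasDerivAt (fun t : ℝ => ((0 : ℝ), t)) ((0 : ℝ), (1 : ℝ)) 0 :=
    (hasDerivAt_const _ _).prodMk (hasDerivAt_id _)
  have e1 := (hd.comp_hasDerivAt_of_eq (0 : ℝ) h1 rfl).deriv
  have e2 := (hd.comp_hasDerivAt_of_eq (0 : ℝ) h2 rfl).deriv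
  have e3 := (hd.comp_hasDerivAt_of_eq (0 : ℝ) h3 rfl).deriv
  simp only [Function.comp_def] at e1 e2 e3
  rw [e1, e2, e3, ← map_add]
  simp

theorem deriv_deriv_comm {f : ℝ → ℝ → ℝ} (hf : ContDiff ℝ ∞ (fun q : ℝ × ℝ => f q.1 q.2)) :
    deriv (fun s => deriv (fun t => f s t) 0) 0 = deriv (fun t => deriv (fun s => f s t) 0) 0 := by
  let F : ℝ × ℝ → ℝ := fun q => f q.1 q.2
  have hd : ∀ q, HasFDerivAt F (fderiv ℝ F q) q := fun q =>
    (hf.differentiable (by simp) q).hasFDerivAt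
  have hF2 : ContDiff ℝ ∞ (fderiv ℝ F) := hf.fderiv_right (by simp)
  have hd2 : HasFDerivAt (fderiv ℝ F) (fderiv ℝ (fderiv ℝ F) (0, 0)) (0, 0) :=
    (hF2.differentiable (by simp) _).hasFDerivAt
  have h2 : ∀ s t, HasDerivAt (fun t : ℝ => (s, t)) ((0 : ℝ), (1 : ℝ)) t := fun s t =>
    (hasDerivAt_const _ _).prodMk (hasDerivAt_id _)
  have h1 : ∀ s t, HasDerivAt (fun s : ℝ => (s, t)) ((1 : ℝ), (0 : ℝ)) s := fun s t =>
    (hasDerivAt_id _).prodMk (hasDerivAt_const _ _)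
  have e1 : (fun s => deriv (fun t => f s t) 0) = fun s => fderiv ℝ F (s, 0) (0, 1) :=
    funext fun s => ((hd (s, 0)).comp_hasDerivAt_of_eq (0 : ℝ) (h2 s 0) rfl).deriv
  have e2 : (fun t => deriv (fun s => f s t) 0) = fun t => fderiv ℝ F (0, t) (1, 0) :=
    funext fun t => ((hd (0, t)).comp_hasDerivAt_of_eq (0 : ℝ) (h1 0 t) rfl).deriv
  rw [e1, e2]
  have e3 := (hd2.comp_hasDerivAt_of_eq (0 : ℝ) (h1 0 0) rfl).clm_apply
    (hasDerivAt_const (0 : ℝ) ((0 : ℝ), (1 : ℝ)))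
  have e4 := (hd2.comp_hasDerivAt_of_eq (0 : ℝ) (h2 0 0) rfl).clm_apply
    (hasDerivAt_const (0 : ℝ) ((1 : ℝ), (0 : ℝ)))
  have e3' := e3.deriv
  have e4' := e4.deriv
  simp only [Function.comp_def, map_zero, add_zero] at e3' e4'
  rw [e3', e4']
  exact second_derivative_symmetric hd hd2 _ _

theorem eq_mul_dslope {f : ℝ → ℝ} (h0 : f 0 = 0) (s : ℝ) : f s = s * dslope f 0 s := by
  have := sub_smul_dslope f 0 s
  simp only [sub_zero, h0, smul_eq_mul] at this
  exact this.symm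

open Asymptotics

/-- Otherwise split off the lowest nonzero power, `p = X^j q` with `j ≤ k` and `q(0) ≠ 0`. Dividing
the bound by `|x|^j` leaves `|q(x)| ≤ C|x|`, hence `q(0) = 0`. -/
theorem coeff_eq_zero_of_isBigO (p : Polynomial ℝ) (k : ℕ)
    (h : (fun x : ℝ => p.eval x) =O[𝓝 0] fun x => x ^ (k + 1)) :
    ∀ j ≤ k, p.coeff j = 0 := by
  by_contra! hcon
  obtain ⟨j, ⟨hj, hne⟩, hmin'⟩ : ∃ j, (j ≤ k ∧ p.coeff j ≠ 0) ∧
      ∀ i < j, ¬ (i ≤ k ∧ p.coeff i ≠ 0) := by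
    classical exact ⟨Nat.find hcon, Nat.find_spec hcon, fun _ => Nat.find_min hcon⟩
  have hmin : ∀ i < j, p.coeff i = 0 := fun i hi => by
    by_contra hne'
    exact hmin' i hi ⟨(hi.le.trans hj), hne'⟩
  obtain ⟨q, rfl⟩ := Polynomial.X_pow_dvd_iff.2 hmin
  have hq : q.eval 0 ≠ 0 := by
    rwa [← Polynomial.coeff_zero_eq_eval_zero, ← Polynomial.coeff_X_pow_mul q j 0, zero_add]
  obtain ⟨C, hC⟩ := h.bound
  have h1 : ∀ᶠ x : ℝ in 𝓝[≠] 0, |q.eval x| ≤ C * |x| := by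
    filter_upwards [hC.filter_mono nhdsWithin_le_nhds,
      (eventually_lt_nhds one_pos : ∀ᶠ x : ℝ in 𝓝 0, x < 1).filter_mono nhdsWithin_le_nhds,
      (eventually_gt_nhds (by norm_num) : ∀ᶠ x : ℝ in 𝓝 0, -1 < x).filter_mono nhdsWithin_le_nhds,
      self_mem_nhdsWithin] with x hx h1 h2 h0
    have hx0 : 0 < |x| := abs_pos.2 h0
    have hx1 : |x| ≤ 1 := abs_le.2 ⟨h2.le, h1.le⟩
    simp only [Polynomial.eval_mul, Polynomial.eval_pow, Polynomial.eval_X, norm_mul, norm_pow,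
      Real.norm_eq_abs] at hx
    have hC0 : 0 ≤ C := by
      by_contra hneg
      have := mul_neg_of_neg_of_pos (not_le.1 hneg) (pow_pos hx0 (k + 1))
      have := mul_nonneg (pow_nonneg hx0.le j) (abs_nonneg (q.eval x))
      linarith
    have h3 : |x| ^ (k + 1) ≤ |x| ^ j * |x| := by
      rw [← pow_succ]
      exact pow_le_pow_of_le_one hx0.le hx1 (by omega)
    have h4 : |x| ^ j * |q.eval x| ≤ |x| ^ j * (C * |x|) := by
      calc _ ≤ C * |x| ^ (k + 1) := hx
        _ ≤ C * (|x| ^ j * |x|) := by gcongr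
        _ = _ := by ring
    exact le_of_mul_le_mul_left h4 (pow_pos hx0 j)
  -- Division by `|x|^j` was only possible for `x ≠ 0`; continuity carries the bound to the origin.
  have h2 : Filter.Tendsto (fun x : ℝ => |q.eval x|) (𝓝[≠] 0) (𝓝 |q.eval 0|) :=
    (q.continuous.abs.tendsto 0).mono_left nhdsWithin_le_nhds
  have h3 : Filter.Tendsto (fun x : ℝ => C * |x|) (𝓝[≠] 0) (𝓝 (C * |(0 : ℝ)|)) :=
    ((continuous_const.mul continuous_abs).tendsto 0).mono_left nhdsWithin_le_nhds
  have := le_of_tendsto_of_tendsto h2 h3 h1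
  simp at this
  exact hq this


theorem isBigO_pow_pow_zero {a b : ℕ} (h : a ≤ b) :
    (fun x : ℝ => x ^ b) =O[𝓝 0] fun x => x ^ a := by
  obtain ⟨c, rfl⟩ := Nat.exists_eq_add_of_le h
  have : (fun x : ℝ => x ^ c) =O[𝓝 0] fun _ => (1 : ℝ) :=
    ((continuous_pow c).tendsto 0).isBigO_one ℝ
  simpa [pow_add] using (isBigO_refl (fun x : ℝ => x ^ a) (𝓝 0)).mul this

/-- The information on `R` sits on a curve `γ`, multiplied by `x^a`. Dividing by `x^a` costs `a`
orders, and moving from `γ` to `γ₀` costs nothing more, since `R` is locally Lipschitz and the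
curves differ by `O(x^(k+1))`. -/
theorem isBigO_of_isBigO_curve {R : E → ℝ} (hR : ContDiff ℝ ∞ R) {γ γ₀ : ℝ → E} (e : E)
    (hγ : Filter.Tendsto γ (𝓝 0) (𝓝 e)) (hγ₀ : Continuous γ₀) (he : γ₀ 0 = e) (k : ℕ)
    (hd : (fun x => γ x - γ₀ x) =O[𝓝 0] fun x => x ^ (k + 1)) (a m : ℕ) (hm : a + k + 1 ≤ m)
    (hO : (fun x => x ^ a * R (γ x)) =O[𝓝 0] fun x => x ^ m) :
    (fun x => R (γ₀ x)) =O[𝓝 0] fun x => x ^ (k + 1) := by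
  have h1 : (fun x : ℝ => R (γ x)) =O[𝓝[≠] 0] fun x => x ^ (k + 1) := by
    have h2 : (fun x : ℝ => x ^ m) =O[𝓝 0] fun x => x ^ a * x ^ (k + 1) := by
      simp only [← pow_add]
      exact isBigO_pow_pow_zero (by omega)
    have h3 := ((isBigO_refl (fun x : ℝ => (x ^ a)⁻¹) (𝓝[≠] 0)).mul
      ((hO.trans h2).mono nhdsWithin_le_nhds))
    refine (h3.congr' ?_ ?_) <;>
    · filter_upwards [self_mem_nhdsWithin] with x hx
      have : x ^ a ≠ 0 := pow_ne_zero _ hx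
      field_simp
  have h2 : (fun x : ℝ => R (γ x) - R (γ₀ x)) =O[𝓝 0] fun x => x ^ (k + 1) := by
    obtain ⟨C, U, hU, hL⟩ := (hR.of_le (by simp) : ContDiff ℝ 1 R).contDiffAt.exists_lipschitzOnWith (x := e)
    refine IsBigO.trans (IsBigO.of_bound C ?_) hd
    have := hγ₀.tendsto 0
    rw [he] at this
    filter_upwards [hγ.eventually hU, this.eventually hU] with x hx1 hx2
    exact hL.norm_sub_le hx1 hx2
  have h4 : (fun x : ℝ => R (γ₀ x)) =O[𝓝[≠] 0] fun x => x ^ (k + 1) := by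
    have := h1.sub (h2.mono nhdsWithin_le_nhds)
    simpa using this
  have hcont : Continuous (fun x : ℝ => R (γ₀ x)) := hR.continuous.comp hγ₀
  -- The estimate holds so far on a punctured neighbourhood; at `x = 0` it says that the left-hand
  -- side vanishes.
  have h5 : R (γ₀ 0) = 0 := by
    have t1 : Filter.Tendsto (fun x : ℝ => R (γ₀ x)) (𝓝[≠] 0) (𝓝 0) := h4.trans_tendsto (by
      have : Continuous (fun x : ℝ => x ^ (k + 1)) := by fun_prop
      have := (this.tendsto 0).mono_left (nhdsWithin_le_nhds (s := {0}ᶜ))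
      simpa using this)
    exact tendsto_nhds_unique ((hcont.tendsto 0).mono_left nhdsWithin_le_nhds) t1
  rw [← nhdsNE_sup_pure 0]
  refine h4.sup (IsBigO.of_bound 1 ?_)
  simp [h5]

omit [NormedSpace ℝ E] in
theorem isBigO_norm_pow_of_isBigO {γ : ℝ → E} (h : γ =O[𝓝 0] fun x => x) (m : ℕ) :
    (fun x => ‖γ x‖ ^ m) =O[𝓝 0] fun x : ℝ => x ^ m := h.norm_left.pow m

/-- Write `f = s r(s,x)` and put `s = x^(k+1)`. One factor `x^(k+1)` is lost in the division and one
is kept, whence `2k + 2`. -/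
theorem isBigO_deriv_of_isBigO {f : ℝ → ℝ → ℝ} (hf : ContDiff ℝ ∞ (fun q : ℝ × ℝ => f q.1 q.2))
    (h0 : ∀ x, f 0 x = 0) (k m : ℕ) (hm : 2 * k + 2 ≤ m)
    (hO : (fun q : ℝ × ℝ => f q.1 q.2) =O[𝓝 0] fun q => ‖q‖ ^ m) :
    (fun x => deriv (fun s => f s x) 0) =O[𝓝 0] fun x : ℝ => x ^ (k + 1) := by
  let γ : ℝ → ℝ × ℝ := fun x => (x ^ (k + 1), x)
  let γ₀ : ℝ → ℝ × ℝ := fun x => (0, x)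
  have hc : Filter.Tendsto γ (𝓝 0) (𝓝 0) := by
    have : Continuous γ := by fun_prop
    simpa [γ, Prod.zero_eq_mk] using this.tendsto 0
  have hpow : (fun x : ℝ => x ^ (k + 1)) =O[𝓝 0] fun x => x := by
    simpa using isBigO_pow_pow_zero (show 1 ≤ k + 1 by omega)
  have hγ : γ =O[𝓝 0] fun x => x := isBigO_prod_left.2 ⟨hpow, isBigO_refl _ _⟩
  have key := isBigO_of_isBigO_curve (contDiff_dslope hf) (γ := γ) (γ₀ := γ₀) 0 hc
    (by fun_prop) rfl k (isBigO_prod_left.2 ⟨by simpa [γ, γ₀] using isBigO_refl _ _,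
      by simpa [γ, γ₀] using isBigO_zero _ _⟩) (k + 1) m (by omega)
    (by
      have := (hO.comp_tendsto hc).trans (isBigO_norm_pow_of_isBigO hγ m)
      refine this.congr_left fun x => ?_
      exact eq_mul_dslope (f := fun s => f s x) (h0 x) (x ^ (k + 1)))
  simpa [γ₀, dslope_same] using key

/-- As before with `f = s t r(s,t,x)` on the curve `s = t = x^(k+1)`: two factors are lost and one
is kept, whence `3k + 3`. Vanishing on both hyperplanes `s = 0` and `t = 0` is what permits the
division by `s t`. -/
theorem isBigO_deriv_deriv_of_isBigO {f : ℝ → ℝ → ℝ → ℝ}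
    (hf : ContDiff ℝ ∞ (fun q : ℝ × ℝ × ℝ => f q.1 q.2.1 q.2.2))
    (h1 : ∀ t x, f 0 t x = 0) (h2 : ∀ s x, f s 0 x = 0) (k m : ℕ) (hm : 3 * k + 3 ≤ m)
    (hO : (fun q : (ℝ × ℝ) × ℝ => f q.1.1 q.1.2 q.2) =O[𝓝 0] fun q => ‖q‖ ^ m) :
    (fun x => deriv (fun t => deriv (fun s => f s t x) 0) 0) =O[𝓝 0] fun x : ℝ => x ^ (k + 1) := by
  let r₁ : ℝ → ℝ × ℝ → ℝ := fun s q => dslope (fun s => f s q.1 q.2) 0 s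
  have hr₁ : ContDiff ℝ ∞ (fun q : ℝ × ℝ × ℝ => r₁ q.1 q.2) :=
    contDiff_dslope (f := fun s (q : ℝ × ℝ) => f s q.1 q.2) hf
  have hr₁' : ContDiff ℝ ∞ (fun q : ℝ × ℝ × ℝ => r₁ q.2.1 (q.1, q.2.2)) :=
    hr₁.comp ((contDiff_fst.comp contDiff_snd).prodMk
      (contDiff_fst.prodMk (contDiff_snd.comp contDiff_snd)))
  have hr₂ := contDiff_dslope (f := fun t (q : ℝ × ℝ) => r₁ q.1 (t, q.2)) hr₁'
  -- The quotient by `s` still vanishes for `t = 0`, so a second division, by `t`, is possible.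
  have hr₁0 : ∀ s x, r₁ s (0, x) = 0 := fun s x => by
    have : (fun s => f s 0 x) = fun _ => 0 := funext fun s => h2 s x
    simp only [r₁, this]
    rcases eq_or_ne s 0 with rfl | hs
    · simp
    · simp [dslope_of_ne _ hs, slope_def_field]
  let γ : ℝ → ℝ × ℝ × ℝ := fun x => (x ^ (k + 1), x ^ (k + 1), x)
  let γ₀ : ℝ → ℝ × ℝ × ℝ := fun x => (0, 0, x)
  have hc : Filter.Tendsto γ (𝓝 0) (𝓝 0) := by
    have : Continuous γ := by fun_prop
    simpa [γ, Prod.zero_eq_mk] using this.tendsto 0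
  have hpow : (fun x : ℝ => x ^ (k + 1)) =O[𝓝 0] fun x => x := by
    simpa using isBigO_pow_pow_zero (show 1 ≤ k + 1 by omega)
  let γ' : ℝ → (ℝ × ℝ) × ℝ := fun x => ((x ^ (k + 1), x ^ (k + 1)), x)
  have hc' : Filter.Tendsto γ' (𝓝 0) (𝓝 0) := by
    have : Continuous γ' := by fun_prop
    simpa [γ', Prod.zero_eq_mk] using this.tendsto 0
  have hγ' : γ' =O[𝓝 0] fun x => x :=
    isBigO_prod_left.2 ⟨isBigO_prod_left.2 ⟨hpow, hpow⟩, isBigO_refl _ _⟩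
  have key := isBigO_of_isBigO_curve hr₂ (γ := γ) (γ₀ := γ₀) 0 hc
    (by fun_prop) rfl k (isBigO_prod_left.2 ⟨by simpa [γ, γ₀] using isBigO_refl _ _,
      isBigO_prod_left.2 ⟨by simpa [γ, γ₀] using isBigO_refl _ _,
      by simpa [γ, γ₀] using isBigO_zero _ _⟩⟩) (2 * (k + 1)) m (by omega)
    (by
      have := (hO.comp_tendsto hc').trans (isBigO_norm_pow_of_isBigO hγ' m)
      refine this.congr_left fun x => ?_
      have e1 := eq_mul_dslope (f := fun s => f s (x ^ (k + 1)) x) (h1 _ x) (x ^ (k + 1))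
      have e2 := eq_mul_dslope (f := fun t => r₁ (x ^ (k + 1)) (t, x)) (hr₁0 _ x) (x ^ (k + 1))
      change f (x ^ (k + 1)) (x ^ (k + 1)) x = x ^ (2 * (k + 1)) *
        dslope (fun t => r₁ (x ^ (k + 1)) (t, x)) 0 (x ^ (k + 1))
      have e3 : dslope (fun s => f s (x ^ (k + 1)) x) 0 (x ^ (k + 1)) =
        r₁ (x ^ (k + 1)) (x ^ (k + 1), x) := rfl
      rw [e1, e3, e2, two_mul, pow_add (n := k + 1), mul_assoc])
  simpa [γ₀, r₁, dslope_same] using key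

end Calculus

/-! ### Coordinates, differentials and Gram determinants -/

section Coordinates

variable {d : ℕ} {M : Type*} [TopologicalSpace M] [ChartedSpace (EuclideanSpace ℝ (Fin d)) M]
  [IsManifold (𝓡 d) ∞ M] [T2Space M]

/-- A function that is smooth near `x₀` agrees near `x₀` with a globally smooth function. -/
theorem exists_smooth_eventuallyEq {g : M → ℝ} {U : Set M} {x₀ : M} (hU : U ∈ 𝓝 x₀)
    (hg : ∀ x ∈ U, ContMDiffAt (𝓡 d) 𝓘(ℝ) ∞ g x) : ∃ f : Smooth d M, ∀ᶠ x in 𝓝 x₀, f x = g x := by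
  obtain ⟨β, -, hβ⟩ := (SmoothBumpFunction.nhds_basis_tsupport (I := 𝓡 d) x₀).mem_iff.1 hU
  refine ⟨⟨fun x => β x * g x, fun x => ?_⟩, ?_⟩
  · by_cases hx : x ∈ tsupport β
    · exact β.contMDiff.contMDiffAt.mul (hg x (hβ hx))
    · have : (fun x => β x * g x) =ᶠ[𝓝 x] fun _ => 0 := by
        filter_upwards [(isClosed_tsupport β).isOpen_compl.mem_nhds hx] with y hy
        rw [image_eq_zero_of_notMem_tsupport hy, zero_mul]
      exact contMDiffAt_const.congr_of_eventuallyEq this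
  · filter_upwards [β.eventuallyEq_one] with x hx
    change β x * g x = g x
    rw [hx]; simp

theorem contMDiffAt_chart_apply {e : OpenPartialHomeomorph M (EuclideanSpace ℝ (Fin d))}
    (he : e ∈ IsManifold.maximalAtlas (𝓡 d) ∞ M) {x : M} (hx : x ∈ e.source) (i : Fin d) :
    ContMDiffAt (𝓡 d) 𝓘(ℝ) ∞ (fun z => e z i) x := by
  have h1 := contMDiffAt_of_mem_maximalAtlas he hx
  have h2 : ContMDiff 𝓘(ℝ, EuclideanSpace ℝ (Fin d)) 𝓘(ℝ) ∞
      (fun u : EuclideanSpace ℝ (Fin d) => u i) :=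
    contMDiff_iff_contDiff.2 (EuclideanSpace.proj (𝕜 := ℝ) i).contDiff
  exact h2.contMDiffAt.comp x h1

/-- Globally smooth functions that coincide with the coordinates of `e` near `x₀`. -/
theorem exists_coordinates {e : OpenPartialHomeomorph M (EuclideanSpace ℝ (Fin d))}
    (he : e ∈ IsManifold.maximalAtlas (𝓡 d) ∞ M) {x₀ : M} (hx : x₀ ∈ e.source) :
    ∃ f : Fin d → Smooth d M, ∀ᶠ x in 𝓝 x₀, ∀ i, f i x = e x i := by
  have := fun i => exists_smooth_eventuallyEq (e.open_source.mem_nhds hx)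
    (fun x hx => contMDiffAt_chart_apply he hx i)
  choose f hf using this
  exact ⟨f, Filter.eventually_all.2 hf⟩

theorem dAt_congr {f g : M → ℝ} {x : M} (h : ∀ᶠ y in 𝓝 x, f y = g y) : dAt (d := d) f x = dAt g x :=
  Filter.EventuallyEq.mfderiv_eq h

/-- The derivative of `f` with respect to the `j`-th coordinate of the chart `e`. -/
def coordDeriv (e : OpenPartialHomeomorph M (EuclideanSpace ℝ (Fin d))) (j : Fin d) (f : M → ℝ)
    (x : M) : ℝ :=
  fderiv ℝ (fun u => f (e.symm u)) (e x) (EuclideanSpace.single j 1)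

theorem dAt_chart_apply {e : OpenPartialHomeomorph M (EuclideanSpace ℝ (Fin d))}
    (he : e ∈ IsManifold.maximalAtlas (𝓡 d) ∞ M) {x : M} (hx : x ∈ e.source) (j : Fin d) :
    dAt (d := d) (fun z => e z j) x =
      (EuclideanSpace.proj (𝕜 := ℝ) j).comp (mfderiv (𝓡 d) 𝓘(ℝ, EuclideanSpace ℝ (Fin d)) e x) := by
  have h1 : MDifferentiableAt (𝓡 d) 𝓘(ℝ, EuclideanSpace ℝ (Fin d)) e x :=
    (contMDiffAt_of_mem_maximalAtlas he hx).mdifferentiableAt (by simp)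
  have h5 : MDifferentiableAt 𝓘(ℝ, EuclideanSpace ℝ (Fin d)) 𝓘(ℝ)
      (EuclideanSpace.proj (𝕜 := ℝ) j : EuclideanSpace ℝ (Fin d) → ℝ) (e x) :=
    (EuclideanSpace.proj (𝕜 := ℝ) j).differentiableAt.mdifferentiableAt
  have := mfderiv_comp x h5 h1
  rw [mfderiv_eq_fderiv, ContinuousLinearMap.fderiv] at this
  exact this

theorem euclidean_eq_sum_single (w : EuclideanSpace ℝ (Fin d)) :
    w = ∑ j, w j • EuclideanSpace.single j (1 : ℝ) := by
  ext i; simp [Finset.sum_apply, Pi.single_apply]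

/-- The differentials of coordinates span the cotangent space. -/
theorem exists_eq_sum_dAt_chart {e : OpenPartialHomeomorph M (EuclideanSpace ℝ (Fin d))}
    (he : e ∈ IsManifold.maximalAtlas (𝓡 d) ∞ M) {x : M} (hx : x ∈ e.source)
    (β : TangentSpace (𝓡 d) x →L[ℝ] ℝ) :
    ∃ c : Fin d → ℝ, β = ∑ j, c j • dAt (d := d) (fun z => e z j) x := by
  have h1 : MDifferentiableAt (𝓡 d) 𝓘(ℝ, EuclideanSpace ℝ (Fin d)) e x :=
    (contMDiffAt_of_mem_maximalAtlas he hx).mdifferentiableAt (by simp)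
  have h2 : MDifferentiableAt 𝓘(ℝ, EuclideanSpace ℝ (Fin d)) (𝓡 d) e.symm (e x) :=
    (contMDiffAt_symm_of_mem_maximalAtlas (n := ∞) he (e.map_source hx)).mdifferentiableAt
      (by simp)
  have h3 := mfderiv_comp x h2 h1
  have h4 : mfderiv (𝓡 d) (𝓡 d) (e.symm ∘ e) x = mfderiv (𝓡 d) (𝓡 d) id x :=
    Filter.EventuallyEq.mfderiv_eq (by
      filter_upwards [e.open_source.mem_nhds hx] with y hy using e.left_inv hy)
  rw [h4, mfderiv_id] at h3
  set A := mfderiv 𝓘(ℝ, EuclideanSpace ℝ (Fin d)) (𝓡 d) e.symm (e x)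
  set B := mfderiv (𝓡 d) 𝓘(ℝ, EuclideanSpace ℝ (Fin d)) e x
  -- The coefficients are the values of the covector on the coordinate vectors, pushed forward by
  -- the inverse chart.
  let L : EuclideanSpace ℝ (Fin d) → ℝ := fun w => (show EuclideanSpace ℝ (Fin d) →L[ℝ] ℝ from β) (A w)
  refine ⟨fun j => L (EuclideanSpace.single j (1 : ℝ)), ?_⟩
  ext v
  have h5 : v = A (B v) := congrArg (fun T => T v) h3
  simp only [dAt_chart_apply he hx]
  rw [sum_apply]
  have h6 : β v = L (B v) := congrArg β h5
  have hL : IsLinearMap ℝ L := ⟨fun a b => (congrArg β (A.map_add a b)).trans (β.map_add _ _),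
    fun c a => (congrArg β (A.map_smul c a)).trans (β.map_smul _ _)⟩
  rw [h6]
  set w : EuclideanSpace ℝ (Fin d) := B v
  have h7 : L w = ∑ j, w j • L (EuclideanSpace.single j (1 : ℝ)) := by
    conv_lhs => rw [euclidean_eq_sum_single w]
    change hL.mk' L _ = _
    rw [map_sum]
    exact Finset.sum_congr rfl fun j _ => map_smul _ _ _
  rw [h7]
  refine Finset.sum_congr rfl fun j _ => ?_
  rw [smul_eq_mul, mul_comm]
  rfl

theorem dAt_eq_sum_coordDeriv {e : OpenPartialHomeomorph M (EuclideanSpace ℝ (Fin d))}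
    (he : e ∈ IsManifold.maximalAtlas (𝓡 d) ∞ M) {x : M} (hx : x ∈ e.source) {f : M → ℝ}
    (hf : ContMDiffAt (𝓡 d) 𝓘(ℝ) ∞ f x) :
    dAt (d := d) f x = ∑ j, coordDeriv e j f x • dAt (fun z => e z j) x := by
  have h1 : MDifferentiableAt (𝓡 d) 𝓘(ℝ, EuclideanSpace ℝ (Fin d)) e x :=
    (contMDiffAt_of_mem_maximalAtlas he hx).mdifferentiableAt (by simp)
  have h2 : MDifferentiableAt 𝓘(ℝ, EuclideanSpace ℝ (Fin d)) 𝓘(ℝ) (fun u => f (e.symm u)) (e x) := by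
    have h3 : ContMDiffAt 𝓘(ℝ, EuclideanSpace ℝ (Fin d)) (𝓡 d) ∞ e.symm (e x) :=
      contMDiffAt_symm_of_mem_maximalAtlas he (e.map_source hx)
    exact (ContMDiffAt.comp_of_eq hf h3 (e.left_inv hx)).mdifferentiableAt (by simp)
  have h3 : dAt (d := d) f x = dAt (fun z => (fun u => f (e.symm u)) (e z)) x := dAt_congr (by
    filter_upwards [e.open_source.mem_nhds hx] with y hy
    simp [e.left_inv hy])
  have h4 := fun j => dAt_chart_apply he hx j
  have h5 := mfderiv_comp x h2 h1
  rw [mfderiv_eq_fderiv] at h5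
  rw [h3]
  ext v
  change (mfderiv (𝓡 d) 𝓘(ℝ) ((fun u => f (e.symm u)) ∘ e) x) v = _
  rw [h5]
  simp only [h4, coordDeriv]
  set w : EuclideanSpace ℝ (Fin d) := mfderiv (𝓡 d) 𝓘(ℝ, EuclideanSpace ℝ (Fin d)) e x v with hw
  set L := fderiv ℝ (fun u => f (e.symm u)) (e x)
  have h6 := euclidean_eq_sum_single w
  change L w = _
  rw [sum_apply]
  conv_lhs => rw [h6, map_sum]
  refine Finset.sum_congr rfl fun j _ => ?_
  rw [map_smul, smul_eq_mul, mul_comm]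
  rfl

variable {EQ : Type*} [NormedAddCommGroup EQ] [NormedSpace ℝ EQ] {HQ : Type*} [TopologicalSpace HQ]
  {JQ : ModelWithCorners ℝ EQ HQ} {Q : Type*} [TopologicalSpace Q] [ChartedSpace HQ Q]
  [IsManifold JQ 1 Q]

/-- The function is read through the inverse chart with `(q, x)` as parameters; the derivative of
such a family, at a base point depending smoothly on the parameters, is smooth. -/
theorem contMDiffAt_coordDeriv {e : OpenPartialHomeomorph M (EuclideanSpace ℝ (Fin d))}
    (he : e ∈ IsManifold.maximalAtlas (𝓡 d) ∞ M) {x : M} (hx : x ∈ e.source) {f : Q → M → ℝ}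
    {q : Q} (hf : ContMDiffAt (JQ.prod (𝓡 d)) 𝓘(ℝ) ∞ (fun r : Q × M => f r.1 r.2) (q, x))
    (j : Fin d) :
    ContMDiffAt (JQ.prod (𝓡 d)) 𝓘(ℝ) ∞ (fun r : Q × M => coordDeriv e j (f r.1) r.2) (q, x) := by
  have : IsManifold (𝓡 d) 1 M := IsManifold.of_le (n := ∞) (by simp)
  have h3 : ContMDiffAt 𝓘(ℝ, EuclideanSpace ℝ (Fin d)) (𝓡 d) ∞ e.symm (e x) :=
      contMDiffAt_symm_of_mem_maximalAtlas he (e.map_source hx)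
  have h1 : ContMDiffAt ((JQ.prod (𝓡 d)).prod 𝓘(ℝ, EuclideanSpace ℝ (Fin d))) 𝓘(ℝ) ∞
      (Function.uncurry (fun (r : Q × M) (u : EuclideanSpace ℝ (Fin d)) => f r.1 (e.symm u)))
      ((q, x), e x) := by
    refine ContMDiffAt.comp_of_eq (y := (q, x)) (g := fun r : Q × M => f r.1 r.2)
      (f := fun p : (Q × M) × EuclideanSpace ℝ (Fin d) => (p.1.1, e.symm p.2)) hf ?_ ?_
    · exact (contMDiffAt_fst.comp _ contMDiffAt_fst).prodMk
        (ContMDiffAt.comp_of_eq h3 contMDiffAt_snd rfl)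
    · simp [e.left_inv hx]
  have h2 := ContMDiffAt.mfderiv (m := ∞) (I := 𝓘(ℝ, EuclideanSpace ℝ (Fin d)))
    (fun (r : Q × M) (u : EuclideanSpace ℝ (Fin d)) => f r.1 (e.symm u)) (fun r => e r.2) h1
    ((contMDiffAt_of_mem_maximalAtlas he hx).comp (q, x) contMDiffAt_snd) le_rfl
  have h4 := inTangentCoordinates_model_space (I := 𝓘(ℝ, EuclideanSpace ℝ (Fin d)))
    (I' := 𝓘(ℝ, ℝ)) (fun r : Q × M => e r.2) (fun r : Q × M => f r.1 (e.symm (e r.2)))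
    (fun r => mfderiv 𝓘(ℝ, EuclideanSpace ℝ (Fin d)) 𝓘(ℝ, ℝ) (fun u => f r.1 (e.symm u)) (e r.2))
    (q, x)
  rw [h4] at h2
  have h5 := h2.clm_apply (contMDiffAt_const (c := EuclideanSpace.single j (1 : ℝ)))
  simpa only [mfderiv_eq_fderiv, coordDeriv] using h5

variable [MeasurableSpace M] (S : Spacetime d M)

/-- The inner product of the differentials of smooth families of functions is smooth. -/
theorem contMDiff_coMetric {f h : Q → Smooth d M}
    (hf : ContMDiff (JQ.prod (𝓡 d)) 𝓘(ℝ) ∞ (fun r : Q × M => f r.1 r.2))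
    (hh : ContMDiff (JQ.prod (𝓡 d)) 𝓘(ℝ) ∞ (fun r : Q × M => h r.1 r.2)) :
    ContMDiff (JQ.prod (𝓡 d)) 𝓘(ℝ) ∞
      (fun r : Q × M => S.coMetric r.2 (dAt (f r.1) r.2) (dAt (h r.1) r.2)) := by
  rintro ⟨q, x⟩
  set e := chartAt (EuclideanSpace ℝ (Fin d)) x with he'
  have he : e ∈ IsManifold.maximalAtlas (𝓡 d) ∞ M := IsManifold.chart_mem_maximalAtlas x
  have hx : x ∈ e.source := mem_chart_source _ x
  obtain ⟨c, hc⟩ := exists_coordinates he hx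
  have h1 : ∀ᶠ r : Q × M in 𝓝 (q, x), S.coMetric r.2 (dAt (f r.1) r.2) (dAt (h r.1) r.2) =
      ∑ i, ∑ j, coordDeriv e i (f r.1) r.2 * (coordDeriv e j (h r.1) r.2 *
        S.coMetric r.2 (dAt (c i) r.2) (dAt (c j) r.2)) := by
    filter_upwards [continuousAt_snd.eventually hc.eventually_nhds,
      continuousAt_snd.eventually (e.open_source.mem_nhds hx)] with r hr hr2
    have h2 : ∀ i, dAt (d := d) (fun z => e z i) r.2 = dAt (c i) r.2 := fun i =>
      dAt_congr (hr.mono fun y hy => (hy i).symm)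
    rw [dAt_eq_sum_coordDeriv he hr2 (f r.1).contMDiff.contMDiffAt,
      dAt_eq_sum_coordDeriv he hr2 (h r.1).contMDiff.contMDiffAt]
    simp only [h2, map_sum, map_smul, LinearMap.sum_apply, LinearMap.smul_apply, smul_eq_mul,
      Finset.mul_sum]
    rw [Finset.sum_comm]
    exact Finset.sum_congr rfl fun i _ => Finset.sum_congr rfl fun j _ => by ring
  refine ContMDiffAt.congr_of_eventuallyEq ?_ h1
  refine contMDiffAt_finsetSum fun i _ => contMDiffAt_finsetSum fun j _ => ?_
  exact (contMDiffAt_coordDeriv he hx (f := fun q => f q) hf.contMDiffAt i).mul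
    ((contMDiffAt_coordDeriv he hx (f := fun q => h q) hh.contMDiffAt j).mul
      ((S.smooth (c i) (c j)).contMDiffAt.comp (q, x) contMDiffAt_snd))

theorem bilin_gram_of_sum {V : Type*} [AddCommGroup V] [Module ℝ V] (B : LinearMap.BilinForm ℝ V)
    {α β : Fin d → V} (P : Matrix (Fin d) (Fin d) ℝ) (h : ∀ i, α i = ∑ j, P i j • β j) :
    (Matrix.of fun i j => B (α i) (α j)) = P * (Matrix.of fun i j => B (β i) (β j)) * Pᵀ := by
  ext i j
  simp only [Matrix.of_apply, Matrix.mul_apply, h, map_sum, map_smul, LinearMap.sum_apply,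
    LinearMap.smul_apply, smul_eq_mul, Matrix.transpose_apply, Finset.sum_mul, Finset.mul_sum]
  exact Finset.sum_congr rfl fun k _ => Finset.sum_congr rfl fun l _ => by ring

/-- The Gram matrix of the differentials of a tuple of functions. -/
def gram (f : Fin d → M → ℝ) (x : M) : Matrix (Fin d) (Fin d) ℝ :=
  Matrix.of fun i j => S.coMetric x (dAt (f i) x) (dAt (f j) x)

theorem det_gram_of_sum {f h : Fin d → M → ℝ} {x : M} (P : Matrix (Fin d) (Fin d) ℝ)
    (hP : ∀ i, dAt (d := d) (f i) x = ∑ j, P i j • dAt (d := d) (h j) x) :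
    (gram S f x).det = P.det ^ 2 * (gram S h x).det := by
  have : gram S f x = P * gram S h x * Pᵀ := bilin_gram_of_sum _ P hP
  rw [this, Matrix.det_mul, Matrix.det_mul, Matrix.det_transpose]
  ring

theorem gram_congr {f h : Fin d → M → ℝ} {x : M} (hfh : ∀ᶠ y in 𝓝 x, ∀ i, f i y = h i y) :
    gram S f x = gram S h x := by
  have : ∀ i, dAt (d := d) (f i) x = dAt (d := d) (h i) x := fun i =>
    dAt_congr (hfh.mono fun y hy => hy i)
  simp only [gram, this]

/-- The coordinate differentials span, so the Gram matrix of a Lorentzian basis is `P G Pᵀ`. Its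
determinant is a product of signs, so `det G` cannot vanish. -/
theorem det_gram_chart_ne_zero {e : OpenPartialHomeomorph M (EuclideanSpace ℝ (Fin d))}
    (he : e ∈ IsManifold.maximalAtlas (𝓡 d) ∞ M) {x : M} (hx : x ∈ e.source) :
    (gram S (fun i z => e z i) x).det ≠ 0 := by
  obtain ⟨b, hb⟩ := S.lorentzian x
  choose P hP using fun i => exists_eq_sum_dAt_chart he hx (b i)
  intro h0
  have h1 : (Matrix.of fun i j => S.coMetric x (b i) (b j)) =
      Matrix.diagonal fun i : Fin d => if (i : ℕ) = 0 then (1 : ℝ) else -1 := by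
    ext i j
    rw [Matrix.of_apply, hb, Matrix.diagonal_apply]
  have h2 : (Matrix.of fun i j => S.coMetric x (b i) (b j)) =
      Matrix.of P * gram S (fun i z => e z i) x * (Matrix.of P)ᵀ :=
    bilin_gram_of_sum _ (Matrix.of P) hP
  have h3 := congrArg Matrix.det (h1.symm.trans h2)
  rw [Matrix.det_mul, Matrix.det_mul, h0, Matrix.det_diagonal] at h3
  simp only [mul_zero, zero_mul] at h3
  rw [Finset.prod_eq_zero_iff] at h3
  obtain ⟨i, -, hi⟩ := h3
  split_ifs at hi <;> norm_num at hi

end Coordinates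

/-! ### Charts and the volume measure -/

section Volume

variable {d : ℕ} {M : Type*} [TopologicalSpace M] [ChartedSpace (EuclideanSpace ℝ (Fin d)) M]
  [IsManifold (𝓡 d) ∞ M] [T2Space M]

theorem mem_contDiffGroupoid_of_contMDiffOn
    {f : OpenPartialHomeomorph (EuclideanSpace ℝ (Fin d)) (EuclideanSpace ℝ (Fin d))}
    (h1 : ContMDiffOn (𝓡 d) (𝓡 d) ∞ f f.source) (h2 : ContMDiffOn (𝓡 d) (𝓡 d) ∞ f.symm f.target) :
    f ∈ contDiffGroupoid ∞ (𝓡 d) := by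
  rw [contDiffGroupoid, mem_groupoid_of_pregroupoid]
  rw [contMDiffOn_iff_contDiffOn] at h1 h2
  constructor
  · simpa [contDiffPregroupoid] using h1
  · simpa [contDiffPregroupoid] using h2

/-- Charts can be composed with diffeomorphisms. -/
theorem diffeomorph_trans_mem_maximalAtlas (ρ : Diffeomorph (𝓡 d) (𝓡 d) M M ∞)
    {e : OpenPartialHomeomorph M (EuclideanSpace ℝ (Fin d))}
    (he : e ∈ IsManifold.maximalAtlas (𝓡 d) ∞ M) :
    ρ.toHomeomorph.toOpenPartialHomeomorph ≫ₕ e ∈ IsManifold.maximalAtlas (𝓡 d) ∞ M := by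
  rw [IsManifold.maximalAtlas, mem_maximalAtlas_iff]
  intro c hc
  have hc' : c ∈ IsManifold.maximalAtlas (𝓡 d) ∞ M := IsManifold.subset_maximalAtlas hc
  have a1 : ContMDiffOn (𝓡 d) (𝓡 d) ∞ (fun u => c (ρ.symm (e.symm u)))
      {u | u ∈ e.target ∧ ρ.symm (e.symm u) ∈ c.source} :=
    (contMDiffOn_of_mem_maximalAtlas hc').comp (ρ.symm.contMDiff.comp_contMDiffOn
      ((contMDiffOn_symm_of_mem_maximalAtlas he).mono fun u hu => hu.1)) fun u hu => hu.2
  have a2 : ContMDiffOn (𝓡 d) (𝓡 d) ∞ (fun u => e (ρ (c.symm u)))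
      {u | u ∈ c.target ∧ ρ (c.symm u) ∈ e.source} :=
    (contMDiffOn_of_mem_maximalAtlas he).comp (ρ.contMDiff.comp_contMDiffOn
      ((contMDiffOn_symm_of_mem_maximalAtlas hc').mono fun u hu => hu.1)) fun u hu => hu.2
  constructor
  · refine mem_contDiffGroupoid_of_contMDiffOn (a1.mono fun u hu => ?_) (a2.mono fun u hu => ?_)
    · simpa [OpenPartialHomeomorph.trans_source] using hu
    · simpa [OpenPartialHomeomorph.trans_target] using hu
  · refine mem_contDiffGroupoid_of_contMDiffOn (a2.mono fun u hu => ?_) (a1.mono fun u hu => ?_)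
    · simpa [OpenPartialHomeomorph.trans_source] using hu
    · simpa [OpenPartialHomeomorph.trans_target] using hu

variable [MeasurableSpace M] (S : Spacetime d M)

/-- The density of the volume measure in the chart `e`. -/
def chartWeight (e : OpenPartialHomeomorph M (EuclideanSpace ℝ (Fin d)))
    (u : EuclideanSpace ℝ (Fin d)) : ENNReal :=
  ENNReal.ofReal (Real.sqrt |(gram S (fun i z => e z i) (e.symm u)).det|)⁻¹

theorem map_vol_chart {e : OpenPartialHomeomorph M (EuclideanSpace ℝ (Fin d))}
    (he : e ∈ IsManifold.maximalAtlas (𝓡 d) ∞ M) :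
    Measure.map e (S.vol.restrict e.source) =
      ((volume : Measure (EuclideanSpace ℝ (Fin d))).restrict e.target).withDensity
        (chartWeight S e) := S.vol_chart e he

theorem contMDiff_det {EQ : Type*} [NormedAddCommGroup EQ] [NormedSpace ℝ EQ] {HQ : Type*}
    [TopologicalSpace HQ] {J : ModelWithCorners ℝ EQ HQ} {Q : Type*} [TopologicalSpace Q]
    [ChartedSpace HQ Q] {ι : Type*} [Fintype ι] [DecidableEq ι] {A : Q → Matrix ι ι ℝ}
    (h : ∀ i j, ContMDiff J 𝓘(ℝ) ∞ (fun q => A q i j)) :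
    ContMDiff J 𝓘(ℝ) ∞ (fun q => (A q).det) := by
  simp only [Matrix.det_apply']
  exact contMDiff_finsetSum fun σ _ => contMDiff_const.mul (contMDiff_finsetProd fun i _ => h _ _)

theorem contMDiff_gram_det (c : Fin d → Smooth d M) :
    ContMDiff (𝓡 d) 𝓘(ℝ) ∞ (fun x => (gram S (fun i z => c i z) x).det) :=
  contMDiff_det fun i j => S.smooth (c i) (c j)

variable [BorelSpace M]

theorem aemeasurable_chart (e : OpenPartialHomeomorph M (EuclideanSpace ℝ (Fin d)))
    (μ : Measure M) : AEMeasurable e (μ.restrict e.source) :=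
  e.continuousOn.aemeasurable e.open_source.measurableSet

/-- Smoothness of the metric is assumed only for global functions. Near each point the chart
coordinates are therefore replaced by global functions with the same germ. -/
theorem continuousOn_chartWeight {e : OpenPartialHomeomorph M (EuclideanSpace ℝ (Fin d))}
    (he : e ∈ IsManifold.maximalAtlas (𝓡 d) ∞ M) :
    ContinuousOn (fun u => (Real.sqrt |(gram S (fun i z => e z i) (e.symm u)).det|)⁻¹)
      e.target := by
  intro u hu
  obtain ⟨c, hc⟩ := exists_coordinates he (e.map_target hu)
  have h2 := e.continuousAt_symm hu
  have h1 : ∀ᶠ v in 𝓝 u, (Real.sqrt |(gram S (fun i z => e z i) (e.symm v)).det|)⁻¹ =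
      (Real.sqrt |(gram S (fun i z => c i z) (e.symm v)).det|)⁻¹ := by
    filter_upwards [h2.eventually hc.eventually_nhds] with v hv
    rw [gram_congr S hv]
  refine (ContinuousAt.congr ?_ (Filter.EventuallyEq.symm h1)).continuousWithinAt
  refine ContinuousAt.inv₀ (ContinuousAt.comp (f := e.symm)
    (g := fun x => Real.sqrt |(gram S (fun i z => c i z) x).det|)
    (contMDiff_gram_det S c).continuous.abs.sqrt.continuousAt h2) ?_
  rw [gram_congr S hc]
  exact (Real.sqrt_pos.2 (abs_pos.2 (det_gram_chart_ne_zero S he (e.map_target hu)))).ne'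

/-- In a chart the density is continuous, hence bounded on a closed ball around the image point. -/
instance isLocallyFiniteMeasure_vol : IsLocallyFiniteMeasure S.vol := by
  refine ⟨fun x => ?_⟩
  set e := chartAt (EuclideanSpace ℝ (Fin d)) x with he'
  have he : e ∈ IsManifold.maximalAtlas (𝓡 d) ∞ M := IsManifold.chart_mem_maximalAtlas x
  have hx : x ∈ e.source := mem_chart_source _ x
  obtain ⟨r, hr, hball⟩ := Metric.nhds_basis_closedBall.mem_iff.1
    (e.open_target.mem_nhds (e.map_source hx))
  set B := Metric.closedBall (e x) r
  obtain ⟨C, hC⟩ := ((isCompact_closedBall (e x) r).image_of_continuousOn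
    ((continuousOn_chartWeight S he).mono hball)).bddAbove
  refine ⟨e.source ∩ e ⁻¹' B, Filter.inter_mem (e.open_source.mem_nhds hx)
    ((e.continuousAt hx).preimage_mem_nhds (Metric.closedBall_mem_nhds _ hr)), ?_⟩
  have hBm : MeasurableSet B := Metric.isClosed_closedBall.measurableSet
  have h2 : S.vol (e.source ∩ e ⁻¹' B) = Measure.map e (S.vol.restrict e.source) B := by
    rw [Measure.map_apply_of_aemeasurable (aemeasurable_chart e _) hBm,
      Measure.restrict_apply' e.open_source.measurableSet, Set.inter_comm]
  rw [h2, map_vol_chart S he, withDensity_apply _ hBm,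
    Measure.restrict_restrict hBm]
  calc ∫⁻ u in B ∩ e.target, chartWeight S e u
      ≤ ∫⁻ u in B ∩ e.target, ENNReal.ofReal C :=
        setLIntegral_mono measurable_const fun u hu =>
          ENNReal.ofReal_le_ofReal (hC ⟨u, hu.1, rfl⟩)
    _ ≤ ∫⁻ u in B, ENNReal.ofReal C := lintegral_mono_set Set.inter_subset_left
    _ < ⊤ := by
        rw [setLIntegral_const]
        exact ENNReal.mul_lt_top ENNReal.ofReal_lt_top
          (isCompact_closedBall (e x) r).measure_lt_top

end Volume

/-! ### The Jacobian of a diffeomorphism and change of variables -/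

section Jacobian

variable {d : ℕ} {M : Type*} [TopologicalSpace M] [ChartedSpace (EuclideanSpace ℝ (Fin d)) M]
  [IsManifold (𝓡 d) ∞ M] [T2Space M] [MeasurableSpace M] (S : Spacetime d M)

/-- The Jacobian of the diffeomorphism `ρ` with respect to the volume measure, computed with
respect to the coordinates `c`. -/
def jacobianIn (c : Fin d → M → ℝ) (ρ : Diffeomorph (𝓡 d) (𝓡 d) M M ∞) (y : M) : ℝ :=
  Real.sqrt |(gram S c y).det| / Real.sqrt |(gram S (fun i z => c i (ρ z)) (ρ.symm y)).det|

/-- The Jacobian of `ρ`: the density of the image of the volume measure under `ρ`. -/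
def jacobian (ρ : Diffeomorph (𝓡 d) (𝓡 d) M M ∞) (y : M) : ℝ :=
  jacobianIn S (fun i z => chartAt (EuclideanSpace ℝ (Fin d)) y z i) ρ y

theorem det_gram_chart_comp_ne_zero (ρ : Diffeomorph (𝓡 d) (𝓡 d) M M ∞)
    {e : OpenPartialHomeomorph M (EuclideanSpace ℝ (Fin d))}
    (he : e ∈ IsManifold.maximalAtlas (𝓡 d) ∞ M) {y : M} (hy : y ∈ e.source) :
    (gram S (fun i z => e (ρ z) i) (ρ.symm y)).det ≠ 0 := by
  have := det_gram_chart_ne_zero S (diffeomorph_trans_mem_maximalAtlas ρ he) (x := ρ.symm y)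
    (by simpa [OpenPartialHomeomorph.trans_source] using hy)
  exact this

theorem dAt_comp_diffeomorph (ρ : Diffeomorph (𝓡 d) (𝓡 d) M M ∞) {f : M → ℝ} {x : M}
    (hf : ContMDiffAt (𝓡 d) 𝓘(ℝ) ∞ f (ρ x)) :
    dAt (d := d) (fun z => f (ρ z)) x = (dAt (d := d) f (ρ x)).comp (mfderiv (𝓡 d) (𝓡 d) ρ x) :=
  mfderiv_comp x (hf.mdifferentiableAt (by simp))
    (ρ.contMDiff.contMDiffAt.mdifferentiableAt (by simp))

/-- Changing coordinates multiplies both Gram determinants by the same factor `(det P)²`, because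
the same matrix `P` relates the coordinates pulled back by `ρ`. Hence the quotient does not depend
on the chart. -/
theorem jacobian_eq (ρ : Diffeomorph (𝓡 d) (𝓡 d) M M ∞)
    {e : OpenPartialHomeomorph M (EuclideanSpace ℝ (Fin d))}
    (he : e ∈ IsManifold.maximalAtlas (𝓡 d) ∞ M) {y : M} (hy : y ∈ e.source) :
    jacobian S ρ y = jacobianIn S (fun i z => e z i) ρ y := by
  obtain ⟨x, rfl⟩ : ∃ x, ρ x = y := ⟨ρ.symm y, ρ.apply_symm_apply y⟩
  set k := chartAt (EuclideanSpace ℝ (Fin d)) (ρ x)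
  have hk : k ∈ IsManifold.maximalAtlas (𝓡 d) ∞ M := IsManifold.chart_mem_maximalAtlas _
  have hky : ρ x ∈ k.source := mem_chart_source _ _
  choose P hP using fun i => exists_eq_sum_dAt_chart he hy (dAt (d := d) (fun z => k z i) (ρ x))
  have e1 := det_gram_of_sum S (f := fun i z => k z i) (h := fun i z => e z i) (Matrix.of P) hP
  have hQ : ∀ i, dAt (d := d) (fun z => k (ρ z) i) x =
      ∑ j, P i j • dAt (d := d) (fun z => e (ρ z) j) x := by
    intro i
    rw [dAt_comp_diffeomorph ρ (f := fun z => k z i) (contMDiffAt_chart_apply hk hky i), hP]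
    ext v
    simp only [dAt_comp_diffeomorph ρ (f := fun z => e z _) (contMDiffAt_chart_apply he hy _)]
    simp [ContinuousLinearMap.comp_apply, sum_apply]
  have e2 := det_gram_of_sum S (f := fun i z => k (ρ z) i) (h := fun i z => e (ρ z) i)
    (Matrix.of P) hQ
  have hne := det_gram_chart_ne_zero S hk hky
  have hP0 : (Matrix.of P).det ≠ 0 := fun h0 => hne (by rw [e1, h0]; simp)
  simp only [jacobian, jacobianIn, ρ.symm_apply_apply]
  rw [e1, e2, abs_mul, abs_mul, Real.sqrt_mul (abs_nonneg _), Real.sqrt_mul (abs_nonneg _)]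
  have : Real.sqrt |(Matrix.of P).det ^ 2| ≠ 0 :=
    (Real.sqrt_pos.2 (abs_pos.2 (pow_ne_zero 2 hP0))).ne'
  exact mul_div_mul_left _ _ this

theorem jacobian_nonneg (ρ : Diffeomorph (𝓡 d) (𝓡 d) M M ∞) (y : M) : 0 ≤ jacobian S ρ y :=
  div_nonneg (Real.sqrt_nonneg _) (Real.sqrt_nonneg _)

theorem contMDiffAt_sqrt_abs {EQ : Type*} [NormedAddCommGroup EQ] [NormedSpace ℝ EQ] {HQ : Type*}
    [TopologicalSpace HQ] {J : ModelWithCorners ℝ EQ HQ} {Q : Type*} [TopologicalSpace Q]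
    [ChartedSpace HQ Q] {f : Q → ℝ} {q : Q} (hf : ContMDiffAt J 𝓘(ℝ) ∞ f q) (h0 : f q ≠ 0) :
    ContMDiffAt J 𝓘(ℝ) ∞ (fun q => Real.sqrt |f q|) q := by
  have h1 : ContDiffAt ℝ ∞ (fun x : ℝ => Real.sqrt |x|) (f q) :=
    (contDiffAt_abs h0).sqrt (abs_ne_zero.2 h0)
  exact h1.contMDiffAt.comp q hf

variable {EP : Type*} [NormedAddCommGroup EP] [NormedSpace ℝ EP] {HP : Type*} [TopologicalSpace HP]
  {JP : ModelWithCorners ℝ EP HP} {P : Type*} [TopologicalSpace P] [ChartedSpace HP P]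
  [IsManifold JP 1 P]

/-- The definition uses the preferred chart of each point, which need not vary smoothly. By
`jacobian_eq` one fixed chart may be used near a given point, with its coordinates replaced by
global functions. -/
theorem contMDiff_jacobian {ρ : P → Diffeomorph (𝓡 d) (𝓡 d) M M ∞}
    (hρ : ContMDiff (JP.prod (𝓡 d)) (𝓡 d) ∞ (fun q : P × M => ρ q.1 q.2))
    (hρ' : ContMDiff (JP.prod (𝓡 d)) (𝓡 d) ∞ (fun q : P × M => (ρ q.1).symm q.2)) :
    ContMDiff (JP.prod (𝓡 d)) 𝓘(ℝ) ∞ (fun q : P × M => jacobian S (ρ q.1) q.2) := by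
  rintro ⟨s, y⟩
  set e := chartAt (EuclideanSpace ℝ (Fin d)) y
  have he : e ∈ IsManifold.maximalAtlas (𝓡 d) ∞ M := IsManifold.chart_mem_maximalAtlas _
  have hy : y ∈ e.source := mem_chart_source _ _
  obtain ⟨c, hc⟩ := exists_coordinates he hy
  have hcong : ∀ (σ : Diffeomorph (𝓡 d) (𝓡 d) M M ∞) (z : M),
      (∀ᶠ w in 𝓝 z, ∀ i, c i w = e w i) →
      gram S (fun i w => c i w) z = gram S (fun i w => e w i) z ∧
      gram S (fun i w => c i (σ w)) (σ.symm z) = gram S (fun i w => e (σ w) i) (σ.symm z) := by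
    intro σ z hz
    refine ⟨gram_congr S hz, gram_congr S (f := fun i w => c i (σ w)) (h := fun i w => e (σ w) i) ?_⟩
    have : Filter.Tendsto σ (𝓝 (σ.symm z)) (𝓝 z) := by
      have := σ.continuous.tendsto (σ.symm z)
      rwa [σ.apply_symm_apply] at this
    exact this.eventually hz
  have h1 : ∀ᶠ q : P × M in 𝓝 (s, y), jacobian S (ρ q.1) q.2 =
      Real.sqrt |(gram S (fun i z => c i z) q.2).det| /
        Real.sqrt |(gram S (fun i z => pull (ρ q.1) (c i) z) ((ρ q.1).symm q.2)).det| := by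
    filter_upwards [continuousAt_snd.eventually hc.eventually_nhds,
      continuousAt_snd.eventually (e.open_source.mem_nhds hy)] with q hq hq2
    simp only [pull_apply]
    rw [jacobian_eq S _ he hq2, jacobianIn, (hcong (ρ q.1) q.2 hq).1, (hcong (ρ q.1) q.2 hq).2]
  refine ContMDiffAt.congr_of_eventuallyEq ?_ h1
  have hG : ContMDiff (JP.prod (𝓡 d)) 𝓘(ℝ) ∞ (fun q : P × M =>
      (gram S (fun i z => pull (ρ q.1) (c i) z) q.2).det) :=
    contMDiff_det fun i j => contMDiff_coMetric S (f := fun s => pull (ρ s) (c i))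
      (h := fun s => pull (ρ s) (c j)) ((c i).contMDiff.comp hρ) ((c j).contMDiff.comp hρ)
  refine ContMDiffAt.div₀ (contMDiffAt_sqrt_abs ((contMDiff_gram_det S c).contMDiffAt.comp (s, y)
    contMDiffAt_snd) ?_) (contMDiffAt_sqrt_abs (hG.comp (contMDiff_fst.prodMk hρ')).contMDiffAt ?_)
      ?_
  · rw [(hcong (ρ s) y hc).1]
    exact det_gram_chart_ne_zero S he hy
  · simp only [pull_apply]
    rw [(hcong (ρ s) y hc).2]
    exact det_gram_chart_comp_ne_zero S _ he hy
  · simp only [pull_apply]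
    rw [(hcong (ρ s) y hc).2]
    exact (Real.sqrt_pos.2 (abs_pos.2 (det_gram_chart_comp_ne_zero S _ he hy))).ne'

variable [BorelSpace M] [SecondCountableTopology M]

theorem measurableSet_inter_preimage {α β : Type*} [TopologicalSpace α] [MeasurableSpace α]
    [BorelSpace α] [TopologicalSpace β] [MeasurableSpace β] [BorelSpace β] {f : α → β} {s : Set α}
    (hs : MeasurableSet s) (hf : ContinuousOn f s) {B : Set β} (hB : MeasurableSet B) :
    MeasurableSet (s ∩ f ⁻¹' B) := by
  have h := hs.subtype_image ((continuousOn_iff_continuous_domRestrict.1 hf).measurable hB)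
  rw [Set.domRestrict_eq, Set.preimage_comp, Subtype.image_preimage_coe] at h
  exact h

/-- A chart is injective on its domain, so a measure there is determined by its image. -/
theorem restrict_eq_of_map_chart_eq {e : OpenPartialHomeomorph M (EuclideanSpace ℝ (Fin d))}
    {μ ν : Measure M}
    (h : Measure.map e (μ.restrict e.source) = Measure.map e (ν.restrict e.source)) :
    μ.restrict e.source = ν.restrict e.source := by
  ext A hA
  have hB : MeasurableSet (e.target ∩ e.symm ⁻¹' A) :=
    measurableSet_inter_preimage e.open_target.measurableSet e.continuousOn_symm hA
  have key : ∀ μ : Measure M, μ.restrict e.source A =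
      Measure.map e (μ.restrict e.source) (e.target ∩ e.symm ⁻¹' A) := by
    intro μ
    rw [Measure.map_apply_of_aemeasurable (aemeasurable_chart e _) hB,
      Measure.restrict_apply' e.open_source.measurableSet,
      Measure.restrict_apply' e.open_source.measurableSet]
    congr 1
    ext x
    simp only [Set.mem_inter_iff, Set.mem_preimage]
    constructor
    · rintro ⟨h1, h2⟩
      exact ⟨⟨e.map_source h2, by rwa [e.left_inv h2]⟩, h2⟩
    · rintro ⟨⟨_, h1⟩, h2⟩
      exact ⟨by rwa [e.left_inv h2] at h1, h2⟩
  rw [key μ, key ν, h]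

theorem continuous_jacobian (ρ : Diffeomorph (𝓡 d) (𝓡 d) M M ∞) : Continuous (jacobian S ρ) := by
  have := contMDiff_jacobian S (JP := 𝓘(ℝ)) (ρ := fun _ : ℝ => ρ)
    (ρ.contMDiff.comp contMDiff_snd) (ρ.symm.contMDiff.comp contMDiff_snd)
  exact this.continuous.comp (Continuous.prodMk_right (0 : ℝ))

/-- If `e` is a chart, so is `e ∘ ρ`, and the defining property of the volume measure holds in both.
Comparing the two densities gives the Jacobian directly, without the transformation formula for
Lebesgue measure. -/
theorem map_diffeomorph_vol (ρ : Diffeomorph (𝓡 d) (𝓡 d) M M ∞) :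
    Measure.map ρ S.vol = S.vol.withDensity (fun y => ENNReal.ofReal (jacobian S ρ y)) := by
  have hρm : Measurable ρ := ρ.continuous.measurable
  -- Countably many chart domains cover `M`, so it suffices to compare the measures on one of them.
  obtain ⟨T, hT, hcov⟩ := TopologicalSpace.countable_cover_nhds
    (fun x : M => chart_source_mem_nhds (EuclideanSpace ℝ (Fin d)) x)
  have : Countable T := hT.to_subtype
  refine (Measure.ext_iff_of_iUnion_eq_univ (ι := T)
    (s := fun x => (chartAt (EuclideanSpace ℝ (Fin d)) (x : M)).source)
    (by rw [← hcov, Set.biUnion_eq_iUnion])).2 fun x => ?_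
  set e := chartAt (EuclideanSpace ℝ (Fin d)) (x : M)
  have he : e ∈ IsManifold.maximalAtlas (𝓡 d) ∞ M := IsManifold.chart_mem_maximalAtlas _
  have hs : MeasurableSet e.source := e.open_source.measurableSet
  apply restrict_eq_of_map_chart_eq
  set e' := ρ.toHomeomorph.toOpenPartialHomeomorph ≫ₕ e with he'
  have hsrc : e'.source = ρ ⁻¹' e.source := by simp [he']
  have htar : e'.target = e.target := by simp [he']
  have h1 : Measure.map e ((Measure.map ρ S.vol).restrict e.source) =
      Measure.map e' (S.vol.restrict e'.source) := by
    rw [Measure.restrict_map hρm hs, hsrc, AEMeasurable.map_map_of_aemeasurable ?_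
      hρm.aemeasurable]
    · rfl
    · rw [← Measure.restrict_map hρm hs]
      exact aemeasurable_chart e _
  rw [h1, map_vol_chart S (diffeomorph_trans_mem_maximalAtlas ρ he), htar]
  ext B hB
  rw [Measure.map_apply_of_aemeasurable (aemeasurable_chart e _) hB,
    Measure.restrict_apply' hs, withDensity_apply _ hB]
  have hBm : MeasurableSet (e ⁻¹' B ∩ e.source) := by
    rw [Set.inter_comm]
    exact measurableSet_inter_preimage hs e.continuousOn hB
  rw [withDensity_apply _ hBm]
  set g : EuclideanSpace ℝ (Fin d) → ENNReal :=
    fun u => ENNReal.ofReal (jacobian S ρ (e.symm u)) with hg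
  have h2 : ∫⁻ y in e ⁻¹' B ∩ e.source, ENNReal.ofReal (jacobian S ρ y) ∂S.vol =
      ∫⁻ y, B.indicator g (e y) ∂(S.vol.restrict e.source) := by
    rw [← lintegral_indicator hBm, ← lintegral_indicator hs]
    refine lintegral_congr fun y => ?_
    by_cases hy : y ∈ e.source
    · by_cases hyB : e y ∈ B
      · simp [hy, hyB, hg, e.left_inv hy]
      · simp [hyB, Set.indicator]
    · simp [hy]
  have hgc : ContinuousOn g e.target :=
    ENNReal.continuous_ofReal.comp_continuousOn
      ((continuous_jacobian S ρ).comp_continuousOn e.continuousOn_symm)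
  have hgm : AEMeasurable g ((volume : Measure (EuclideanSpace ℝ (Fin d))).restrict e.target) :=
    hgc.aemeasurable e.open_target.measurableSet
  have hwm : AEMeasurable (chartWeight S e)
      ((volume : Measure (EuclideanSpace ℝ (Fin d))).restrict e.target) :=
    (ENNReal.continuous_ofReal.comp_continuousOn (continuousOn_chartWeight S he)).aemeasurable
      e.open_target.measurableSet
  have hgB : AEMeasurable (B.indicator g)
      ((volume : Measure (EuclideanSpace ℝ (Fin d))).restrict e.target) := hgm.indicator hB
  have h3 : Measure.map e (S.vol.restrict e.source) ≪
      (volume : Measure (EuclideanSpace ℝ (Fin d))).restrict e.target := by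
    rw [map_vol_chart S he]
    exact withDensity_absolutelyContinuous _ _
  rw [h2, ← lintegral_map' (hgB.mono_ac h3) (aemeasurable_chart e _), map_vol_chart S he,
    lintegral_withDensity_eq_lintegral_mul₀ hwm hgB, ← lintegral_indicator hB]
  refine lintegral_congr_ae ?_
  filter_upwards [ae_restrict_mem e.open_target.measurableSet] with u hu
  by_cases huB : u ∈ B
  · simp only [huB, Set.indicator_of_mem, Pi.mul_apply, hg, chartWeight]
    rw [jacobian_eq S ρ he (e.map_target hu), jacobianIn,
      ← ENNReal.ofReal_mul (inv_nonneg.2 (Real.sqrt_nonneg _))]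
    congr 1
    -- The numerator of the Jacobian cancels the weight of the chart `e`; what remains is the weight
    -- of `e ∘ ρ`.
    have h4 : Real.sqrt |(gram S (fun i z => e z i) (e.symm u)).det| ≠ 0 :=
      (Real.sqrt_pos.2 (abs_pos.2 (det_gram_chart_ne_zero S he (e.map_target hu)))).ne'
    rw [div_eq_mul_inv, inv_mul_cancel_left₀ h4]
    rfl
  · simp [huB]

/-- Change of variables for the volume measure. -/
theorem integral_comp_diffeomorph (ρ : Diffeomorph (𝓡 d) (𝓡 d) M M ∞) (f : M → ℝ) :
    ∫ y, jacobian S ρ y * f (ρ.symm y) ∂S.vol = ∫ x, f x ∂S.vol := by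
  have h1 : ∫ x, f x ∂S.vol = ∫ y, f (ρ.symm y) ∂(Measure.map ρ S.vol) := by
    have := (ρ.toHomeomorph.measurableEmbedding).integral_map (μ := S.vol)
      (fun y => f (ρ.symm y))
    change ∫ y, f (ρ.symm y) ∂(Measure.map ρ S.vol) = ∫ x, f (ρ.symm (ρ x)) ∂S.vol at this
    rw [this]
    simp
  rw [h1, map_diffeomorph_vol, integral_withDensity_eq_integral_toReal_smul
    (continuous_jacobian S ρ).measurable.ennreal_ofReal
    (Filter.Eventually.of_forall fun _ => ENNReal.ofReal_lt_top)]
  refine integral_congr_ae (Filter.Eventually.of_forall fun y => ?_)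
  simp [ENNReal.toReal_ofReal (jacobian_nonneg S ρ y)]

end Jacobian

/-! ### Smooth families of densities and of local functionals -/

section LocalFamilies

variable {d n : ℕ} {M : Type*} [TopologicalSpace M] [ChartedSpace (EuclideanSpace ℝ (Fin d)) M]
  [IsManifold (𝓡 d) ∞ M] [T2Space M]
  {P P' : Type} [NormedAddCommGroup P] [NormedSpace ℝ P] [NormedAddCommGroup P'] [NormedSpace ℝ P']
  {k : ℕ}

/-- The space of polarized polynomial densities. -/
abbrev Density (d n : ℕ) (M : Type*) [TopologicalSpace M]
    [ChartedSpace (EuclideanSpace ℝ (Fin d)) M] (k : ℕ) :=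
  MultilinearMap ℝ (fun _ : Fin k => Conf d n M) (Smooth d M)

theorem isSmoothConfFamily_const {Q : Type*} [NormedAddCommGroup Q] [NormedSpace ℝ Q]
    (φ : Conf d n M) : IsSmoothConfFamily (fun _ : Q => φ) :=
  fun i => (φ i).contMDiff.comp contMDiff_snd

theorem IsSmoothConfFamily.comp {Q Q' : Type*} [NormedAddCommGroup Q] [NormedSpace ℝ Q]
    [NormedAddCommGroup Q'] [NormedSpace ℝ Q'] {φ : Q → Conf d n M} (h : IsSmoothConfFamily φ)
    {f : Q' → Q} (hf : ContDiff ℝ ∞ f) : IsSmoothConfFamily (fun q => φ (f q)) :=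
  fun i => (h i).comp ((hf.contMDiff.comp contMDiff_fst).prodMk contMDiff_snd)

namespace IsDensityFamily

theorem zero : IsDensityFamily (fun _ : P => (0 : Density d n M k)) :=
  ⟨⟨0, fun _ _ _ _ _ => rfl⟩, ⟨∅, isCompact_empty, fun _ _ _ _ => rfl⟩,
    fun _ _ _ _ _ _ => contMDiff_const (c := (0 : ℝ))⟩

theorem comp {D : P → Density d n M k} (hD : IsDensityFamily D) {f : P' → P}
    (hf : ContDiff ℝ ∞ f) : IsDensityFamily (fun s => D (f s)) := by
  obtain ⟨⟨r, hr⟩, ⟨K, hK, hKD⟩, hs⟩ := hD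
  refine ⟨⟨r, fun s => hr (f s)⟩, ⟨K, hK, fun s => hKD (f s)⟩, fun Q _ _ _ φ hφ => ?_⟩
  have h1 : ContDiff ℝ ∞ (fun q : P' × Q => (f q.1, q.2)) :=
    (hf.comp contDiff_fst).prodMk contDiff_snd
  exact (hs Q φ hφ).comp ((h1.contMDiff.comp contMDiff_fst).prodMk contMDiff_snd)

theorem jetVanishes_mono {r r' : ℕ} (h : r ≤ r') {x : M} {φ : Conf d n M}
    (hφ : JetVanishes r' x φ) : JetVanishes r x φ :=
  fun i => Ideal.pow_le_pow_right (by omega) (hφ i)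

theorem add {D D' : P → Density d n M k} (hD : IsDensityFamily D) (hD' : IsDensityFamily D') :
    IsDensityFamily (fun s => D s + D' s) := by
  obtain ⟨⟨r, hr⟩, ⟨K, hK, hKD⟩, hs⟩ := hD
  obtain ⟨⟨r', hr'⟩, ⟨K', hK', hKD'⟩, hs'⟩ := hD'
  refine ⟨⟨max r r', fun s x φ i h => ?_⟩, ⟨K ∪ K', hK.union hK', fun s φ x hx => ?_⟩,
    fun Q _ _ _ φ hφ => (hs Q φ hφ).add (hs' Q φ hφ)⟩
  · change D s φ x + D' s φ x = 0
    rw [hr s x φ i (jetVanishes_mono (le_max_left _ _) h),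
      hr' s x φ i (jetVanishes_mono (le_max_right _ _) h), add_zero]
  · change D s φ x + D' s φ x = 0
    rw [hKD s φ x fun h => hx (Or.inl h), hKD' s φ x fun h => hx (Or.inr h), add_zero]

theorem smul {D : P → Density d n M k} (hD : IsDensityFamily D) {c : P → ℝ}
    (hc : ContDiff ℝ ∞ c) : IsDensityFamily (fun s => c s • D s) := by
  obtain ⟨⟨r, hr⟩, ⟨K, hK, hKD⟩, hs⟩ := hD
  refine ⟨⟨r, fun s x φ i h => ?_⟩, ⟨K, hK, fun s φ x hx => ?_⟩, fun Q _ _ _ φ hφ => ?_⟩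
  · change c s * D s φ x = 0
    rw [hr s x φ i h, mul_zero]
  · change c s * D s φ x = 0
    rw [hKD s φ x hx, mul_zero]
  · exact ((hc.comp contDiff_fst).contMDiff.comp contMDiff_fst).mul (hs Q φ hφ)

theorem contMDiff_apply {D : P → Density d n M k} (hD : IsDensityFamily D)
    (φ : Fin k → Conf d n M) :
    ContMDiff (𝓘(ℝ, P).prod (𝓡 d)) 𝓘(ℝ) ∞ (fun q : P × M => D q.1 φ q.2) := by
  have h := hD.2.2 ℝ (fun i _ => φ i) fun i => isSmoothConfFamily_const (φ i)
  have h1 : ContDiff ℝ ∞ (fun q : P => (q, (0 : ℝ))) := contDiff_id.prodMk contDiff_const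
  exact h.comp ((h1.contMDiff.comp contMDiff_fst).prodMk contMDiff_snd)

/-- Divided differences of densities. -/
def dslopeDensity {D : ℝ → Density d n M k} (hD : IsDensityFamily D) (s : ℝ) :
    Density d n M k where
  toFun φ := ⟨fun x => dslope (fun s => D s φ x) 0 s, by
    have h : ContMDiff (𝓘(ℝ).prod (𝓡 d)) 𝓘(ℝ) ∞
        (fun q : ℝ × M => dslope (fun s => D s φ q.2) 0 q.1) :=
      contMDiff_dslope (f := fun s x => D s φ x) (hD.contMDiff_apply φ)
    exact h.comp (contMDiff_const.prodMk contMDiff_id)⟩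
  map_update_add' φ i a b := by
    refine ContMDiffMap.ext fun x => ?_
    have hd : ∀ φ, DifferentiableAt ℝ (fun s => D s φ x) 0 := fun φ =>
      (contMDiff_slice (f := fun s x => D s φ x) (hD.contMDiff_apply φ) x).differentiable
        (by simp) 0
    change dslope (fun s => D s _ x) 0 s = dslope (fun s => D s _ x) 0 s +
      dslope (fun s => D s _ x) 0 s
    have h1 : (fun s => D s (Function.update φ i (a + b)) x) = fun s =>
        D s (Function.update φ i a) x + D s (Function.update φ i b) x :=
      funext fun s => by rw [MultilinearMap.map_update_add]; rfl
    rw [h1]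
    rcases eq_or_ne s 0 with rfl | hs
    · simp only [dslope_same]
      exact deriv_fun_add (hd _) (hd _)
    · simp only [dslope_of_ne _ hs, slope_def_field]
      ring
  map_update_smul' φ i c a := by
    refine ContMDiffMap.ext fun x => ?_
    change dslope (fun s => D s _ x) 0 s = c * dslope (fun s => D s _ x) 0 s
    have h1 : (fun s => D s (Function.update φ i (c • a)) x) = fun s =>
        c * D s (Function.update φ i a) x :=
      funext fun s => by rw [MultilinearMap.map_update_smul]; rfl
    rw [h1]
    rcases eq_or_ne s 0 with rfl | hs
    · simp only [dslope_same]
      exact deriv_const_mul_field _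
    · simp only [dslope_of_ne _ hs, slope_def_field]
      ring

/-- Joint smoothness is required along arbitrary families of configurations, so Hadamard's lemma is
applied with the manifold `Q × M` as parameter space. -/
theorem dslope {D : ℝ → Density d n M k} (hD : IsDensityFamily D) :
    IsDensityFamily (dslopeDensity hD) := by
  obtain ⟨⟨r, hr⟩, ⟨K, hK, hKD⟩, hs⟩ := id hD
  have h0 : ∀ s, _root_.dslope (fun _ : ℝ => (0 : ℝ)) 0 s = 0 := fun s => by
    rcases eq_or_ne s 0 with rfl | hs
    · simp
    · simp [dslope_of_ne _ hs, slope_def_field]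
  refine ⟨⟨r, fun s x φ i h => ?_⟩, ⟨K, hK, fun s φ x hx => ?_⟩, fun Q _ _ _ φ hφ => ?_⟩
  · change _root_.dslope (fun s => D s φ x) 0 s = 0
    simp only [hr _ x φ i h, h0]
  · change _root_.dslope (fun s => D s φ x) 0 s = 0
    simp only [hKD _ φ x hx, h0]
  · have h1 : ContMDiff (𝓘(ℝ).prod (𝓘(ℝ, Q).prod (𝓡 d))) 𝓘(ℝ) ∞
        (fun q : ℝ × (Q × M) => D q.1 (fun i => φ i q.2.1) q.2.2) := by
      have h2 : ContMDiff (𝓘(ℝ).prod (𝓘(ℝ, Q).prod (𝓡 d))) 𝓘(ℝ, ℝ × Q) ∞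
          (fun q : ℝ × (Q × M) => (q.1, q.2.1)) :=
        contMDiff_fst.prodMk_space (contMDiff_fst.comp contMDiff_snd)
      exact (hs Q φ hφ).comp (h2.prodMk (contMDiff_snd.comp contMDiff_snd))
    have h3 := contMDiff_dslope
      (f := fun s (q : Q × M) => D s (fun i => φ i q.1) q.2) h1
    have h4 : ContMDiff (𝓘(ℝ, ℝ × Q).prod (𝓡 d)) (𝓘(ℝ).prod (𝓘(ℝ, Q).prod (𝓡 d))) ∞
        (fun q : (ℝ × Q) × M => (q.1.1, (q.1.2, q.2))) :=
      (contDiff_fst.contMDiff.comp contMDiff_fst).prodMk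
        ((contDiff_snd.contMDiff.comp contMDiff_fst).prodMk contMDiff_snd)
    exact h3.comp h4

variable [MeasurableSpace M] [BorelSpace M] [SecondCountableTopology M] (S : Spacetime d M)

theorem integrable {D : P → Density d n M k} (hD : IsDensityFamily D) (s : P)
    (φ : Fin k → Conf d n M) : Integrable (fun x => D s φ x) S.vol := by
  obtain ⟨-, ⟨K, hK, hKD⟩, -⟩ := hD
  exact (D s φ).contMDiff.continuous.integrable_of_hasCompactSupport
    (HasCompactSupport.intro hK fun x hx => hKD s φ x hx)

theorem contDiff_integral [FiniteDimensional ℝ P] {D : P → Density d n M k}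
    (hD : IsDensityFamily D) {Q : Type} [NormedAddCommGroup Q] [NormedSpace ℝ Q]
    [FiniteDimensional ℝ Q] {φ : Fin k → Q → Conf d n M} (hφ : ∀ i, IsSmoothConfFamily (φ i)) :
    ContDiff ℝ ∞ (fun q : P × Q => ∫ x, D q.1 (fun i => φ i q.2) x ∂S.vol) := by
  obtain ⟨-, ⟨K, hK, hKD⟩, hs⟩ := hD
  have : IsManifold (𝓡 d) 1 M := IsManifold.of_le (n := ∞) (by simp)
  have h1 : (fun q : P × Q => ∫ x, D q.1 (fun i => φ i q.2) x ∂S.vol) =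
      fun q => ∫ x in K, D q.1 (fun i => φ i q.2) x ∂S.vol := funext fun q =>
    (setIntegral_eq_integral_of_forall_compl_eq_zero fun x hx => hKD _ _ x hx).symm
  rw [h1]
  exact contDiff_setIntegral (f := fun (q : P × Q) x => D q.1 (fun i => φ i q.2) x)
    (hs Q φ hφ) hK hK.isClosed.measurableSet hK.measure_lt_top

end IsDensityFamily

variable [MeasurableSpace M] [BorelSpace M] [SecondCountableTopology M] (S : Spacetime d M)

/-- `F` is a smooth family of local functionals near `s₀`. -/
def IsLocalAt (F : P → Functional d n M) (s₀ : P) : Prop :=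
  ∃ (m : ℕ) (D : ∀ k : ℕ, P → Density d n M k), (∀ k, IsDensityFamily (D k)) ∧
    ∀ᶠ s in 𝓝 s₀, ∀ φ, F s φ = ∑ k ∈ Finset.range m, ∫ x, D k s (fun _ => φ) x ∂S.vol

namespace IsLocalAt

variable {S}

theorem congr {F G : P → Functional d n M} {s₀ : P} (hF : IsLocalAt S F s₀)
    (h : ∀ᶠ s in 𝓝 s₀, ∀ φ, G s φ = F s φ) : IsLocalAt S G s₀ := by
  obtain ⟨m, D, hD, h'⟩ := hF
  refine ⟨m, D, hD, ?_⟩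
  filter_upwards [h, h'] with s h1 h2 φ
  rw [h1, h2]

theorem of_density {D : P → Density d n M k} (hD : IsDensityFamily D) (s₀ : P) :
    IsLocalAt S (fun s φ => ∫ x, D s (fun _ => φ) x ∂S.vol) s₀ := by
  classical
  refine ⟨k + 1, fun j => if h : j = k then h ▸ D else fun _ => 0, fun j => ?_,
    Filter.Eventually.of_forall fun s φ => ?_⟩
  · beta_reduce
    split_ifs with h
    · subst h; exact hD
    · exact IsDensityFamily.zero
  · rw [Finset.sum_eq_single k]
    · simp
    · intro j _ hj
      beta_reduce
      rw [dif_neg hj]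
      change ∫ x, (0 : ℝ) ∂S.vol = 0
      simp
    · simp

theorem zero (s₀ : P) : IsLocalAt S (fun _ => (0 : Functional d n M)) s₀ :=
  ⟨0, fun _ _ => 0, fun _ => IsDensityFamily.zero, by simp⟩

/-- The number of homogeneous components can be enlarged. -/
theorem exists_of_le {F : P → Functional d n M} {s₀ : P} (hF : IsLocalAt S F s₀) :
    ∃ m, ∀ m' ≥ m, ∃ D : ∀ k : ℕ, P → Density d n M k, (∀ k, IsDensityFamily (D k)) ∧
      ∀ᶠ s in 𝓝 s₀, ∀ φ, F s φ = ∑ k ∈ Finset.range m', ∫ x, D k s (fun _ => φ) x ∂S.vol := by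
  classical
  obtain ⟨m, D, hD, h⟩ := hF
  refine ⟨m, fun m' hm => ⟨fun k => if k < m then D k else fun _ => 0, fun k => ?_, ?_⟩⟩
  · beta_reduce
    split_ifs
    · exact hD k
    · exact IsDensityFamily.zero
  · filter_upwards [h] with s hs φ
    rw [hs φ]
    have hsub : Finset.range m ⊆ Finset.range m' := Finset.range_subset_range.2 hm
    rw [← Finset.sum_subset hsub]
    · exact Finset.sum_congr rfl fun k hk => by rw [if_pos (Finset.mem_range.1 hk)]
    · intro k _ hk
      rw [if_neg fun h => hk (Finset.mem_range.2 h)]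
      change ∫ x, (0 : ℝ) ∂S.vol = 0
      simp

theorem add {F G : P → Functional d n M} {s₀ : P} (hF : IsLocalAt S F s₀)
    (hG : IsLocalAt S G s₀) : IsLocalAt S (fun s => F s + G s) s₀ := by
  obtain ⟨m, hm⟩ := hF.exists_of_le
  obtain ⟨m', hm'⟩ := hG.exists_of_le
  obtain ⟨D, hD, h⟩ := hm (max m m') (le_max_left _ _)
  obtain ⟨D', hD', h'⟩ := hm' (max m m') (le_max_right _ _)
  refine ⟨max m m', fun k s => D k s + D' k s, fun k => (hD k).add (hD' k), ?_⟩
  filter_upwards [h, h'] with s h1 h2 φ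
  rw [Pi.add_apply, h1, h2, ← Finset.sum_add_distrib]
  exact Finset.sum_congr rfl fun k _ =>
    (integral_add ((hD k).integrable S s _) ((hD' k).integrable S s _)).symm

theorem sum {ι : Type*} (t : Finset ι) {F : ι → P → Functional d n M} {s₀ : P}
    (hF : ∀ i ∈ t, IsLocalAt S (F i) s₀) : IsLocalAt S (fun s => ∑ i ∈ t, F i s) s₀ := by
  classical
  induction t using Finset.induction_on with
  | empty => simpa using zero s₀
  | insert a t ha ih =>
    simp only [Finset.sum_insert ha]
    exact (hF a (Finset.mem_insert_self _ _)).add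
      (ih fun i hi => hF i (Finset.mem_insert_of_mem hi))

theorem smul {F : P → Functional d n M} {s₀ : P} (hF : IsLocalAt S F s₀) {c : P → ℝ}
    (hc : ContDiff ℝ ∞ c) : IsLocalAt S (fun s => c s • F s) s₀ := by
  obtain ⟨m, D, hD, h⟩ := hF
  refine ⟨m, fun k s => c s • D k s, fun k => (hD k).smul hc, ?_⟩
  filter_upwards [h] with s hs φ
  rw [Pi.smul_apply, hs, smul_eq_mul, Finset.mul_sum]
  exact Finset.sum_congr rfl fun k _ => (integral_const_mul _ _).symm

theorem comp {F : P → Functional d n M} {f : P' → P} (hf : ContDiff ℝ ∞ f) {s₀ : P'}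
    (hF : IsLocalAt S F (f s₀)) : IsLocalAt S (fun s => F (f s)) s₀ := by
  obtain ⟨m, D, hD, h⟩ := hF
  exact ⟨m, fun k s => D k (f s), fun k => (hD k).comp hf,
    hf.continuous.continuousAt.eventually h⟩

/-- Subtracting the value at `φ = 0` removes exactly the component of degree `0`, as the components
of positive degree vanish there. -/
theorem reduced {F : P → Functional d n M} {s₀ : P} (hF : IsLocalAt S F s₀) :
    IsLocalAt S (fun s => reduced (F s)) s₀ := by
  classical
  obtain ⟨m, D, hD, h⟩ := hF
  refine ⟨m, fun k => if k = 0 then fun _ => 0 else D k, fun k => ?_, ?_⟩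
  · beta_reduce
    split_ifs
    · exact IsDensityFamily.zero
    · exact hD k
  · filter_upwards [h] with s hs φ
    rw [AMWI.reduced, hs, hs, ← Finset.sum_sub_distrib]
    refine Finset.sum_congr rfl fun k _ => ?_
    split_ifs with hk
    · subst hk
      have : (fun _ : Fin 0 => φ) = fun _ => 0 := Subsingleton.elim _ _
      rw [this, sub_self]
      change 0 = ∫ x, (0 : ℝ) ∂S.vol
      simp
    · have : D k s (fun _ => (0 : Conf d n M)) = 0 :=
        MultilinearMap.map_coord_zero _ (⟨0, Nat.pos_of_ne_zero hk⟩ : Fin k) rfl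
      rw [this]
      have h0 : ∫ x, (0 : Smooth d M) x ∂S.vol = 0 := by
        change ∫ x, (0 : ℝ) ∂S.vol = 0
        simp
      rw [h0, sub_zero]

theorem contDiffAt_eval [FiniteDimensional ℝ P] {F : P → Functional d n M} {s₀ : P}
    (hF : IsLocalAt S F s₀) {Q : Type} [NormedAddCommGroup Q] [NormedSpace ℝ Q]
    [FiniteDimensional ℝ Q] {φ : Q → Conf d n M} (hφ : IsSmoothConfFamily φ) (q₀ : Q) :
    ContDiffAt ℝ ∞ (fun q : P × Q => F q.1 (φ q.2)) (s₀, q₀) := by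
  obtain ⟨m, D, hD, h⟩ := hF
  have h1 : ContDiff ℝ ∞ (fun q : P × Q =>
      ∑ k ∈ Finset.range m, ∫ x, D k q.1 (fun _ => φ q.2) x ∂S.vol) :=
    ContDiff.sum fun k _ => (hD k).contDiff_integral S (φ := fun _ => φ) fun _ => hφ
  refine h1.contDiffAt.congr_of_eventuallyEq ?_
  filter_upwards [continuousAt_fst.eventually h] with q hq using hq _

end IsLocalAt

/-- Supplies the factor `1/s` in difference quotients away from `0` as a globally smooth function,
as `IsLocalAt.smul` demands. -/
theorem exists_contDiff_eq_inv {s₀ : ℝ} (h : s₀ ≠ 0) :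
    ∃ c : ℝ → ℝ, ContDiff ℝ ∞ c ∧ ∀ᶠ s in 𝓝 s₀, c s = s⁻¹ := by
  have hpos : 0 < |s₀| := abs_pos.2 h
  let β : ContDiffBump s₀ := ⟨|s₀| / 4, |s₀| / 2, by linarith, by linarith⟩
  refine ⟨fun s => β s * s⁻¹, ?_, ?_⟩
  · rw [contDiff_iff_contDiffAt]
    intro s
    by_cases hs : s = 0
    · subst hs
      have : (0 : ℝ) ∉ tsupport β := by
        rw [β.tsupport_eq, Metric.mem_closedBall, dist_comm, dist_zero_right, Real.norm_eq_abs]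
        simp only [β]
        linarith
      refine contDiffAt_const (c := (0 : ℝ)) |>.congr_of_eventuallyEq ?_
      filter_upwards [(isClosed_tsupport β).isOpen_compl.mem_nhds this] with x hx
      rw [image_eq_zero_of_notMem_tsupport hx, zero_mul]
    · exact β.contDiff.contDiffAt.mul (contDiffAt_inv ℝ hs)
  · filter_upwards [β.eventuallyEq_one] with s hs
    rw [hs]; simp

namespace IsLocalFamily

variable {S}

theorem zero : IsLocalFamily S (fun _ : P => (0 : Functional d n M)) := fun s => IsLocalAt.zero s

theorem add {F G : P → Functional d n M} (hF : IsLocalFamily S F) (hG : IsLocalFamily S G) :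
    IsLocalFamily S (fun s => F s + G s) := fun s => IsLocalAt.add (hF s) (hG s)

theorem sum {ι : Type*} (t : Finset ι) {F : ι → P → Functional d n M}
    (hF : ∀ i ∈ t, IsLocalFamily S (F i)) : IsLocalFamily S (fun s => ∑ i ∈ t, F i s) :=
  fun s => IsLocalAt.sum t fun i hi => hF i hi s

theorem smul {F : P → Functional d n M} (hF : IsLocalFamily S F) {c : P → ℝ}
    (hc : ContDiff ℝ ∞ c) : IsLocalFamily S (fun s => c s • F s) :=
  fun s => IsLocalAt.smul (hF s) hc

theorem comp {F : P → Functional d n M} (hF : IsLocalFamily S F) {f : P' → P}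
    (hf : ContDiff ℝ ∞ f) : IsLocalFamily S (fun s => F (f s)) :=
  fun s => IsLocalAt.comp hf (hF (f s))

theorem reduced {F : P → Functional d n M} (hF : IsLocalFamily S F) :
    IsLocalFamily S (fun s => AMWI.reduced (F s)) := fun s => IsLocalAt.reduced (hF s)

theorem contDiff_eval [FiniteDimensional ℝ P] {F : P → Functional d n M}
    (hF : IsLocalFamily S F) {Q : Type} [NormedAddCommGroup Q] [NormedSpace ℝ Q]
    [FiniteDimensional ℝ Q] {φ : Q → Conf d n M} (hφ : IsSmoothConfFamily φ) :
    ContDiff ℝ ∞ (fun q : P × Q => F q.1 (φ q.2)) :=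
  contDiff_iff_contDiffAt.2 fun q => IsLocalAt.contDiffAt_eval (hF q.1) hφ q.2

theorem contDiff_apply [FiniteDimensional ℝ P] {F : P → Functional d n M}
    (hF : IsLocalFamily S F) (φ : Conf d n M) : ContDiff ℝ ∞ (fun s => F s φ) :=
  (hF.contDiff_eval (isSmoothConfFamily_const (Q := ℝ) φ)).comp
    (contDiff_id.prodMk (contDiff_const (c := (0 : ℝ))))

/-- Hadamard's lemma for families of local functionals. -/
theorem dslope {F : ℝ → Functional d n M} (hF : IsLocalFamily S F) :
    IsLocalFamily S (fun s φ => dslope (fun s => F s φ) 0 s) := by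
  intro s₀
  rcases eq_or_ne s₀ 0 with rfl | hs₀
  -- Near `s = 0` the difference quotient is taken under the integral, density by density.
  · obtain ⟨m, D, hD, h⟩ := hF 0
    have hR : IsLocalAt S (fun s φ => ∑ k ∈ Finset.range m,
        ∫ x, IsDensityFamily.dslopeDensity (hD k) s (fun _ => φ) x ∂S.vol) (0 : ℝ) := by
      have := IsLocalAt.sum (S := S) (Finset.range m) (s₀ := (0 : ℝ))
        fun k _ => IsLocalAt.of_density (S := S) (hD k).dslope (0 : ℝ)
      exact this.congr (Filter.Eventually.of_forall fun s φ => by simp [Finset.sum_apply])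
    refine hR.congr ?_
    filter_upwards [h] with s hs φ
    have hfc : ∀ k, ContDiff ℝ ∞ (fun s => ∫ x, D k s (fun _ => φ) x ∂S.vol) := fun k =>
      ((hD k).contDiff_integral S (φ := fun _ (_ : ℝ) => φ)
        (fun _ => isSmoothConfFamily_const _)).comp
        (contDiff_id.prodMk (contDiff_const (c := (0 : ℝ))))
    set R : ℝ → ℝ := fun s => ∑ k ∈ Finset.range m,
        ∫ x, IsDensityFamily.dslopeDensity (hD k) s (fun _ => φ) x ∂S.vol with hRdef
    have hRc : Continuous R := continuous_finsetSum _ fun k _ =>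
      (((hD k).dslope.contDiff_integral S (φ := fun _ (_ : ℝ) => φ)
        (fun _ => isSmoothConfFamily_const _)).comp
        (contDiff_id.prodMk (contDiff_const (c := (0 : ℝ))))).continuous
    -- Integrating Hadamard's identity gives `F_t = F_0 + t R_t` for `t` near `0`. With `R`
    -- continuous this identifies `R` with the quotient, also at `t = 0`.
    have heq : ∀ t, (∀ φ, F t φ = ∑ k ∈ Finset.range m, ∫ x, D k t (fun _ => φ) x ∂S.vol) →
        F t φ = F 0 φ + t * R t := by
      intro t ht
      rw [ht φ, h.self_of_nhds φ, hRdef, Finset.mul_sum, ← Finset.sum_add_distrib]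
      refine Finset.sum_congr rfl fun k _ => ?_
      rw [← integral_const_mul, ← integral_add ((hD k).integrable S _ _)
        (((hD k).dslope.integrable S _ _).const_mul t)]
      refine integral_congr_ae (Filter.Eventually.of_forall fun x => ?_)
      have := sub_smul_dslope (fun s => D k s (fun _ => φ) x) 0 t
      simp only [sub_zero, smul_eq_mul] at this
      change _ = D k 0 (fun _ => φ) x + t * _root_.dslope (fun s => D k s (fun _ => φ) x) 0 t
      rw [this]
      ring
    change _root_.dslope (fun s => F s φ) 0 s = R s
    rcases eq_or_ne s 0 with rfl | hs0
    · rw [dslope_same]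
      have h1 : HasDerivAt (fun t => F 0 φ + t * R t) (R 0) 0 := by
        rw [hasDerivAt_iff_tendsto_slope_zero]
        refine ((hRc.tendsto 0).mono_left nhdsWithin_le_nhds).congr' ?_
        filter_upwards [self_mem_nhdsWithin] with t ht
        have ht' : t ≠ 0 := ht
        simp
        field_simp
      exact (h1.congr_of_eventuallyEq (h.mono heq)).deriv
    · rw [dslope_of_ne _ hs0, slope_def_field, heq s hs]
      field_simp
      ring
  -- Away from `0` the quotient is just `(F_s - F_0)/s`.
  · obtain ⟨c, hc, hcs⟩ := exists_contDiff_eq_inv hs₀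
    have h1 : IsLocalAt S (fun s => c s • (F s + (-1 : ℝ) • F 0)) s₀ :=
      IsLocalAt.smul (IsLocalAt.add (hF s₀) (IsLocalAt.smul
        ((hF.comp (contDiff_const (c := (0 : ℝ)))) s₀) contDiff_const)) hc
    refine h1.congr ?_
    filter_upwards [hcs, isOpen_ne.mem_nhds hs₀] with s h2 h3 φ
    rw [dslope_of_ne _ h3, slope_def_field, Pi.smul_apply, h2]
    simp
    field_simp
    ring

end IsLocalFamily

/-- Local functionals are already closed under linear combinations, so taking the span adds nothing.
-/
theorem mem_Floc_iff {F : Functional d n M} :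
    F ∈ Floc n S ↔ IsLocalFamily S (fun _ : ℝ => F) := by
  refine ⟨fun h => ?_, fun h => Submodule.subset_span h⟩
  refine Submodule.span_induction (p := fun F _ => IsLocalFamily S (fun _ : ℝ => F))
    (fun F hF => hF) IsLocalFamily.zero (fun F G _ _ hF hG => hF.add hG)
    (fun c F _ hF => hF.smul contDiff_const) h

theorem isLocalFamily_const {F : Functional d n M} (hF : F ∈ Floc n S) :
    IsLocalFamily S (fun _ : P => F) :=
  ((mem_Floc_iff S).1 hF).comp (contDiff_const (c := (0 : ℝ)))

theorem IsLocalFamily.mem_Floc {F : P → Functional d n M} (hF : IsLocalFamily S F) (s : P) :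
    F s ∈ Floc n S :=
  (mem_Floc_iff S).2 (hF.comp (contDiff_const (c := s)))

theorem reduced_mem_Floc {F : Functional d n M} (hF : F ∈ Floc n S) : reduced F ∈ Floc n S :=
  (mem_Floc_iff S).2 (((mem_Floc_iff S).1 hF).reduced)

theorem reduced_pow_mem_Fnloc {F : Functional d n M} (hF : F ∈ Floc n S) (k : ℕ) :
    reduced F ^ k ∈ Fnloc n S k :=
  Submodule.subset_span ⟨fun _ => reduced F, fun _ =>
    ⟨reduced_mem_Floc S hF, sub_self _⟩, by simp⟩

theorem prod_mem_Fnloc {F : Fin k → Functional d n M} (hF : ∀ i, F i ∈ Floc n S)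
    (h0 : ∀ i, F i 0 = 0) : ∏ i, F i ∈ Fnloc n S k :=
  Submodule.subset_span ⟨F, fun i => ⟨hF i, h0 i⟩, rfl⟩

end LocalFamilies

/-! ### Smooth families of symmetries -/

section SymmetryFamilies

variable {d n : ℕ} {M : Type*} [TopologicalSpace M] [ChartedSpace (EuclideanSpace ℝ (Fin d)) M]
  {P P' : Type} [NormedAddCommGroup P] [NormedSpace ℝ P] [NormedAddCommGroup P'] [NormedSpace ℝ P']

/-- Joint smoothness of the components of a family of symmetries. -/
def HasSmoothComponents (h : P → Gc d n M) : Prop :=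
  ContMDiff (𝓘(ℝ, P).prod (𝓡 d)) (𝓡 d) ∞ (fun q : P × M => (h q.1).ρ q.2) ∧
    (∀ i j, ContMDiff (𝓘(ℝ, P).prod (𝓡 d)) 𝓘(ℝ) ∞ (fun q : P × M => (h q.1).A.val i j q.2)) ∧
    (∀ i, ContMDiff (𝓘(ℝ, P).prod (𝓡 d)) 𝓘(ℝ) ∞ (fun q : P × M => (h q.1).ψ i q.2))

/-- The components of a family of symmetries are trivial outside a common compact set. -/
def HasCommonSupport (h : P → Gc d n M) : Prop :=
  ∃ K : Set M, IsCompact K ∧ ∀ s, ∀ x ∉ K, (h s).ρ x = x ∧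
    (∀ i j, (h s).A.val i j x = (1 : Matrix (Fin n) (Fin n) ℝ) i j) ∧ ∀ i, (h s).ψ i x = 0

theorem isSmoothSymFamily_iff {g : P → Gc d n M} : IsSmoothSymFamily g ↔
    HasCommonSupport g ∧ HasSmoothComponents g ∧ HasSmoothComponents (fun s => (g s)⁻¹) := by
  constructor
  · rintro ⟨h1, h2⟩
    exact ⟨h1, h2 _ (Or.inl rfl), h2 _ (Or.inr rfl)⟩
  · rintro ⟨h1, h2, h3⟩
    exact ⟨h1, by rintro h (rfl | rfl) <;> assumption⟩

namespace Gc

theorem mul_ρ_apply (g h : Gc d n M) (x : M) : (g * h).ρ x = g.ρ (h.ρ x) := rfl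

theorem evalHom_apply (x : M) (f : Smooth d M) :
    ContMDiffMap.evalRingHom (I := 𝓡 d) (I' := 𝓘(ℝ)) (n := ∞) (R := ℝ) x f = f x := rfl

theorem sum_apply {ι : Type*} (t : Finset ι) (f : ι → Smooth d M) (x : M) :
    (∑ i ∈ t, f i) x = ∑ i ∈ t, f i x := by
  rw [← evalHom_apply, map_sum]; rfl

theorem vecMul_apply (φ : Conf d n M) (A : Matrix (Fin n) (Fin n) (Smooth d M)) (j : Fin n) (x : M) :
    (φ ᵥ* A) j x = ∑ i, φ i x * A i j x := by
  rw [Matrix.vecMul, dotProduct, sum_apply]; rfl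

theorem matMul_apply (A B : Matrix (Fin n) (Fin n) (Smooth d M)) (i j : Fin n) (x : M) :
    (A * B) i j x = ∑ k, A i k x * B k j x := by
  rw [Matrix.mul_apply, sum_apply]; rfl

theorem mul_A_apply (g h : Gc d n M) (i j : Fin n) (x : M) :
    (g * h).A.val i j x = ∑ k, g.A.val i k (h.ρ x) * h.A.val k j x :=
  matMul_apply _ _ i j x

theorem mul_ψ_apply (g h : Gc d n M) (j : Fin n) (x : M) :
    (g * h).ψ j x = ∑ i, g.ψ i (h.ρ x) * h.A.val i j x + h.ψ j x := by
  have := vecMul_apply (fun i => pull h.ρ (g.ψ i)) h.A.val j x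
  rw [mul_ψ]
  change ((fun i => pull h.ρ (g.ψ i)) ᵥ* h.A.val) j x + h.ψ j x = _
  rw [this]
  rfl

theorem act_apply (g : Gc d n M) (φ : Conf d n M) (j : Fin n) (x : M) :
    g.act φ j x = ∑ i, φ i (g.ρ x) * g.A.val i j x + g.ψ j x := by
  change ((fun i => pull g.ρ (φ i)) ᵥ* g.A.val) j x + _ = _
  rw [vecMul_apply]
  rfl

theorem one_A_apply (x : M) (i j : Fin n) :
    (1 : GL (Fin n) (Smooth d M)).val i j x = (1 : Matrix (Fin n) (Fin n) ℝ) i j :=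
  (evalGL_eq_one_iff x _).1 (map_one _) i j

theorem one_act (φ : Conf d n M) : (1 : Gc d n M).act φ = φ := by
  funext j
  refine ContMDiffMap.ext fun x => ?_
  have h1 : ∀ i, (1 : Gc d n M).A.val i j x = (1 : Matrix (Fin n) (Fin n) ℝ) i j := fun i =>
    (evalGL_eq_one_iff x (1 : GL (Fin n) (Smooth d M))).1 (map_one _) i j
  have h2 : (1 : Gc d n M).ψ j x = 0 := rfl
  rw [act_apply, h2, add_zero]
  simp only [h1]
  change ∑ i, φ i x * _ = _
  simp [Matrix.one_apply]

theorem act_inv_act (g : Gc d n M) (φ : Conf d n M) : g.act (g⁻¹.act φ) = φ := by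
  rw [← act_mul, inv_mul_cancel, one_act]

end Gc

theorem HasSmoothComponents.mul {g h : P → Gc d n M} (hg : HasSmoothComponents g)
    (hh : HasSmoothComponents h) : HasSmoothComponents (fun s => g s * h s) := by
  obtain ⟨g1, g2, g3⟩ := hg
  obtain ⟨h1, h2, h3⟩ := hh
  have hp : ContMDiff (𝓘(ℝ, P).prod (𝓡 d)) (𝓘(ℝ, P).prod (𝓡 d)) ∞
      (fun q : P × M => (q.1, (h q.1).ρ q.2)) := contMDiff_fst.prodMk h1
  refine ⟨g1.comp hp, fun i j => ?_, fun j => ?_⟩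
  · simp only [Gc.mul_A_apply]
    exact contMDiff_finsetSum fun k _ => ((g2 i k).comp hp).mul (h2 k j)
  · simp only [Gc.mul_ψ_apply]
    exact (contMDiff_finsetSum fun i _ => ((g3 i).comp hp).mul (h2 i j)).add (h3 j)

theorem HasCommonSupport.mul {g h : P → Gc d n M} (hg : HasCommonSupport g)
    (hh : HasCommonSupport h) : HasCommonSupport (fun s => g s * h s) := by
  obtain ⟨K, hK, hg⟩ := hg
  obtain ⟨L, hL, hh⟩ := hh
  refine ⟨K ∪ L, hK.union hL, fun s x hx => ?_⟩
  obtain ⟨hg1, hg2, hg3⟩ := hg s x (fun h' => hx (Or.inl h'))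
  obtain ⟨hh1, hh2, hh3⟩ := hh s x (fun h' => hx (Or.inr h'))
  refine ⟨by rw [Gc.mul_ρ_apply, hh1, hg1], fun i j => ?_, fun i => ?_⟩
  · rw [Gc.mul_A_apply, hh1]
    simp [hg2, hh2, Matrix.one_apply]
  · rw [Gc.mul_ψ_apply, hh1]
    simp [hg3, hh3]

theorem HasCommonSupport.inv {g : P → Gc d n M} (hg : HasCommonSupport g) :
    HasCommonSupport (fun s => (g s)⁻¹) := by
  obtain ⟨K, hK, hg⟩ := hg
  refine ⟨K, hK, fun s x hx => ?_⟩
  obtain ⟨hg1, hg2, hg3⟩ := hg s x hx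
  have hs : (g s).ρ.symm x = x := by
    conv_lhs => rw [← hg1]
    exact (g s).ρ.symm_apply_apply x
  refine ⟨hs, ?_, fun i => ?_⟩
  · rw [← Gc.evalGL_eq_one_iff] at hg2 ⊢
    change Gc.evalGL x (Gc.pullGL (g s).ρ.symm (g s).A⁻¹) = 1
    rw [Gc.evalGL_pullGL, hs, map_inv, hg2, inv_one]
  · have h1 := Gc.vecMul_eq_zero_at x (fun i => pull (g s).ρ.symm ((g s).ψ i))
      (Gc.pullGL (g s).ρ.symm (g s).A⁻¹).val (fun i => by rw [pull_apply, hs, hg3]) i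
    change - (((fun i => pull (g s).ρ.symm ((g s).ψ i)) ᵥ*
      (Gc.pullGL (g s).ρ.symm (g s).A⁻¹).val) i x) = 0
    rw [h1, neg_zero]

namespace IsSmoothSymFamily

theorem mul {g h : P → Gc d n M} (hg : IsSmoothSymFamily g) (hh : IsSmoothSymFamily h) :
    IsSmoothSymFamily (fun s => g s * h s) := by
  rw [isSmoothSymFamily_iff] at *
  refine ⟨hg.1.mul hh.1, hg.2.1.mul hh.2.1, ?_⟩
  simp only [mul_inv_rev]
  exact hh.2.2.mul hg.2.2

theorem inv {g : P → Gc d n M} (hg : IsSmoothSymFamily g) :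
    IsSmoothSymFamily (fun s => (g s)⁻¹) := by
  rw [isSmoothSymFamily_iff] at *
  refine ⟨hg.1.inv, hg.2.2, ?_⟩
  simp only [inv_inv]
  exact hg.2.1

theorem comp {g : P → Gc d n M} (hg : IsSmoothSymFamily g) {f : P' → P} (hf : ContDiff ℝ ∞ f) :
    IsSmoothSymFamily (fun s => g (f s)) := by
  have hp : ContMDiff (𝓘(ℝ, P').prod (𝓡 d)) (𝓘(ℝ, P).prod (𝓡 d)) ∞
      (fun q : P' × M => (f q.1, q.2)) := (hf.contMDiff.comp contMDiff_fst).prodMk contMDiff_snd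
  have key : ∀ {h : P → Gc d n M}, HasSmoothComponents h →
      HasSmoothComponents (fun s => h (f s)) := fun hh =>
    ⟨hh.1.comp hp, fun i j => (hh.2.1 i j).comp hp, fun i => (hh.2.2 i).comp hp⟩
  rw [isSmoothSymFamily_iff] at *
  obtain ⟨⟨K, hK, h1⟩, h2, h3⟩ := hg
  exact ⟨⟨K, hK, fun s => h1 (f s)⟩, key h2, key h3⟩

theorem const (g : Gc d n M) : IsSmoothSymFamily (fun _ : P => g) := by
  have key : ∀ h : Gc d n M, HasSmoothComponents (fun _ : P => h) := fun h =>
    ⟨h.ρ.contMDiff.comp contMDiff_snd, fun i j => (h.A.val i j).contMDiff.comp contMDiff_snd,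
      fun i => (h.ψ i).contMDiff.comp contMDiff_snd⟩
  obtain ⟨K, hK, h1⟩ := g.compact
  exact isSmoothSymFamily_iff.2 ⟨⟨K, hK, fun _ => h1⟩, key _, key _⟩

theorem components {g : P → Gc d n M} (hg : IsSmoothSymFamily g) : HasSmoothComponents g :=
  (isSmoothSymFamily_iff.1 hg).2.1

/-- A smooth family of symmetries maps smooth families of configurations to such families. -/
theorem act {g : P → Gc d n M} (hg : IsSmoothSymFamily g) {φ : P → Conf d n M}
    (hφ : IsSmoothConfFamily φ) : IsSmoothConfFamily (fun q => (g q).act (φ q)) := by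
  obtain ⟨h1, h2, h3⟩ := hg.components
  intro j
  simp only [Gc.act_apply]
  exact (contMDiff_finsetSum fun i _ => ((hφ i).comp (contMDiff_fst.prodMk h1)).mul (h2 i j)).add
    (h3 j)

end IsSmoothSymFamily

end SymmetryFamilies

/-! ### Transformation of local functionals under symmetries -/

section Transformation

variable {d n : ℕ} {M : Type*} [TopologicalSpace M] [ChartedSpace (EuclideanSpace ℝ (Fin d)) M]
  [IsManifold (𝓡 d) ∞ M] [T2Space M]
  {P : Type} [NormedAddCommGroup P] [NormedSpace ℝ P] {k : ℕ}

/-- Pullback as a linear map. -/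
def pullLinear (ρ : Diffeomorph (𝓡 d) (𝓡 d) M M ∞) : Smooth d M →ₗ[ℝ] Smooth d M where
  toFun := pull ρ
  map_add' := map_add _
  map_smul' _ _ := rfl

/-- The linear part `φ ↦ (φ ∘ ρ) A` of a symmetry. -/
def Gc.linAct (g : Gc d n M) : Conf d n M →ₗ[ℝ] Conf d n M where
  toFun φ := (fun i => pullLinear g.ρ (φ i)) ᵥ* g.A.val
  map_add' φ χ := by
    rw [← Matrix.add_vecMul]
    rfl
  map_smul' c φ := by
    rw [RingHom.id_apply, ← Matrix.smul_vecMul]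
    rfl

theorem Gc.linAct_apply (g : Gc d n M) (φ : Conf d n M) (j : Fin n) (x : M) :
    g.linAct φ j x = ∑ i, φ i (g.ρ x) * g.A.val i j x := by
  change ((fun i => pullLinear g.ρ (φ i)) ᵥ* g.A.val) j x = _
  rw [Gc.vecMul_apply]
  rfl

/-- Pullback by `ρ` maps the maximal ideal at `ρ x` into the one at `x`, hence also their powers. So
the jet order of a density is preserved. -/
theorem JetVanishes.linAct (g : Gc d n M) {r : ℕ} {x : M} {φ : Conf d n M}
    (h : JetVanishes r (g.ρ x) φ) : JetVanishes r x (g.linAct φ) := by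
  have h1 : (vanishingIdeal (d := d) (g.ρ x)).map (pull g.ρ) ≤ vanishingIdeal x :=
    Ideal.map_le_iff_le_comap.2 fun f hf => hf
  intro j
  change ∑ i, pull g.ρ (φ i) * g.A.val i j ∈ _
  refine Ideal.sum_mem _ fun i _ => Ideal.mul_mem_right _ _ ?_
  have h2 := Ideal.mem_map_of_mem (pull g.ρ) (h i)
  rw [Ideal.map_pow] at h2
  exact Ideal.pow_right_mono h1 _ h2

theorem contMDiff_of_comp_snd {f : M → ℝ}
    (h : ContMDiff (𝓘(ℝ, ℝ).prod (𝓡 d)) 𝓘(ℝ) ∞ (fun q : ℝ × M => f q.2)) :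
    ContMDiff (𝓡 d) 𝓘(ℝ) ∞ f := by
  have h4 : ContMDiff (𝓡 d) (𝓘(ℝ, ℝ).prod (𝓡 d)) ∞ (fun y : M => ((0 : ℝ), y)) :=
    contMDiff_const.prodMk contMDiff_id
  exact h.comp h4

variable [MeasurableSpace M] [BorelSpace M] [SecondCountableTopology M] (S : Spacetime d M)

theorem contMDiff_jacobian_family {g : P → Gc d n M} (hg : IsSmoothSymFamily g) :
    ContMDiff (𝓘(ℝ, P).prod (𝓡 d)) 𝓘(ℝ) ∞ (fun q : P × M => jacobian S (g q.1).ρ q.2) :=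
  contMDiff_jacobian S (ρ := fun s => (g s).ρ) hg.components.1 hg.inv.components.1

theorem contMDiff_jacobian_single (ρ : Diffeomorph (𝓡 d) (𝓡 d) M M ∞) :
    ContMDiff (𝓡 d) 𝓘(ℝ) ∞ (jacobian S ρ) := by
  have h1 : ContMDiff (𝓘(ℝ, ℝ).prod (𝓡 d)) (𝓡 d) ∞ (fun q : ℝ × M => ρ q.2) :=
    ρ.contMDiff.comp contMDiff_snd
  have h2 : ContMDiff (𝓘(ℝ, ℝ).prod (𝓡 d)) (𝓡 d) ∞ (fun q : ℝ × M => ρ.symm q.2) :=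
    ρ.symm.contMDiff.comp contMDiff_snd
  have h3 : ContMDiff (𝓘(ℝ, ℝ).prod (𝓡 d)) 𝓘(ℝ) ∞ (fun q : ℝ × M => jacobian S ρ q.2) :=
    contMDiff_jacobian S (P := ℝ) (ρ := fun _ => ρ) h1 h2
  exact contMDiff_of_comp_snd h3

/-- The Jacobian as a smooth function. -/
def smoothJacobian (ρ : Diffeomorph (𝓡 d) (𝓡 d) M M ∞) : Smooth d M :=
  ⟨jacobian S ρ, contMDiff_jacobian_single S ρ⟩

/-- The part of the density of `g_* F` in which the slots in `T` carry the linear part of the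
transformation. -/
def transformDensity (g : Gc d n M) (D : Density d n M k) (T : Finset (Fin k)) :
    Density d n M T.card :=
  (LinearMap.mulLeft ℝ (smoothJacobian S g.ρ)).compMultilinearMap
    ((pullLinear g.ρ.symm).compMultilinearMap
      ((D.restr T rfl g.ψ).compLinearMap fun _ => g.linAct))

theorem transformDensity_apply (g : Gc d n M) (D : Density d n M k) (T : Finset (Fin k))
    (φ : Fin T.card → Conf d n M) (y : M) :
    transformDensity S g D T φ y = jacobian S g.ρ y *
      D (fun j => if h : j ∈ T then g.linAct (φ ((T.orderIsoOfFin rfl).symm ⟨j, h⟩)) else g.ψ)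
        (g.ρ.symm y) := rfl

theorem isDensityFamily_transform [FiniteDimensional ℝ P] {g : P → Gc d n M}
    (hg : IsSmoothSymFamily g) {D : P → Density d n M k} (hD : IsDensityFamily D)
    (T : Finset (Fin k)) : IsDensityFamily (fun s => transformDensity S (g s) (D s) T) := by
  obtain ⟨⟨r, hr⟩, ⟨K, hK, hKD⟩, hs⟩ := hD
  obtain ⟨⟨L, hL, hLg⟩, hc, hci⟩ := isSmoothSymFamily_iff.1 hg
  refine ⟨⟨r, fun s y φ i h => ?_⟩, ⟨K ∪ L, hK.union hL, fun s φ y hy => ?_⟩,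
    fun Q _ _ _ φ hφ => ?_⟩
  · rw [transformDensity_apply,
      hr s ((g s).ρ.symm y) _ (T.orderIsoOfFin rfl i : Fin k) ?_, mul_zero]
    rw [dif_pos (T.orderIsoOfFin rfl i).2]
    refine JetVanishes.linAct (g s) ?_
    rw [(g s).ρ.apply_symm_apply]
    simpa only [Subtype.coe_eta, OrderIso.symm_apply_apply] using h
  -- Outside `K ∪ L` the preimage under `ρ` is not in `K`: were it in `L`, it would be `y` itself,
  -- as `y` is fixed; if it is not in `L`, it is fixed and again equals `y`.
  · rw [transformDensity_apply, hKD, mul_zero]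
    intro hx
    have hLs := hLg s ((g s).ρ.symm y)
    by_cases hxL : (g s).ρ.symm y ∈ L
    · have h2 := hLg s y fun h => hy (Or.inr h)
      have h3 : (g s).ρ.symm y = y := by
        conv_lhs => rw [← h2.1]
        exact (g s).ρ.symm_apply_apply y
      rw [h3] at hxL
      exact hy (Or.inr hxL)
    · have h2 := (hLs hxL).1
      rw [(g s).ρ.apply_symm_apply] at h2
      rw [← h2] at hx
      exact hy (Or.inl hx)
  · simp only [transformDensity_apply]
    have hfst : ContMDiff (𝓘(ℝ, P × Q).prod (𝓡 d)) 𝓘(ℝ, P) ∞ (fun q : (P × Q) × M => q.1.1) :=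
      contDiff_fst.contMDiff.comp contMDiff_fst
    have hJ := (contMDiff_jacobian_family S hg).comp (hfst.prodMk contMDiff_snd)
    refine hJ.mul ?_
    -- The arguments of the old density, as families over `P × Q`: transformed configurations in the
    -- slots of `T`, the translation part elsewhere.
    let χ : Fin k → (P × Q) → Conf d n M := fun j q =>
      if h : j ∈ T then (g q.1).linAct (φ ((T.orderIsoOfFin rfl).symm ⟨j, h⟩) q.2) else (g q.1).ψ
    have hχ : ∀ j, IsSmoothConfFamily (χ j) := by
      intro j i
      by_cases hj : j ∈ T
      · simp only [χ, dif_pos hj, Gc.linAct_apply]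
        refine contMDiff_finsetSum fun l _ => ContMDiff.mul ?_ ?_
        · have h1 : ContMDiff (𝓘(ℝ, P × Q).prod (𝓡 d)) (𝓘(ℝ, Q).prod (𝓡 d)) ∞
              (fun q : (P × Q) × M => (q.1.2, (g q.1.1).ρ q.2)) :=
            (contDiff_snd.contMDiff.comp contMDiff_fst).prodMk
              (hc.1.comp (hfst.prodMk contMDiff_snd))
          exact (hφ _ l).comp h1
        · exact (hc.2.1 l i).comp (hfst.prodMk contMDiff_snd)
      · simp only [χ, dif_neg hj]
        exact (hc.2.2 i).comp (hfst.prodMk contMDiff_snd)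
    have h1 := hs (P × Q) χ hχ
    have h2 : ContMDiff (𝓘(ℝ, P × Q).prod (𝓡 d)) (𝓘(ℝ, P × (P × Q)).prod (𝓡 d)) ∞
        (fun q : (P × Q) × M => ((q.1.1, q.1), (g q.1.1).ρ.symm q.2)) := by
      have h3 : ContDiff ℝ ∞ (fun q : P × Q => (q.1, q)) := contDiff_fst.prodMk contDiff_id
      exact (h3.contMDiff.comp contMDiff_fst).prodMk (hci.1.comp (hfst.prodMk contMDiff_snd))
    exact h1.comp h2

/-- The action is affine, so substituting it into a homogeneous density gives terms of every lower
degree. The degree of a term is the number of slots that carry the linear part. -/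
theorem density_act_eq_sum (g : Gc d n M) (D : Density d n M k) (φ : Conf d n M) :
    D (fun _ => g.act φ) = ∑ T : Finset (Fin k), D (fun j => if j ∈ T then g.linAct φ else g.ψ) := by
  classical
  have := D.map_add_univ (fun _ => g.linAct φ) (fun _ => g.ψ)
  rw [show (fun _ : Fin k => g.act φ) = (fun _ => g.linAct φ) + (fun _ => g.ψ) from rfl, this]
  refine Finset.sum_congr rfl fun T _ => ?_
  congr 1

/-- Smooth families of symmetries map smooth families of local functionals to such families. -/
theorem IsLocalFamily.act [FiniteDimensional ℝ P] {F : P → Functional d n M}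
    (hF : IsLocalFamily S F) {g : P → Gc d n M} (hg : IsSmoothSymFamily g) :
    IsLocalFamily S (fun s φ => F s ((g s).act φ)) := by
  intro s₀
  obtain ⟨m, D, hD, h⟩ := hF s₀
  have h1 : IsLocalAt S (fun s => ∑ k ∈ Finset.range m, ∑ T : Finset (Fin k),
      fun φ : Conf d n M => ∫ y, transformDensity S (g s) (D k s) T (fun _ => φ) y ∂S.vol) s₀ :=
    IsLocalAt.sum _ fun k _ => IsLocalAt.sum _ fun T _ =>
      IsLocalAt.of_density (isDensityFamily_transform S hg (hD k) T) s₀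
  refine h1.congr ?_
  filter_upwards [h] with s hs φ
  rw [hs, Finset.sum_apply]
  refine Finset.sum_congr rfl fun k _ => ?_
  rw [Finset.sum_apply, density_act_eq_sum, ← integral_finsetSum]
  -- The density of `g_* F` at `x` depends on jets at `ρ x`. Substituting `y = ρ x` makes it local
  -- in `y` again, at the cost of the Jacobian.
  · rw [← integral_comp_diffeomorph S (g s).ρ]
    refine integral_congr_ae (Filter.Eventually.of_forall fun y => ?_)
    simp only [transformDensity_apply, dite_eq_ite]
    rw [Gc.sum_apply, Finset.mul_sum]
  · exact fun T _ => (isDensityFamily_transform S hg (hD k) T).integrable S s _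

end Transformation

/-! ### The free Lagrangian and the affine action -/

section Lagrangian

variable {d n : ℕ} {M : Type*} [TopologicalSpace M] [ChartedSpace (EuclideanSpace ℝ (Fin d)) M]

theorem mdifferentiableAt_smooth (f : Smooth d M) (x : M) :
    MDifferentiableAt (𝓡 d) 𝓘(ℝ) f x :=
  f.contMDiff.contMDiffAt.mdifferentiableAt (by simp)

theorem dAt_add (f h : Smooth d M) (x : M) :
    dAt (d := d) (f + h : Smooth d M) x = dAt f x + dAt h x :=
  mfderiv_add (mdifferentiableAt_smooth f x) (mdifferentiableAt_smooth h x)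

theorem dAt_smul (c : ℝ) (f : Smooth d M) (x : M) :
    dAt (d := d) (c • f : Smooth d M) x = c • dAt f x :=
  const_smul_mfderiv (mdifferentiableAt_smooth f x) c

theorem dAt_mul_eq_zero {f h : Smooth d M} {x : M} (hf : f x = 0) (hh : h x = 0) :
    dAt (d := d) (f * h : Smooth d M) x = 0 := by
  have h1 := (mdifferentiableAt_smooth f x).hasMFDerivAt.mul'
    (mdifferentiableAt_smooth h x).hasMFDerivAt
  have h2 := h1.mfderiv
  change mfderiv (𝓡 d) 𝓘(ℝ) (⇑f * ⇑h) x = 0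
  rw [h2]
  refine ContinuousLinearMap.ext fun v => ?_
  change f x * dAt (d := d) h x v + dAt (d := d) f x v * h x = (0 : ℝ)
  rw [hf, hh, zero_mul, mul_zero, add_zero]

theorem JetVanishes.apply_eq_zero {x : M} {φ : Conf d n M} (h : JetVanishes 1 x φ) (i : Fin n) :
    φ i x = 0 ∧ dAt (d := d) (φ i) x = 0 := by
  have h1 := h i
  rw [show (1 + 1 : ℕ) = 2 from rfl, pow_two] at h1
  refine Submodule.mul_induction_on (C := fun f : Smooth d M => f x = 0 ∧ dAt (d := d) f x = 0) h1
    (fun f hf g hg => ?_) (fun f g hf hg => ?_)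
  · have hf' : f x = 0 := hf
    have hg' : g x = 0 := hg
    exact ⟨by change f x * g x = 0; rw [hf', zero_mul], dAt_mul_eq_zero hf' hg'⟩
  · exact ⟨by change f x + g x = 0; rw [hf.1, hg.1, add_zero], by rw [dAt_add, hf.2, hg.2, add_zero]⟩

variable [IsManifold (𝓡 d) ∞ M] [T2Space M] [MeasurableSpace M] (S : Spacetime d M) (m : ℝ)

/-- The polarization of the free Lagrangian. -/
def lagrB (φ χ : Conf d n M) (x : M) : ℝ :=
  (1 / 2) * ∑ i, (S.coMetric x (dAt (φ i) x) (dAt (χ i) x) - m ^ 2 * (φ i x * χ i x))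

theorem lagr_eq (φ : Conf d n M) (x : M) : lagr S m φ x = lagrB S m φ φ x := by
  simp only [lagr, lagrB, sq (φ _ x)]

theorem lagrB_comm (φ χ : Conf d n M) (x : M) : lagrB S m φ χ x = lagrB S m χ φ x := by
  simp only [lagrB]
  congr 1
  refine Finset.sum_congr rfl fun i _ => ?_
  rw [S.symm, mul_comm (φ i x)]

theorem lagrB_add_right (φ χ χ' : Conf d n M) (x : M) :
    lagrB S m φ (χ + χ') x = lagrB S m φ χ x + lagrB S m φ χ' x := by
  simp only [lagrB]
  rw [← mul_add, ← Finset.sum_add_distrib]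
  congr 1
  refine Finset.sum_congr rfl fun i _ => ?_
  rw [Pi.add_apply, dAt_add, map_add]
  change _ - m ^ 2 * (φ i x * (χ i x + χ' i x)) = _
  ring

theorem lagrB_smul_right (c : ℝ) (φ χ : Conf d n M) (x : M) :
    lagrB S m φ (c • χ) x = c * lagrB S m φ χ x := by
  simp only [lagrB]
  rw [mul_left_comm, Finset.mul_sum (a := c)]
  refine congrArg _ (Finset.sum_congr rfl fun i _ => ?_)
  rw [Pi.smul_apply, dAt_smul, map_smul, smul_eq_mul]
  change _ - m ^ 2 * (φ i x * (c * χ i x)) = _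
  ring

theorem lagrB_congr {φ φ' χ χ' : Conf d n M} {x : M} (h : ∀ᶠ y in 𝓝 x, ∀ i, φ i y = φ' i y)
    (h' : ∀ᶠ y in 𝓝 x, ∀ i, χ i y = χ' i y) : lagrB S m φ χ x = lagrB S m φ' χ' x := by
  simp only [lagrB]
  congr 1
  refine Finset.sum_congr rfl fun i _ => ?_
  rw [dAt_congr (d := d) (h.mono fun y hy => hy i), dAt_congr (d := d) (h'.mono fun y hy => hy i),
    h.self_of_nhds i, h'.self_of_nhds i]

theorem lagrB_zero_right (φ : Conf d n M) (x : M) : lagrB S m φ 0 x = 0 := by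
  have := lagrB_smul_right S m 0 φ 0 x
  rwa [zero_smul, zero_mul] at this

/-- The Lagrangian is quadratic, so it is an exact polynomial in `t` along a line; this makes its
derivative and the integral commute by inspection. -/
theorem lagr_add_smul (φ η : Conf d n M) (t : ℝ) (x : M) :
    lagr S m (φ + t • η) x = lagr S m φ x + t * (2 * lagrB S m φ η x) + t ^ 2 * lagr S m η x := by
  simp only [lagr_eq]
  rw [lagrB_add_right, lagrB_smul_right, lagrB_comm S m (φ + t • η) φ,
    lagrB_comm S m (φ + t • η) η, lagrB_add_right, lagrB_add_right, lagrB_smul_right,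
    lagrB_smul_right, lagrB_comm S m η φ]
  ring

theorem deriv_lagr (φ η : Conf d n M) (x : M) :
    deriv (fun t : ℝ => lagr S m (φ + t • η) x) 0 = 2 * lagrB S m φ η x := by
  simp only [lagr_add_smul]
  have h1 : HasDerivAt (fun t : ℝ => lagr S m φ x + t * (2 * lagrB S m φ η x) +
      t ^ 2 * lagr S m η x) (1 * (2 * lagrB S m φ η x) + (2 : ℕ) * (0 : ℝ) ^ (2 - 1) * lagr S m η x)
      0 := (((hasDerivAt_id (0 : ℝ)).mul_const _).const_add _).add
        ((hasDerivAt_pow 2 (0 : ℝ)).mul_const _)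
  rw [h1.deriv]
  simp

theorem contMDiff_lagrB {Q : Type*} [NormedAddCommGroup Q] [NormedSpace ℝ Q]
    {φ χ : Q → Conf d n M} (hφ : IsSmoothConfFamily φ) (hχ : IsSmoothConfFamily χ) :
    ContMDiff (𝓘(ℝ, Q).prod (𝓡 d)) 𝓘(ℝ) ∞
      (fun q : Q × M => lagrB S m (φ q.1) (χ q.1) q.2) := by
  refine contMDiff_const.mul (contMDiff_finsetSum fun i _ => ?_)
  exact (contMDiff_coMetric S (f := fun q => φ q i) (h := fun q => χ q i) (hφ i) (hχ i)).sub (contMDiff_const.mul ((hφ i).mul (hχ i)))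

theorem contMDiff_lagrB_single (φ χ : Conf d n M) :
    ContMDiff (𝓡 d) 𝓘(ℝ) ∞ (lagrB S m φ χ) := by
  have h := contMDiff_lagrB S m (Q := ℝ) (isSmoothConfFamily_const φ) (isSmoothConfFamily_const χ)
  exact contMDiff_of_comp_snd (f := lagrB S m φ χ) h

/-- The polarized density of `L(f)`. -/
def lagrDensity (f : Smooth d M) : Density d n M 2 where
  toFun φ := f * ⟨lagrB S m (φ 0) (φ 1), contMDiff_lagrB_single S m _ _⟩
  map_update_add' φ i a b := by
    ext x
    change f x * lagrB S m _ _ x = f x * lagrB S m _ _ x + f x * lagrB S m _ _ x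
    rw [← mul_add]
    congr 1
    fin_cases i
    · simp only [Fin.zero_eta, Function.update_self, ne_eq, one_ne_zero, not_false_eq_true,
        Function.update_of_ne]
      rw [lagrB_comm, lagrB_add_right, lagrB_comm S m a, lagrB_comm S m b]
    · simp only [Fin.mk_one, Function.update_self, ne_eq, zero_ne_one, not_false_eq_true,
        Function.update_of_ne]
      rw [lagrB_add_right]
  map_update_smul' φ i c a := by
    ext x
    change f x * lagrB S m _ _ x = c * (f x * lagrB S m _ _ x)
    rw [mul_left_comm]
    congr 1
    fin_cases i
    · simp only [Fin.zero_eta, Function.update_self, ne_eq, one_ne_zero, not_false_eq_true,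
        Function.update_of_ne]
      rw [lagrB_comm, lagrB_smul_right, lagrB_comm S m a]
    · simp only [Fin.mk_one, Function.update_self, ne_eq, zero_ne_one, not_false_eq_true,
        Function.update_of_ne]
      rw [lagrB_smul_right]

theorem lagrDensity_apply (f : Smooth d M) (φ : Fin 2 → Conf d n M) (x : M) :
    lagrDensity S m f φ x = f x * lagrB S m (φ 0) (φ 1) x := rfl

theorem lagrB_eq_zero_of_jet {φ χ : Conf d n M} {x : M} (h : JetVanishes 1 x χ) :
    lagrB S m φ χ x = 0 := by
  simp only [lagrB]
  rw [Finset.sum_eq_zero, mul_zero]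
  intro i _
  rw [(h.apply_eq_zero i).1, (h.apply_eq_zero i).2]
  simp

theorem isDensityFamily_lagr {f : Smooth d M} {K : Set M} (hK : IsCompact K)
    (hf : ∀ x ∉ K, f x = 0) {P : Type} [NormedAddCommGroup P] [NormedSpace ℝ P] :
    IsDensityFamily (fun _ : P => (lagrDensity S m f : Density d n M 2)) := by
  refine ⟨⟨1, fun _ x φ i h => ?_⟩, ⟨K, hK, fun _ φ x hx => ?_⟩, fun Q _ _ _ φ hφ => ?_⟩
  · rw [lagrDensity_apply]
    fin_cases i
    · rw [lagrB_comm]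
      exact mul_eq_zero_of_right _ (lagrB_eq_zero_of_jet S m h)
    · exact mul_eq_zero_of_right _ (lagrB_eq_zero_of_jet S m h)
  · rw [lagrDensity_apply, hf x hx, zero_mul]
  · simp only [lagrDensity_apply]
    have h1 := contMDiff_lagrB S m (hφ 0) (hφ 1)
    exact (f.contMDiff.comp contMDiff_snd).mul
      (h1.comp ((contDiff_snd.contMDiff.comp contMDiff_fst).prodMk contMDiff_snd))

variable [BorelSpace M] [SecondCountableTopology M]

/-- The functional `L(f)`. -/
def lagrFunctional (f : Smooth d M) : Functional d n M :=
  fun φ => ∫ x, f x * lagr S m φ x ∂S.vol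

theorem lagrFunctional_mem_Floc {f : Smooth d M} {K : Set M} (hK : IsCompact K)
    (hf : ∀ x ∉ K, f x = 0) : lagrFunctional S m f ∈ Floc n S := by
  rw [mem_Floc_iff]
  intro s
  refine (IsLocalAt.of_density (isDensityFamily_lagr S m hK hf) s).congr ?_
  refine Filter.Eventually.of_forall fun _ φ => ?_
  simp only [lagrFunctional, lagr_eq, lagrDensity_apply]

theorem exists_cutoff {K : Set M} (hK : IsCompact K) : ∃ f : Smooth d M, (∀ x ∈ K, f x = 1) ∧
    ∃ L : Set M, IsCompact L ∧ ∀ x ∉ L, f x = 0 := by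
  have : LocallyCompactSpace M := Manifold.locallyCompact_of_finiteDimensional (𝓡 d)
  obtain ⟨L, hL, hKL⟩ := exists_compact_superset hK
  obtain ⟨f, hf1, hf0, -⟩ := exists_contMDiffMap_one_nhds_of_subset_interior (n := ⊤) (𝓡 d)
    hK.isClosed hKL
  exact ⟨f, fun x hx => hf1.self_of_nhdsSet x hx, L, hL, hf0⟩

/-- `g` is trivial outside `K`. -/
def Gc.SupportedIn (g : Gc d n M) (K : Set M) : Prop := ∀ x ∉ K, g.ρ x = x ∧
  (∀ i j, g.A.val i j x = (1 : Matrix (Fin n) (Fin n) ℝ) i j) ∧ ∀ i, g.ψ i x = 0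

theorem Gc.SupportedIn.act_apply {g : Gc d n M} {K : Set M} (hg : g.SupportedIn K)
    (φ : Conf d n M) {x : M} (hx : x ∉ K) (i : Fin n) : g.act φ i x = φ i x := by
  obtain ⟨h1, h2, h3⟩ := hg x hx
  rw [Gc.act_apply, h1, h3]
  simp [h2, Matrix.one_apply]

theorem Gc.SupportedIn.lagr_act {g : Gc d n M} {K : Set M} (hg : g.SupportedIn K)
    (hK : IsClosed K) (φ : Conf d n M) {x : M} (hx : x ∉ K) :
    lagr S m (g.act φ) x = lagr S m φ x := by
  have h : ∀ᶠ y in 𝓝 x, ∀ i, g.act φ i y = φ i y := by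
    filter_upwards [hK.isOpen_compl.mem_nhds hx] with y hy i using hg.act_apply φ hy i
  rw [lagr_eq, lagr_eq, lagrB_congr S m h h]

theorem integrable_lagrFunctional {f : Smooth d M} {K : Set M} (hK : IsCompact K)
    (hf : ∀ x ∉ K, f x = 0) (φ : Conf d n M) :
    Integrable (fun x => f x * lagr S m φ x) S.vol := by
  have := (isDensityFamily_lagr (n := n) S m hK hf (P := ℝ)).integrable S 0 (fun _ => φ)
  simpa only [lagrDensity_apply, ← lagr_eq] using this

/-- On `K` the cutoff is `1`; off the closed set `K` the transformed and the original configuration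
have the same germ. Thus `δ_g L` becomes a difference of two local functionals. -/
theorem deltaL_eq {g : Gc d n M} {K : Set M} (hK : IsCompact K) (hg : g.SupportedIn K)
    {f : Smooth d M} (hf : ∀ x ∈ K, f x = 1) {L : Set M} (hL : IsCompact L)
    (hfL : ∀ x ∉ L, f x = 0) (φ : Conf d n M) :
    deltaL S m g φ = lagrFunctional S m f (g.act φ) - lagrFunctional S m f φ := by
  rw [lagrFunctional, lagrFunctional, ← integral_sub (integrable_lagrFunctional S m hL hfL _)
    (integrable_lagrFunctional S m hL hfL _), deltaL]
  refine integral_congr_ae (Filter.Eventually.of_forall fun x => ?_)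
  beta_reduce
  by_cases hx : x ∈ K
  · rw [hf x hx, one_mul, one_mul]
  · rw [hg.lagr_act S m hK.isClosed φ hx]
    simp

theorem IsLocalFamily.deltaL {P : Type} [NormedAddCommGroup P] [NormedSpace ℝ P]
    [FiniteDimensional ℝ P] {g : P → Gc d n M} (hg : IsSmoothSymFamily g) :
    IsLocalFamily S (fun s => deltaL S m (g s)) := by
  obtain ⟨⟨K, hK, h⟩, -⟩ := isSmoothSymFamily_iff.1 hg
  obtain ⟨f, hf, L, hL, hfL⟩ := exists_cutoff (d := d) hK
  have h1 : IsLocalFamily S (fun _ : P => lagrFunctional (n := n) S m f) :=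
    isLocalFamily_const S (lagrFunctional_mem_Floc S m hL hfL)
  have h2 := (h1.act S hg).add (h1.smul (contDiff_const (c := (-1 : ℝ))))
  convert h2 using 2 with s
  funext φ
  rw [deltaL_eq S m hK (h s) hf hL hfL]
  simp [sub_eq_add_neg]

theorem IsLocalFamily.actL {P : Type} [NormedAddCommGroup P] [NormedSpace ℝ P]
    [FiniteDimensional ℝ P] {g : P → Gc d n M} (hg : IsSmoothSymFamily g)
    {F : P → Functional d n M} (hF : IsLocalFamily S F) :
    IsLocalFamily S (fun s => actL S m (g s) (F s)) :=
  (IsLocalFamily.deltaL S m hg).add (hF.act S hg)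

/-- This is the cocycle identity of `δL` for `g⁻¹` and `g`. With one cutoff for both supports it
telescopes. -/
theorem deltaL_inv (g : Gc d n M) (φ : Conf d n M) :
    deltaL S m g⁻¹ φ + deltaL S m g (g⁻¹.act φ) = 0 := by
  obtain ⟨K, hK, h⟩ := g.compact
  obtain ⟨K', hK', h'⟩ := (g⁻¹).compact
  obtain ⟨f, hf, L, hL, hfL⟩ := exists_cutoff (d := d) (hK.union hK')
  rw [deltaL_eq S m hK h (fun x hx => hf x (Or.inl hx)) hL hfL,
    deltaL_eq S m hK' h' (fun x hx => hf x (Or.inr hx)) hL hfL, Gc.act_inv_act]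
  ring

/-- The action is affine: a perturbation `W` of its argument passes through its linear part only,
and the inhomogeneous terms of `g` and `g⁻¹` cancel. This brings the right-hand side of the cocycle
relation into the form `F + U`. -/
theorem actL_inv_actL_add (g : Gc d n M) (G W : Functional d n M) (φ : Conf d n M) :
    actL S m g⁻¹ (actL S m g G + W) φ = G φ + W (g⁻¹.act φ) := by
  change deltaL S m g⁻¹ φ + (deltaL S m g (g⁻¹.act φ) + G (g.act (g⁻¹.act φ)) + W (g⁻¹.act φ)) = _
  rw [Gc.act_inv_act]
  linear_combination deltaL_inv S m g φ

end Lagrangian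

/-! ### Derivatives along curves of symmetries -/

section Tangent

variable {d n : ℕ} {M : Type*} [TopologicalSpace M] [ChartedSpace (EuclideanSpace ℝ (Fin d)) M]

theorem LieGc.act_apply (X : LieGc d n M) (φ : Conf d n M) (j : Fin n) (x : M) :
    X.act φ j x = ∑ i, φ i x * X.a i j x + X.v (φ j) x + X.p j x := by
  change (φ ᵥ* X.a) j x + _ + _ = _
  rw [Gc.vecMul_apply]

theorem IsTangent.hasDerivAt_act {H : ℝ → Gc d n M} {X : LieGc d n M} (h : IsTangent H X)
    (φ : Conf d n M) (j : Fin n) (x : M) :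
    HasDerivAt (fun s => (H s).act φ j x) (X.act φ j x) 0 := by
  obtain ⟨h0, h⟩ := h
  obtain ⟨hA, hψ, hv⟩ := h x
  simp only [Gc.act_apply]
  have hA0 : ∀ i, (H 0).A.val i j x = (1 : Matrix (Fin n) (Fin n) ℝ) i j := fun i => by
    rw [h0]
    exact (Gc.evalGL_eq_one_iff x (1 : GL (Fin n) (Smooth d M))).1 (map_one _) i j
  have hρ0 : (H 0).ρ x = x := by rw [h0]; rfl
  have h1 : HasDerivAt (fun s => ∑ i, φ i ((H s).ρ x) * (H s).A.val i j x + (H s).ψ j x)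
      (∑ i, (X.v (φ i) x * (H 0).A.val i j x + φ i ((H 0).ρ x) * X.a i j x) + X.p j x) 0 :=
    (HasDerivAt.fun_sum fun i _ => (hv (φ i)).mul (hA i j)).add (hψ j)
  convert h1 using 1
  rw [LieGc.act_apply, Finset.sum_add_distrib]
  simp only [hA0, hρ0, Matrix.one_apply, mul_ite, mul_one, mul_zero, Finset.sum_ite_eq',
    Finset.mem_univ, if_true]
  ring

variable [IsManifold (𝓡 d) ∞ M] [T2Space M]

/-- The difference quotients of a smooth family of configurations. -/
def dslopeConf {φ : ℝ → Conf d n M} (h : IsSmoothConfFamily φ) (s : ℝ) : Conf d n M :=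
  fun i => ⟨fun x => dslope (fun s => φ s i x) 0 s, by
    have h1 : ContMDiff (𝓘(ℝ).prod (𝓡 d)) 𝓘(ℝ) ∞
        (fun q : ℝ × M => dslope (fun s => φ s i q.2) 0 q.1) :=
      contMDiff_dslope (f := fun s x => φ s i x) (h i)
    exact h1.comp (contMDiff_const.prodMk contMDiff_id)⟩

theorem isSmoothConfFamily_dslopeConf {φ : ℝ → Conf d n M} (h : IsSmoothConfFamily φ) :
    IsSmoothConfFamily (dslopeConf h) :=
  fun i => contMDiff_dslope (f := fun s x => φ s i x) (h i)

theorem eq_add_smul_dslopeConf {φ : ℝ → Conf d n M} (h : IsSmoothConfFamily φ) (s : ℝ) :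
    φ s = φ 0 + s • dslopeConf h s := by
  funext i
  refine ContMDiffMap.ext fun x => ?_
  change φ s i x = φ 0 i x + s * dslope (fun s => φ s i x) 0 s
  have := sub_smul_dslope (fun s => φ s i x) 0 s
  simp only [sub_zero, smul_eq_mul] at this
  linarith

variable [MeasurableSpace M] [BorelSpace M] [SecondCountableTopology M] {S : Spacetime d M}

/-- The derivative of a local functional along a smooth curve of configurations. -/
theorem deriv_comp_confFamily {F : Functional d n M} (hF : F ∈ Floc n S) {φ : ℝ → Conf d n M}
    (hφ : IsSmoothConfFamily φ) {η : Conf d n M}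
    (hη : ∀ i x, HasDerivAt (fun s => φ s i x) (η i x) 0) :
    deriv (fun s => F (φ s)) 0 = deriv (fun s : ℝ => F (φ 0 + s • η)) 0 := by
  have h0 : dslopeConf hφ 0 = η := by
    funext i
    refine ContMDiffMap.ext fun x => ?_
    change dslope (fun s => φ s i x) 0 0 = η i x
    rw [dslope_same, (hη i x).deriv]
  -- The family `φ_0 + r D_t`, with `D_t` the difference quotient, is the given curve on the
  -- diagonal, the straight line in direction `η` for `t = 0`, and constant for `r = 0`. So
  -- `deriv_diag` compares the curve with the line.
  have hfam : IsSmoothConfFamily (fun q : ℝ × ℝ => φ 0 + q.1 • dslopeConf hφ q.2) := by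
    intro i
    have h1 : ContMDiff (𝓘(ℝ, ℝ × ℝ).prod (𝓡 d)) 𝓘(ℝ) ∞ (fun q : (ℝ × ℝ) × M => q.1.1) :=
      contDiff_fst.contMDiff.comp contMDiff_fst
    have h2 := (isSmoothConfFamily_dslopeConf hφ).comp (contDiff_snd (E := ℝ) (F := ℝ))
    exact ((φ 0 i).contMDiff.comp contMDiff_snd).add (h1.mul (h2 i))
  have hsm : ContDiff ℝ ∞ (fun q : ℝ × ℝ => F (φ 0 + q.1 • dslopeConf hφ q.2)) := by
    have := (isLocalFamily_const S hF (P := ℝ)).contDiff_eval hfam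
    exact this.comp ((contDiff_const (c := (0 : ℝ))).prodMk contDiff_id)
  have h3 := deriv_diag (f := fun s t => F (φ 0 + s • dslopeConf hφ t)) hsm
  simp only [zero_smul, add_zero, deriv_const, h0] at h3
  rw [← h3]
  congr 1
  funext s
  rw [eq_add_smul_dslopeConf hφ s]

variable {H : ℝ → Gc d n M} {X : LieGc d n M}

theorem IsTangent.deriv_comp_act (hX : IsTangent H X) (hH : IsSmoothSymFamily H)
    {F : Functional d n M} (hF : F ∈ Floc n S) (φ : Conf d n M) :
    deriv (fun s => F ((H s).act φ)) 0 = partialX X F φ := by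
  rw [deriv_comp_confFamily hF (hH.act (isSmoothConfFamily_const φ))
    (η := X.act φ) (fun i x => hX.hasDerivAt_act φ i x), hX.1, Gc.one_act]
  rfl

theorem contDiff_comp_act {P : Type} [NormedAddCommGroup P] [NormedSpace ℝ P]
    [FiniteDimensional ℝ P] {g : P → Gc d n M} (hg : IsSmoothSymFamily g) {F : P → Functional d n M}
    (hF : IsLocalFamily S F) (φ : Conf d n M) : ContDiff ℝ ∞ (fun s => F s ((g s).act φ)) :=
  (hF.act S hg).contDiff_apply φ

/-- Differentiating the constant `H_s⁻¹ H_s = e` by `deriv_diag` gives the sign, without computing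
the inverse curve. -/
theorem IsTangent.deriv_comp_inv_act (hX : IsTangent H X) (hH : IsSmoothSymFamily H)
    {F : Functional d n M} (hF : F ∈ Floc n S) (φ : Conf d n M) :
    deriv (fun s => F ((H s)⁻¹.act φ)) 0 = - partialX X F φ := by
  have h1 : ContDiff ℝ ∞ (fun q : ℝ × ℝ => F (((H q.2)⁻¹ * H q.1).act φ)) :=
    contDiff_comp_act ((hH.inv.comp contDiff_snd).mul (hH.comp contDiff_fst))
      (isLocalFamily_const S hF) φ
  have h2 := deriv_diag (f := fun r s => F (((H s)⁻¹ * H r).act φ)) h1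
  simp only [inv_mul_cancel, deriv_const, hX.1, mul_one, inv_one, one_mul] at h2
  rw [hX.deriv_comp_act hH hF] at h2
  linarith

/-- `L(f)` along the direction `φX` is a quadratic polynomial in `t`, whose linear coefficient is
the integral of the derivative of the density. Off `K` the direction vanishes as a germ, so the
cutoff is irrelevant. -/
theorem partialXL_eq {K : Set M} (hK : IsCompact K) {m : ℝ} (X : LieGc d n M)
    (hX : ∀ x ∉ K, (∀ i j, X.a i j x = 0) ∧ (∀ i, X.p i x = 0) ∧ ∀ f, X.v f x = 0)
    {f : Smooth d M} (hf : ∀ x ∈ K, f x = 1) {L : Set M} (hL : IsCompact L)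
    (hfL : ∀ x ∉ L, f x = 0) (φ : Conf d n M) :
    partialXL S m X φ = partialX X (lagrFunctional S m f) φ := by
  have hint := (isDensityFamily_lagr (n := n) S m hL hfL (P := ℝ)).integrable S 0 ![φ, X.act φ]
  simp only [lagrDensity_apply, Matrix.cons_val_zero, Matrix.cons_val_one] at hint
  have h1 : ∀ t : ℝ, lagrFunctional S m f (φ + t • X.act φ) = lagrFunctional S m f φ +
      t * (2 * ∫ x, f x * lagrB S m φ (X.act φ) x ∂S.vol) +
      t ^ 2 * lagrFunctional S m f (X.act φ) := by
    intro t
    simp only [lagrFunctional]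
    rw [← integral_const_mul, ← integral_const_mul, ← integral_const_mul, ← integral_add,
      ← integral_add]
    · refine integral_congr_ae (Filter.Eventually.of_forall fun x => ?_)
      beta_reduce
      rw [lagr_add_smul]
      ring
    · exact (integrable_lagrFunctional S m hL hfL φ).add ((hint.const_mul _).const_mul _)
    · exact (integrable_lagrFunctional S m hL hfL _).const_mul _
    · exact integrable_lagrFunctional S m hL hfL _
    · exact (hint.const_mul _).const_mul _
  have h2 : HasDerivAt (fun t : ℝ => lagrFunctional S m f (φ + t • X.act φ))
      (1 * (2 * ∫ x, f x * lagrB S m φ (X.act φ) x ∂S.vol) +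
        (2 : ℕ) * (0 : ℝ) ^ (2 - 1) * lagrFunctional S m f (X.act φ)) 0 := by
    simp only [h1]
    exact (((hasDerivAt_id (0 : ℝ)).mul_const _).const_add _).add
        ((hasDerivAt_pow 2 (0 : ℝ)).mul_const _)
  change _ = deriv (fun t : ℝ => lagrFunctional S m f (φ + t • X.act φ)) 0
  rw [h2.deriv, partialXL]
  simp only [deriv_lagr]
  rw [integral_const_mul]
  simp only [one_mul, Nat.cast_ofNat, Nat.add_one_sub_one, pow_one, mul_zero, zero_mul, add_zero]
  congr 1
  refine integral_congr_ae (Filter.Eventually.of_forall fun x => ?_)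
  beta_reduce
  by_cases hx : x ∈ K
  · rw [hf x hx, one_mul]
  · have h3 : ∀ᶠ y in 𝓝 x, ∀ i, X.act φ i y = (0 : Conf d n M) i y := by
      filter_upwards [hK.isClosed.isOpen_compl.mem_nhds hx] with y hy i
      obtain ⟨e1, e2, e3⟩ := hX y hy
      rw [LieGc.act_apply, e3, e2]
      simp only [e1, mul_zero, Finset.sum_const_zero, add_zero]
      rfl
    rw [lagrB_congr S m (Filter.Eventually.of_forall fun _ _ => rfl) h3, lagrB_zero_right, mul_zero]

theorem IsTangent.deriv_deltaL (hX : IsTangent H X) (hH : IsSmoothSymFamily H) (m : ℝ)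
    (φ : Conf d n M) :
    deriv (fun s => deltaL S m (H s) φ) 0 = partialXL S m X φ := by
  obtain ⟨⟨K, hK, hKH⟩, -⟩ := isSmoothSymFamily_iff.1 hH
  obtain ⟨K', hK', hKX⟩ := X.property
  obtain ⟨f, hf, L, hL, hfL⟩ := exists_cutoff (d := d) (hK.union hK')
  rw [partialXL_eq hK' X hKX (fun x hx => hf x (Or.inr hx)) hL hfL,
    ← hX.deriv_comp_act hH (lagrFunctional_mem_Floc S m hL hfL)]
  have h1 : (fun s => deltaL S m (H s) φ) =
      fun s => lagrFunctional S m f ((H s).act φ) - lagrFunctional S m f φ := by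
    funext s
    exact deltaL_eq S m hK (hKH s) (fun x hx => hf x (Or.inl hx)) hL hfL φ
  rw [h1, deriv_sub_const]

/-- The derivative at `0` is the member at `s = 0` of the family of difference quotients, which is a
local family. -/
theorem IsLocalFamily.deriv_zero_mem_Floc {F : ℝ → Functional d n M} (hF : IsLocalFamily S F) :
    (fun φ => deriv (fun s => F s φ) 0) ∈ Floc n S := by
  have h := hF.dslope.mem_Floc S (0 : ℝ)
  simp only [dslope_same] at h
  exact h

theorem IsTangent.partialX_mem_Floc (hX : IsTangent H X) (hH : IsSmoothSymFamily H)
    {F : Functional d n M} (hF : F ∈ Floc n S) : partialX X F ∈ Floc n S := by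
  have h := ((isLocalFamily_const S hF (P := ℝ)).act S hH).deriv_zero_mem_Floc
  convert h using 1
  funext φ
  exact (hX.deriv_comp_act hH hF φ).symm

theorem IsTangent.partialXL_mem_Floc (hX : IsTangent H X) (hH : IsSmoothSymFamily H) (m : ℝ) :
    partialXL S m X ∈ Floc n S := by
  have h := (IsLocalFamily.deltaL S m hH).deriv_zero_mem_Floc
  convert h using 1
  funext φ
  exact (hX.deriv_deltaL hH m φ).symm

end Tangent

/-! ### Small perturbations of the identity -/

section Perturbation

variable {E : Type*} [NormedAddCommGroup E] [NormedSpace ℝ E] [CompleteSpace E]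

/-- A smooth perturbation of the identity with small Lipschitz constant is a diffeomorphism. -/
theorem exists_smooth_inverse_of_lipschitz {D : E → E} (hD : ContDiff ℝ ∞ D)
    (hL : LipschitzWith (1 / 2) D) :
    ∃ T : E → E, ContDiff ℝ ∞ T ∧ (∀ z, T (z + D z) = z) ∧ ∀ z, T z + D (T z) = z := by
  rcases subsingleton_or_nontrivial E with hE | hE
  · exact ⟨id, contDiff_id, fun z => Subsingleton.elim _ _, fun z => Subsingleton.elim _ _⟩
  -- The map approximates the identity with constant `1/2`, below the inverse norm of the identity,
  -- which is `1` on a nontrivial space. Hence it is a homeomorphism.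
  have h1 : ApproximatesLinearOn (fun z => z + D z)
      ((ContinuousLinearEquiv.refl ℝ E : E ≃L[ℝ] E) : E →L[ℝ] E) Set.univ (1 / 2) := by
    intro x _ y _
    have := hL.dist_le_mul x y
    rw [dist_eq_norm, dist_eq_norm] at this
    change ‖x + D x - (y + D y) - (x - y)‖ ≤ _
    rwa [show x + D x - (y + D y) - (x - y) = D x - D y by abel]
  have hc : (1 / 2 : NNReal) <
      ‖((ContinuousLinearEquiv.refl ℝ E).symm : E →L[ℝ] E)‖₊⁻¹ := by
    simp only [ContinuousLinearEquiv.refl_symm, ContinuousLinearEquiv.coe_refl,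
      ContinuousLinearMap.nnnorm_id, inv_one]
    exact NNReal.half_lt_self one_ne_zero
  let Ψ := h1.toHomeomorph _ (Or.inr hc)
  have hΨ : ∀ z, Ψ z = z + D z := fun z => rfl
  have hn : ∀ z, ‖-(fderiv ℝ D z)‖ < 1 := fun z => by
    rw [norm_neg]
    refine lt_of_le_of_lt (norm_fderiv_le_of_lipschitz ℝ hL) ?_
    norm_num
  -- The derivative `1 + D'` is invertible by the Neumann series, as `‖D'‖ ≤ 1/2`; so the inverse
  -- homeomorphism is smooth.
  let f' : E → E ≃L[ℝ] E := fun z => ContinuousLinearEquiv.ofUnit (Units.oneSub _ (hn z))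
  have hf' : ∀ z, HasFDerivAt Ψ (f' z : E →L[ℝ] E) z := fun z => by
    have h2 : HasFDerivAt (fun z => z + D z) (ContinuousLinearMap.id ℝ E + fderiv ℝ D z) z :=
      (hasFDerivAt_id z).add (hD.differentiable (by simp) z).hasFDerivAt
    have h4 : (f' z : E →L[ℝ] E) = ContinuousLinearMap.id ℝ E + fderiv ℝ D z := by
      ext v
      change (1 - -(fderiv ℝ D z)) v = _
      simp
    rw [h4]
    exact h2
  have h3 : ContDiff ℝ ∞ (Ψ : E → E) := contDiff_id.add hD
  exact ⟨Ψ.symm, Ψ.contDiff_symm hf' h3, fun z => Ψ.symm_apply_apply z,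
    fun z => Ψ.apply_symm_apply z⟩

end Perturbation

/-! ### Diffeomorphisms supported in a chart -/

section Transport

variable {d n : ℕ} {M : Type*} [TopologicalSpace M] [ChartedSpace (EuclideanSpace ℝ (Fin d)) M]
  [IsManifold (𝓡 d) ∞ M] [T2Space M]
  {Q : Type} [NormedAddCommGroup Q] [NormedSpace ℝ Q]

/-- The map that is given by `Φ` in the chart `e` and trivial elsewhere. -/
def chartMap (e : OpenPartialHomeomorph M (EuclideanSpace ℝ (Fin d)))
    (Φ : EuclideanSpace ℝ (Fin d) → EuclideanSpace ℝ (Fin d)) (x : M) : M :=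
  open Classical in if x ∈ e.source then e.symm (Φ (e x)) else x

variable {e : OpenPartialHomeomorph M (EuclideanSpace ℝ (Fin d))}

theorem chartMap_of_mem {Φ : EuclideanSpace ℝ (Fin d) → EuclideanSpace ℝ (Fin d)} {x : M}
    (hx : x ∈ e.source) : chartMap e Φ x = e.symm (Φ (e x)) := if_pos hx

theorem chartMap_of_notMem {Φ : EuclideanSpace ℝ (Fin d) → EuclideanSpace ℝ (Fin d)} {x : M}
    (hx : x ∉ e.source) : chartMap e Φ x = x := if_neg hx

/-- A point sent outside `K` is sent to a fixed point of `Φ`, so by injectivity it was that point.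
-/
theorem mapsTo_target {Φ Ψ : EuclideanSpace ℝ (Fin d) → EuclideanSpace ℝ (Fin d)}
    {K : Set (EuclideanSpace ℝ (Fin d))} (hKe : K ⊆ e.target) (hΦK : ∀ u ∉ K, Φ u = u)
    (hΨΦ : ∀ u, Ψ (Φ u) = u) {u : EuclideanSpace ℝ (Fin d)} (hu : u ∈ e.target) :
    Φ u ∈ e.target := by
  by_cases h : Φ u ∈ K
  · exact hKe h
  · have h1 := hΦK _ h
    have h2 := congrArg Ψ h1
    rw [hΨΦ, hΨΦ] at h2
    rwa [h2]

theorem chartMap_chartMap {Φ Ψ : EuclideanSpace ℝ (Fin d) → EuclideanSpace ℝ (Fin d)}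
    {K : Set (EuclideanSpace ℝ (Fin d))} (hKe : K ⊆ e.target) (hΦK : ∀ u ∉ K, Φ u = u)
    (hΨΦ : ∀ u, Ψ (Φ u) = u) (x : M) : chartMap e Ψ (chartMap e Φ x) = x := by
  by_cases hx : x ∈ e.source
  · have h1 := mapsTo_target hKe hΦK hΨΦ (e.map_source hx)
    rw [chartMap_of_mem hx, chartMap_of_mem (e.map_target h1), e.right_inv h1, hΨΦ, e.left_inv hx]
  · rw [chartMap_of_notMem hx, chartMap_of_notMem hx]

theorem chartMap_of_notMem_image {Φ : EuclideanSpace ℝ (Fin d) → EuclideanSpace ℝ (Fin d)}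
    {K : Set (EuclideanSpace ℝ (Fin d))} (hΦK : ∀ u ∉ K, Φ u = u) {x : M}
    (hx : x ∉ e.symm '' K) : chartMap e Φ x = x := by
  by_cases hxs : x ∈ e.source
  · rw [chartMap_of_mem hxs, hΦK, e.left_inv hxs]
    exact fun h => hx ⟨_, h, e.left_inv hxs⟩
  · exact chartMap_of_notMem hxs

theorem isCompact_chart_image {K : Set (EuclideanSpace ℝ (Fin d))} (hK : IsCompact K)
    (hKe : K ⊆ e.target) : IsCompact (e.symm '' K) :=
  hK.image_of_continuousOn (e.continuousOn_symm.mono hKe)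

/-- Over the chart domain the map is given by `Φ` in coordinates. Around any other point it is the
identity, because the image of `K` is closed and misses that point. -/
theorem contMDiff_chartMap (he : e ∈ IsManifold.maximalAtlas (𝓡 d) ∞ M)
    {Φ Ψ : Q → EuclideanSpace ℝ (Fin d) → EuclideanSpace ℝ (Fin d)}
    (hΦ : ContDiff ℝ ∞ (fun z : Q × EuclideanSpace ℝ (Fin d) => Φ z.1 z.2))
    {K : Set (EuclideanSpace ℝ (Fin d))} (hK : IsCompact K)
    (hKe : K ⊆ e.target) (hΦK : ∀ q, ∀ u ∉ K, Φ q u = u) (hΨΦ : ∀ q u, Ψ q (Φ q u) = u) :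
    ContMDiff (𝓘(ℝ, Q).prod (𝓡 d)) (𝓡 d) ∞ (fun z : Q × M => chartMap e (Φ z.1) z.2) := by
  rintro ⟨q, x⟩
  by_cases hx : x ∈ e.source
  · have h1 : (fun z : Q × M => chartMap e (Φ z.1) z.2) =ᶠ[𝓝 (q, x)]
        fun z => e.symm (Φ z.1 (e z.2)) := by
      filter_upwards [continuousAt_snd.preimage_mem_nhds (e.open_source.mem_nhds hx)] with z hz
      exact chartMap_of_mem hz
    refine ContMDiffAt.congr_of_eventuallyEq ?_ h1
    have h2 : ContMDiffAt (𝓘(ℝ, Q).prod (𝓡 d)) 𝓘(ℝ, EuclideanSpace ℝ (Fin d)) ∞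
        (fun z : Q × M => e z.2) (q, x) :=
      ContMDiffAt.comp (q, x) (g := e) (f := Prod.snd)
        (contMDiffAt_of_mem_maximalAtlas he hx) contMDiffAt_snd
    have h3 : ContMDiff (𝓘(ℝ, Q).prod 𝓘(ℝ, EuclideanSpace ℝ (Fin d)))
        𝓘(ℝ, EuclideanSpace ℝ (Fin d)) ∞
        (fun z : Q × EuclideanSpace ℝ (Fin d) => Φ z.1 z.2) := contMDiff_prod_iff_contDiff.2 hΦ
    have h4 : ContMDiffAt (𝓘(ℝ, Q).prod (𝓡 d)) 𝓘(ℝ, EuclideanSpace ℝ (Fin d)) ∞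
        (fun z : Q × M => Φ z.1 (e z.2)) (q, x) :=
      h3.contMDiffAt.comp (q, x) (contMDiffAt_fst.prodMk h2)
    have h5 : ContMDiffAt 𝓘(ℝ, EuclideanSpace ℝ (Fin d)) (𝓡 d) ∞ e.symm (Φ q (e x)) :=
      contMDiffAt_symm_of_mem_maximalAtlas he
        (mapsTo_target hKe (hΦK q) (hΨΦ q) (e.map_source hx))
    exact ContMDiffAt.comp (q, x) h5 h4
  · have h1 : (fun z : Q × M => chartMap e (Φ z.1) z.2) =ᶠ[𝓝 (q, x)] fun z => z.2 := by
      have h2 : (e.symm '' K)ᶜ ∈ 𝓝 x := by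
        refine (isCompact_chart_image hK hKe).isClosed.isOpen_compl.mem_nhds ?_
        rintro ⟨u, hu, rfl⟩
        exact hx (e.map_target (hKe hu))
      filter_upwards [continuousAt_snd.preimage_mem_nhds h2] with z hz
      exact chartMap_of_notMem_image (hΦK _) hz
    exact contMDiffAt_snd.congr_of_eventuallyEq h1

theorem contMDiff_slice_snd {f : Q → M → M}
    (h : ContMDiff (𝓘(ℝ, Q).prod (𝓡 d)) (𝓡 d) ∞ (fun q : Q × M => f q.1 q.2)) (q : Q) :
    ContMDiff (𝓡 d) (𝓡 d) ∞ (f q) := by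
  have h4 : ContMDiff (𝓡 d) (𝓘(ℝ, Q).prod (𝓡 d)) ∞ (fun y : M => (q, y)) :=
    contMDiff_const.prodMk contMDiff_id
  exact h.comp h4

/-- The symmetry given by a diffeomorphism with compact support. -/
def Gc.ofDiffeomorph (ρ : Diffeomorph (𝓡 d) (𝓡 d) M M ∞)
    (h : ∃ K : Set M, IsCompact K ∧ ∀ x ∉ K, ρ x = x) : Gc d n M where
  ρ := ρ
  A := 1
  ψ := 0
  compact := by
    obtain ⟨K, hK, h⟩ := h
    exact ⟨K, hK, fun x hx => ⟨h x hx, (Gc.evalGL_eq_one_iff x _).1 (map_one _), fun _ => rfl⟩⟩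

/-- Smooth families of diffeomorphisms of a chart domain give smooth families of symmetries. -/
theorem exists_symFamily_of_chart (he : e ∈ IsManifold.maximalAtlas (𝓡 d) ∞ M)
    {Φ Ψ : Q → EuclideanSpace ℝ (Fin d) → EuclideanSpace ℝ (Fin d)}
    (hΦ : ContDiff ℝ ∞ (fun z : Q × EuclideanSpace ℝ (Fin d) => Φ z.1 z.2))
    (hΨ : ContDiff ℝ ∞ (fun z : Q × EuclideanSpace ℝ (Fin d) => Ψ z.1 z.2))
    {K : Set (EuclideanSpace ℝ (Fin d))} (hK : IsCompact K)
    (hKe : K ⊆ e.target) (hΦK : ∀ q, ∀ u ∉ K, Φ q u = u) (hΨΦ : ∀ q u, Ψ q (Φ q u) = u)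
    (hΦΨ : ∀ q u, Φ q (Ψ q u) = u) :
    ∃ g : Q → Gc d n M, IsSmoothSymFamily g ∧ ∀ q, (g q).A = 1 ∧ (g q).ψ = 0 ∧
      ∀ x, (g q).ρ x = chartMap e (Φ q) x := by
  have hΨK : ∀ q, ∀ u ∉ K, Ψ q u = u := fun q u hu => by
    conv_lhs => rw [← hΦK q u hu]
    exact hΨΦ q u
  have h1 := contMDiff_chartMap he hΦ hK hKe hΦK hΨΦ
  have h2 := contMDiff_chartMap he hΨ hK hKe hΨK hΦΨ
  let ρ : Q → Diffeomorph (𝓡 d) (𝓡 d) M M ∞ := fun q =>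
    { toFun := chartMap e (Φ q)
      invFun := chartMap e (Ψ q)
      left_inv := chartMap_chartMap hKe (hΦK q) (hΨΦ q)
      right_inv := chartMap_chartMap hKe (hΨK q) (hΦΨ q)
      contMDiff_toFun := contMDiff_slice_snd (f := fun q => chartMap e (Φ q)) h1 q
      contMDiff_invFun := contMDiff_slice_snd (f := fun q => chartMap e (Ψ q)) h2 q }
  have hρ : ∀ q, ∀ x ∉ e.symm '' K, ρ q x = x := fun q x hx =>
    chartMap_of_notMem_image (hΦK q) hx
  let g : Q → Gc d n M := fun q =>
    Gc.ofDiffeomorph (ρ q) ⟨_, isCompact_chart_image hK hKe, hρ q⟩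
  have hinv : ∀ q, (g q)⁻¹ = Gc.ofDiffeomorph (ρ q).symm ⟨_, isCompact_chart_image hK hKe,
      fun x hx => chartMap_of_notMem_image (hΨK q) hx⟩ := fun q => by
    rw [inv_eq_iff_mul_eq_one]
    refine Gc.ext ?_ ?_ ?_
    · exact Diffeomorph.ext fun x => (ρ q).apply_symm_apply x
    · rw [Gc.mul_A]
      change Gc.pullGL _ 1 * 1 = 1
      rw [map_one, one_mul]
    · funext i
      refine ContMDiffMap.ext fun x => ?_
      rw [Gc.mul_ψ_apply]
      change ∑ i, (0 : ℝ) * _ + 0 = 0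
      simp
  refine ⟨g, isSmoothSymFamily_iff.2 ⟨⟨_, isCompact_chart_image hK hKe, fun q x hx =>
    ⟨hρ q x hx, Gc.one_A_apply x, fun _ => rfl⟩⟩, ?_, ?_⟩, fun q => ⟨rfl, rfl, fun _ => rfl⟩⟩
  · exact ⟨h1, fun i j => (((1 : GL (Fin n) (Smooth d M)).val i j)).contMDiff.comp contMDiff_snd,
      fun i => contMDiff_const⟩
  · simp only [hinv]
    exact ⟨h2, fun i j => (((1 : GL (Fin n) (Smooth d M)).val i j)).contMDiff.comp contMDiff_snd,
      fun i => contMDiff_const⟩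

end Transport

/-! ### Hadamard's lemma in several variables -/

section Hadamard

variable {d : ℕ}

/-- Hadamard's lemma. -/
theorem exists_hadamard {F : EuclideanSpace ℝ (Fin d) → ℝ} (hF : ContDiff ℝ ∞ F)
    (u₀ : EuclideanSpace ℝ (Fin d)) :
    ∃ G : Fin d → EuclideanSpace ℝ (Fin d) → ℝ, (∀ j, ContDiff ℝ ∞ (G j)) ∧
      (∀ j, G j u₀ = fderiv ℝ F u₀ (EuclideanSpace.single j 1)) ∧
      ∀ u, F u = F u₀ + ∑ j, (u j - u₀ j) * G j u := by
  let w : Fin d → EuclideanSpace ℝ (Fin d) → ℝ → ℝ := fun j u t =>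
    fderiv ℝ F (u₀ + t • (u - u₀)) (EuclideanSpace.single j 1)
  have hw : ∀ j, ContDiff ℝ ∞ (fun q : EuclideanSpace ℝ (Fin d) × ℝ => w j q.1 q.2) := by
    intro j
    have h1 : ContDiff ℝ ∞ (fun q : EuclideanSpace ℝ (Fin d) × ℝ => u₀ + q.2 • (q.1 - u₀)) := by
      fun_prop
    have h2 : ContDiff ℝ ∞ (fderiv ℝ F) := hF.fderiv_right (by simp)
    exact (h2.comp h1).clm_apply contDiff_const
  refine ⟨fun j u => ∫ t in Set.Icc (0 : ℝ) 1, w j u t, fun j => ?_, fun j => ?_, fun u => ?_⟩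
  · exact contDiff_setIntegral (J := 𝓘(ℝ, ℝ)) (f := w j)
      (contMDiff_prod_iff_contDiff.2 (hw j)) isCompact_Icc measurableSet_Icc (by simp)
  · simp [w]
  · have hd : ∀ t : ℝ, HasDerivAt (fun t : ℝ => F (u₀ + t • (u - u₀)))
        (∑ j, (u j - u₀ j) * w j u t) t := fun t => by
      have h1 : HasDerivAt (fun t : ℝ => u₀ + t • (u - u₀)) ((1 : ℝ) • (u - u₀)) t :=
        ((hasDerivAt_id t).smul_const _).const_add _
      have h2 := ((hF.differentiable (by simp) (u₀ + t • (u - u₀))).hasFDerivAt).comp_hasDerivAt t h1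
      have h3 : fderiv ℝ F (u₀ + t • (u - u₀)) ((1 : ℝ) • (u - u₀)) =
          ∑ j, (u j - u₀ j) * w j u t := by
        rw [one_smul]
        have hL : ∀ L : EuclideanSpace ℝ (Fin d) →L[ℝ] ℝ, L (u - u₀) =
            ∑ j, (u j - u₀ j) * L (EuclideanSpace.single j 1) := fun L => by
          conv_lhs => rw [euclidean_eq_sum_single (u - u₀), map_sum]
          refine Finset.sum_congr rfl fun j _ => ?_
          rw [map_smul, smul_eq_mul]
          rfl
        exact hL _
      rw [← h3]
      exact h2
    have hc : ∀ j, Continuous (w j u) := fun j =>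
      (hw j).continuous.comp (Continuous.prodMk_right u)
    have h3 := intervalIntegral.integral_eq_sub_of_hasDerivAt (a := 0) (b := 1) (fun t _ => hd t)
      ((continuous_finsetSum _ fun j _ => continuous_const.mul (hc j)).intervalIntegrable _ _)
    rw [intervalIntegral.integral_finsetSum (f := fun j t => (u j - u₀ j) * w j u t)
      fun j _ => (continuous_const.mul (hc j)).intervalIntegrable _ _] at h3
    simp only [intervalIntegral.integral_const_mul, one_smul, zero_smul, add_zero,
      add_sub_cancel] at h3
    have h4 : ∀ j, ∫ t in Set.Icc (0 : ℝ) 1, w j u t = ∫ t in (0 : ℝ)..1, w j u t := fun j => by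
      rw [intervalIntegral.integral_of_le zero_le_one, integral_Icc_eq_integral_Ioc]
    simp only [h4]
    linarith

end Hadamard

/-! ### Derivations are vector fields -/

section Derivations

variable {d : ℕ} {M : Type*} [TopologicalSpace M] [ChartedSpace (EuclideanSpace ℝ (Fin d)) M]
  [IsManifold (𝓡 d) ∞ M] [T2Space M]

theorem derivation_mul_apply (v : Derivation ℝ (Smooth d M) (Smooth d M)) (f h : Smooth d M)
    (x : M) : v (f * h) x = f x * v h x + h x * v f x := by
  rw [Derivation.leibniz]
  rfl

/-- Derivations are local: with a bump function `b` supported where `f = h`, the Leibniz rule for `b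
(f - h) = 0` at `x` gives the claim. -/
theorem derivation_apply_eq_of_eventuallyEq (v : Derivation ℝ (Smooth d M) (Smooth d M))
    {f h : Smooth d M} {x : M} (hfh : ∀ᶠ y in 𝓝 x, f y = h y) : v f x = v h x := by
  obtain ⟨β, -, hβ⟩ := (SmoothBumpFunction.nhds_basis_tsupport (I := 𝓡 d) x).mem_iff.1 hfh
  let b : Smooth d M := ⟨β, β.contMDiff⟩
  have h0 : b * (f - h) = 0 := by
    ext y
    change β y * (f y - h y) = 0
    by_cases hy : y ∈ tsupport β
    · have : f y = h y := hβ hy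
      rw [this, sub_self, mul_zero]
    · rw [image_eq_zero_of_notMem_tsupport hy, zero_mul]
  have h1 := derivation_mul_apply v b (f - h) x
  have h2 : (f - h) x = 0 := sub_eq_zero.2 hfh.self_of_nhds
  have h3 : b x = 1 := β.eq_one
  rw [h0, map_zero, h2, h3, map_sub, zero_mul, add_zero, one_mul] at h1
  exact (sub_eq_zero.1 h1.symm)

theorem derivation_algebraMap_apply (v : Derivation ℝ (Smooth d M) (Smooth d M)) (c : ℝ) (x : M) :
    v (algebraMap ℝ (Smooth d M) c) x = 0 := by
  rw [Derivation.map_algebraMap]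
  rfl

theorem derivation_sum_apply {ι : Type*} (v : Derivation ℝ (Smooth d M) (Smooth d M))
    (t : Finset ι) (f : ι → Smooth d M) (x : M) :
    v (∑ i ∈ t, f i) x = ∑ i ∈ t, v (f i) x := by
  rw [map_sum, Gc.sum_apply]

/-- A derivation of the algebra of smooth functions is a vector field. -/
theorem derivation_apply_eq_sum (v : Derivation ℝ (Smooth d M) (Smooth d M))
    {e : OpenPartialHomeomorph M (EuclideanSpace ℝ (Fin d))}
    (he : e ∈ IsManifold.maximalAtlas (𝓡 d) ∞ M) {x : M} (hx : x ∈ e.source)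
    {c : Fin d → Smooth d M} (hc : ∀ᶠ y in 𝓝 x, ∀ i, c i y = e y i) (f : Smooth d M) :
    v f x = ∑ j, coordDeriv e j f x * v (c j) x := by
  obtain ⟨F, hF⟩ := exists_smooth_eventuallyEq (d := d) (M := EuclideanSpace ℝ (Fin d))
    (g := fun u => f (e.symm u)) (e.open_target.mem_nhds (e.map_source hx)) (fun u hu => by
      have h3 : ContMDiffAt 𝓘(ℝ, EuclideanSpace ℝ (Fin d)) (𝓡 d) ∞ e.symm u :=
        contMDiffAt_symm_of_mem_maximalAtlas he hu
      exact f.contMDiff.contMDiffAt.comp u h3)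
  obtain ⟨G, hG, hG0, hFG⟩ := exists_hadamard (contMDiff_iff_contDiff.1 F.contMDiff) (e x)
  have hG' : ∀ j, ∃ g : Smooth d M, ∀ᶠ y in 𝓝 x, g y = G j (e y) := fun j =>
    exists_smooth_eventuallyEq (e.open_source.mem_nhds hx) fun y hy =>
      (contMDiff_iff_contDiff.2 (hG j)).contMDiffAt.comp y (contMDiffAt_of_mem_maximalAtlas he hy)
  choose g hg using hG'
  -- Hadamard's expansion in coordinates, realized by global functions with the right germs. Each `c
  -- j - e x j` vanishes at `x`, so the Leibniz rule only sees `g j x`, the partial derivative.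
  let h : Smooth d M := algebraMap ℝ (Smooth d M) (F (e x)) +
    ∑ j, (c j - algebraMap ℝ (Smooth d M) (e x j)) * g j
  have hfh : ∀ᶠ y in 𝓝 x, f y = h y := by
    have h1 : ∀ᶠ y in 𝓝 x, F (e y) = f (e.symm (e y)) := (e.continuousAt hx).eventually hF
    filter_upwards [h1, hc, Filter.eventually_all.2 hg, e.open_source.mem_nhds hx]
      with y h1 h2 h3 h4
    have h5 : h y = F (e x) + ∑ j, (c j y - e x j) * g j y := by
      change _ + (∑ j, (c j - algebraMap ℝ (Smooth d M) (e x j)) * g j : Smooth d M) y = _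
      rw [Gc.sum_apply]
      rfl
    rw [h5, ← e.left_inv h4, ← h1, hFG (e y), e.left_inv h4]
    simp only [h2, h3]
  rw [derivation_apply_eq_of_eventuallyEq v hfh]
  change v (_ + _) x = _
  rw [map_add]
  change v _ x + v _ x = _
  rw [derivation_algebraMap_apply, zero_add, derivation_sum_apply]
  refine Finset.sum_congr rfl fun j _ => ?_
  rw [derivation_mul_apply, map_sub]
  have h6 : (c j - algebraMap ℝ (Smooth d M) (e x j)) x = 0 := by
    change c j x - e x j = 0
    rw [hc.self_of_nhds j, sub_self]
  change _ + g j x * (v (c j) x - v (algebraMap ℝ (Smooth d M) (e x j)) x) = _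
  rw [h6, zero_mul, zero_add, derivation_algebraMap_apply, sub_zero, (hg j).self_of_nhds, hG0]
  congr 1
  rw [coordDeriv]
  congr 1
  exact Filter.EventuallyEq.fderiv_eq hF

end Derivations

/-! ### Tangent vectors of products and reparametrized curves -/

section TangentCalculus

variable {d n : ℕ} {M : Type*} [TopologicalSpace M] [ChartedSpace (EuclideanSpace ℝ (Fin d)) M]
  {P : Type} [NormedAddCommGroup P] [NormedSpace ℝ P]

theorem IsSmoothSymFamily.contDiff_A {g : P → Gc d n M} (hg : IsSmoothSymFamily g) (i j : Fin n)
    (x : M) : ContDiff ℝ ∞ (fun s => (g s).A.val i j x) :=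
  contMDiff_slice (f := fun s x => (g s).A.val i j x) (hg.components.2.1 i j) x

theorem IsSmoothSymFamily.contDiff_ψ {g : P → Gc d n M} (hg : IsSmoothSymFamily g) (i : Fin n)
    (x : M) : ContDiff ℝ ∞ (fun s => (g s).ψ i x) :=
  contMDiff_slice (f := fun s x => (g s).ψ i x) (hg.components.2.2 i) x

theorem IsSmoothSymFamily.contDiff_ρ {g : P → Gc d n M} (hg : IsSmoothSymFamily g)
    (f : Smooth d M) (x : M) : ContDiff ℝ ∞ (fun s => f ((g s).ρ x)) :=
  contMDiff_slice (f := fun s x => f ((g s).ρ x)) (f.contMDiff.comp hg.components.1) x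

/-- At the unit the differential of the product is the sum. Stating this for numerical functions on
the group treats all components of a tangent vector alike. -/
theorem hasDerivAt_mul_of_contDiff (E : Gc d n M → ℝ) {g h : ℝ → Gc d n M} (hg : g 0 = 1)
    (hh : h 0 = 1) (hE : ContDiff ℝ ∞ (fun q : ℝ × ℝ => E (g q.1 * h q.2))) {a b : ℝ}
    (ha : HasDerivAt (fun s => E (g s)) a 0) (hb : HasDerivAt (fun s => E (h s)) b 0) :
    HasDerivAt (fun s => E (g s * h s)) (a + b) 0 := by
  have h1 := deriv_diag (f := fun s t => E (g s * h t)) hE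
  simp only [hg, hh, mul_one, one_mul] at h1
  rw [← ha.deriv, ← hb.deriv, ← h1]
  have h2 : ContDiff ℝ ∞ (fun s : ℝ => E (g s * h s)) := hE.comp (contDiff_id.prodMk contDiff_id)
  exact hasDerivAt_of_contDiff h2 0

theorem IsTangent.mul {g h : ℝ → Gc d n M} {X Y : LieGc d n M} (hX : IsTangent g X)
    (hY : IsTangent h Y) (hg : IsSmoothSymFamily g) (hh : IsSmoothSymFamily h) :
    IsTangent (fun s => g s * h s) (X + Y) := by
  have hgh : IsSmoothSymFamily (fun q : ℝ × ℝ => g q.1 * h q.2) :=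
    (hg.comp contDiff_fst).mul (hh.comp contDiff_snd)
  refine ⟨by simp only [hX.1, hY.1, mul_one], fun x => ⟨fun i j => ?_, fun i => ?_, fun f => ?_⟩⟩
  · exact hasDerivAt_mul_of_contDiff (fun g => g.A.val i j x) hX.1 hY.1 (hgh.contDiff_A i j x)
      ((hX.2 x).1 i j) ((hY.2 x).1 i j)
  · exact hasDerivAt_mul_of_contDiff (fun g => g.ψ i x) hX.1 hY.1 (hgh.contDiff_ψ i x)
      ((hX.2 x).2.1 i) ((hY.2 x).2.1 i)
  · exact hasDerivAt_mul_of_contDiff (fun g => f (g.ρ x)) hX.1 hY.1 (hgh.contDiff_ρ f x)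
      ((hX.2 x).2.2 f) ((hY.2 x).2.2 f)

theorem IsTangent.comp_mul {g : ℝ → Gc d n M} {X : LieGc d n M} (hX : IsTangent g X) (c : ℝ) :
    IsTangent (fun s => g (c * s)) (c • X) := by
  have h1 : HasDerivAt (fun s : ℝ => c * s) c 0 := by
    simpa using (hasDerivAt_id (0 : ℝ)).const_mul c
  have key : ∀ {f : ℝ → ℝ} {a : ℝ}, HasDerivAt f a 0 →
      HasDerivAt (fun s => f (c * s)) (c * a) 0 := fun {f a} hf => by
    have h2 : HasDerivAt f a (c * 0) := by rwa [mul_zero]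
    have := HasDerivAt.comp (0 : ℝ) h2 h1
    rwa [mul_comm] at this
  refine ⟨by simp only [mul_zero, hX.1], fun x => ⟨fun i j => ?_, fun i => ?_, fun f => ?_⟩⟩
  · exact key ((hX.2 x).1 i j)
  · exact key ((hX.2 x).2.1 i)
  · exact key ((hX.2 x).2.2 f)

theorem isTangent_one : IsTangent (fun _ => (1 : Gc d n M)) 0 :=
  ⟨rfl, fun _ => ⟨fun _ _ => hasDerivAt_const _ _, fun _ => hasDerivAt_const _ _,
    fun _ => hasDerivAt_const _ _⟩⟩

/-- A smooth family of infinitesimal symmetries. -/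
structure IsSmoothLieFamily (V : P → LieGc d n M) : Prop where
  support : ∃ K : Set M, IsCompact K ∧ ∀ s, ∀ x ∉ K,
    (∀ i j, (V s).a i j x = 0) ∧ (∀ i, (V s).p i x = 0) ∧ ∀ f, (V s).v f x = 0
  a : ∀ i j, ContMDiff (𝓘(ℝ, P).prod (𝓡 d)) 𝓘(ℝ) ∞ (fun q : P × M => (V q.1).a i j q.2)
  p : ∀ i, ContMDiff (𝓘(ℝ, P).prod (𝓡 d)) 𝓘(ℝ) ∞ (fun q : P × M => (V q.1).p i q.2)
  v : ∀ f, ContMDiff (𝓘(ℝ, P).prod (𝓡 d)) 𝓘(ℝ) ∞ (fun q : P × M => (V q.1).v f q.2)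

theorem isSmoothLieFamily_const (X : LieGc d n M) : IsSmoothLieFamily (fun _ : P => X) := by
  obtain ⟨K, hK, h⟩ := X.property
  exact ⟨⟨K, hK, fun _ => h⟩, fun i j => (X.a i j).contMDiff.comp contMDiff_snd,
    fun i => (X.p i).contMDiff.comp contMDiff_snd, fun f => (X.v f).contMDiff.comp contMDiff_snd⟩

/-- The vector field of `X`, multiplied with a function. -/
def LieGc.smulVector (χ : Smooth d M) (X : LieGc d n M) : LieGc d n M :=
  ⟨(0, 0, χ • X.v), by
    obtain ⟨K, hK, h⟩ := X.property
    refine ⟨K, hK, fun x hx => ⟨fun _ _ => rfl, fun _ => rfl, fun f => ?_⟩⟩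
    change χ x * X.v f x = 0
    rw [show X.v f x = 0 from (h x hx).2.2 f, mul_zero]⟩

/-- The translation part of `X`. -/
def LieGc.translationPart (X : LieGc d n M) : LieGc d n M :=
  ⟨(0, X.p, 0), by
    obtain ⟨K, hK, h⟩ := X.property
    exact ⟨K, hK, fun x hx => ⟨fun _ _ => rfl, (h x hx).2.1, fun f => rfl⟩⟩⟩

/-- The linear part of `X`. -/
def LieGc.linearPart (X : LieGc d n M) : LieGc d n M :=
  ⟨(X.a, 0, 0), by
    obtain ⟨K, hK, h⟩ := X.property
    exact ⟨K, hK, fun x hx => ⟨(h x hx).1, fun _ => rfl, fun f => rfl⟩⟩⟩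

end TangentCalculus

/-! ### Curves of diffeomorphisms in a chart -/

section ChartCurves

variable {d n : ℕ} {M : Type*} [TopologicalSpace M] [ChartedSpace (EuclideanSpace ℝ (Fin d)) M]
  [IsManifold (𝓡 d) ∞ M] [T2Space M]
  {e : OpenPartialHomeomorph M (EuclideanSpace ℝ (Fin d))}

/-- A smooth family of functions with support in a chart domain, in coordinates. -/
theorem contDiff_chart_extend {P : Type} [NormedAddCommGroup P] [NormedSpace ℝ P]
    (he : e ∈ IsManifold.maximalAtlas (𝓡 d) ∞ M) {w : P → Smooth d M}
    (hw : ContMDiff (𝓘(ℝ, P).prod (𝓡 d)) 𝓘(ℝ) ∞ (fun q : P × M => w q.1 q.2))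
    {K : Set M} (hK : IsCompact K) (hKe : K ⊆ e.source) (hwK : ∀ p, ∀ x ∉ K, w p x = 0) :
    ContDiff ℝ ∞ (fun q : P × EuclideanSpace ℝ (Fin d) =>
      open Classical in if q.2 ∈ e.target then w q.1 (e.symm q.2) else 0) := by
  rw [← contMDiff_prod_iff_contDiff]
  rintro ⟨p, u⟩
  by_cases hu : u ∈ e.target
  · have h1 : (fun q : P × EuclideanSpace ℝ (Fin d) =>
        open Classical in if q.2 ∈ e.target then w q.1 (e.symm q.2) else 0) =ᶠ[𝓝 (p, u)]
        fun q => w q.1 (e.symm q.2) := by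
      filter_upwards [continuousAt_snd.preimage_mem_nhds (e.open_target.mem_nhds hu)] with z hz
      exact if_pos hz
    refine ContMDiffAt.congr_of_eventuallyEq ?_ h1
    have h2 : ContMDiffAt (𝓘(ℝ, P).prod 𝓘(ℝ, EuclideanSpace ℝ (Fin d))) (𝓡 d) ∞
        (fun z : P × EuclideanSpace ℝ (Fin d) => e.symm z.2) (p, u) :=
      ContMDiffAt.comp (p, u) (g := e.symm) (f := Prod.snd)
        (contMDiffAt_symm_of_mem_maximalAtlas he hu) contMDiffAt_snd
    exact hw.contMDiffAt.comp (p, u) (contMDiffAt_fst.prodMk h2)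
  · have hKc : IsClosed (e '' K) :=
      (hK.image_of_continuousOn (e.continuousOn.mono hKe)).isClosed
    have h1 : (fun q : P × EuclideanSpace ℝ (Fin d) =>
        open Classical in if q.2 ∈ e.target then w q.1 (e.symm q.2) else 0) =ᶠ[𝓝 (p, u)]
        fun q => 0 := by
      have h2 : (e '' K)ᶜ ∈ 𝓝 u := by
        refine hKc.isOpen_compl.mem_nhds ?_
        rintro ⟨x, hx, rfl⟩
        exact hu (e.map_source (hKe hx))
      filter_upwards [continuousAt_snd.preimage_mem_nhds h2] with z hz
      split_ifs with h3
      · exact hwK _ _ fun h4 => hz ⟨_, h4, e.right_inv h3⟩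
      · rfl
    exact contMDiffAt_const.congr_of_eventuallyEq h1

/-- The vector field `w`, in coordinates, is generated by a family of diffeomorphisms. -/
theorem exists_flow_of_chart (he : e ∈ IsManifold.maximalAtlas (𝓡 d) ∞ M)
    {C : ℝ → EuclideanSpace ℝ (Fin d) → EuclideanSpace ℝ (Fin d)}
    (hC : ContDiff ℝ ∞ (fun q : ℝ × EuclideanSpace ℝ (Fin d) => C q.1 q.2))
    {K : Set (EuclideanSpace ℝ (Fin d))} (hK : IsCompact K) (hKe : K ⊆ e.target)
    (hCK : ∀ p, ∀ u ∉ K, C p u = 0) :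
    ∃ g : ℝ × ℝ → Gc d n M, IsSmoothSymFamily g ∧ (∀ q, (g q).A = 1 ∧ (g q).ψ = 0) ∧
      ∀ᶠ p in 𝓝 (0 : ℝ), g (0, p) = 1 ∧ ∀ x, ∀ᶠ s in 𝓝 (0 : ℝ),
        (g (s, p)).ρ x = chartMap e (fun u => u + s • C p u) x := by
  let β : ContDiffBump (0 : ℝ) := ⟨1, 2, one_pos, one_lt_two⟩
  -- The displacement `s C(p, u)`, cut off in `s` and `p`. Compact support makes it globally
  -- Lipschitz. No differential equation is solved: only the tangent vector at `s = 0` matters, and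
  -- `u + s C(p, u)` has the right one.
  let D₀ : (ℝ × ℝ) × EuclideanSpace ℝ (Fin d) → EuclideanSpace ℝ (Fin d) := fun z =>
    (z.1.1 * β z.1.1 * β z.1.2) • C z.1.2 z.2
  have hD₀ : ContDiff ℝ ∞ D₀ := by
    have h1 : ContDiff ℝ ∞ (fun z : (ℝ × ℝ) × EuclideanSpace ℝ (Fin d) => C z.1.2 z.2) :=
      hC.comp ((contDiff_snd.comp contDiff_fst).prodMk contDiff_snd)
    have h2 : ContDiff ℝ ∞ (fun z : (ℝ × ℝ) × EuclideanSpace ℝ (Fin d) => z.1.1) :=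
      contDiff_fst.comp contDiff_fst
    have h3 : ContDiff ℝ ∞ (fun z : (ℝ × ℝ) × EuclideanSpace ℝ (Fin d) => z.1.2) :=
      contDiff_snd.comp contDiff_fst
    exact ((h2.mul (β.contDiff.comp h2)).mul (β.contDiff.comp h3)).smul h1
  have hβ : ∀ s : ℝ, s ∉ Metric.closedBall (0 : ℝ) 2 → β s = 0 := fun s hs =>
    β.zero_of_le_dist (by
      rw [Metric.mem_closedBall, not_le] at hs
      exact hs.le)
  have hcs : HasCompactSupport D₀ := by
    refine HasCompactSupport.intro (((isCompact_closedBall (0 : ℝ) 2).prod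
      (isCompact_closedBall (0 : ℝ) 2)).prod hK) fun z hz => ?_
    by_cases h1 : z.1.1 ∈ Metric.closedBall (0 : ℝ) 2
    · by_cases h2 : z.1.2 ∈ Metric.closedBall (0 : ℝ) 2
      · have h3 : z.2 ∉ K := fun h3 => hz ⟨⟨h1, h2⟩, h3⟩
        simp only [D₀, hCK _ _ h3, smul_zero]
      · simp only [D₀, hβ _ h2, mul_zero, zero_smul]
    · simp only [D₀, hβ _ h1, mul_zero, zero_mul, zero_smul]
  obtain ⟨L, hL⟩ := ContDiff.lipschitzWith_of_hasCompactSupport hcs hD₀ (by simp)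
  -- Chosen so that the scaled displacement has Lipschitz constant at most `1/2`.
  let ε : ℝ := 1 / (2 * (L + 1))
  have hε : 0 < ε := by positivity
  -- The parameters are carried along unchanged, so that a single inverse on the product yields
  -- inverses depending smoothly on `(s, p)`.
  let D : (ℝ × ℝ) × EuclideanSpace ℝ (Fin d) → (ℝ × ℝ) × EuclideanSpace ℝ (Fin d) :=
    fun z => (0, ε • D₀ z)
  have hD : ContDiff ℝ ∞ D := contDiff_const.prodMk (hD₀.const_smul ε)
  have hDL : LipschitzWith (1 / 2) D := by
    refine LipschitzWith.of_dist_le_mul fun z z' => ?_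
    have h1 := hL.dist_le_mul z z'
    have h2 : dist (D z) (D z') = ε * dist (D₀ z) (D₀ z') := by
      simp only [D, Prod.dist_eq, dist_self]
      rw [max_eq_right dist_nonneg, dist_smul₀, Real.norm_of_nonneg hε.le]
    rw [h2]
    have h3 : ε * L ≤ 1 / 2 := by
      simp only [ε]
      rw [div_mul_eq_mul_div, one_mul, div_le_div_iff₀ (by positivity) two_pos]
      nlinarith [L.coe_nonneg]
    calc ε * dist (D₀ z) (D₀ z') ≤ ε * (L * dist z z') := by gcongr
      _ = ε * L * dist z z' := by ring
      _ ≤ 1 / 2 * dist z z' := by gcongr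
      _ = _ := by norm_num
  obtain ⟨T, hT, hT1, hT2⟩ := exists_smooth_inverse_of_lipschitz hD hDL
  have hT0 : ∀ z, (T z).1 = z.1 := fun z => by
    have := congrArg Prod.fst (hT2 z)
    simpa [D] using this
  let Φ : ℝ × ℝ → EuclideanSpace ℝ (Fin d) → EuclideanSpace ℝ (Fin d) := fun q u =>
    u + ε • D₀ (q, u)
  let Ψ : ℝ × ℝ → EuclideanSpace ℝ (Fin d) → EuclideanSpace ℝ (Fin d) := fun q u => (T (q, u)).2
  have hΨΦ : ∀ q u, Ψ q (Φ q u) = u := fun q u => by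
    have h1 : (q, Φ q u) = (q, u) + D (q, u) := by simp [D, Φ]
    simp only [Ψ, h1, hT1]
  have hΦΨ : ∀ q u, Φ q (Ψ q u) = u := fun q u => by
    have h1 : (q, Ψ q u) = T (q, u) := Prod.ext (hT0 (q, u)).symm rfl
    have h2 := congrArg Prod.snd (hT2 (q, u))
    simp only [Φ, h1]
    exact h2
  obtain ⟨g, hg, hgA⟩ := exists_symFamily_of_chart (n := n) he (Φ := Φ) (Ψ := Ψ)
    (contDiff_snd.add (hD₀.const_smul ε)) (contDiff_snd.comp hT) hK hKe
    (fun q u hu => by simp [Φ, D₀, hCK _ u hu]) hΨΦ hΦΨ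
  -- Rescaling `s` by `ε⁻¹` undoes the factor `ε`; near `s = 0` and `p = 0` the cutoffs equal `1`,
  -- and the map is `u + s C(p, u)`.
  have hr : ContDiff ℝ ∞ (fun q : ℝ × ℝ => (ε⁻¹ * q.1, q.2)) :=
    (contDiff_const.mul contDiff_fst).prodMk contDiff_snd
  refine ⟨fun q => g (ε⁻¹ * q.1, q.2), hg.comp hr, fun q => ⟨(hgA _).1, (hgA _).2.1⟩, ?_⟩
  filter_upwards [β.eventuallyEq_one] with p hp
  refine ⟨?_, fun x => ?_⟩
  · refine Gc.ext (Diffeomorph.ext fun x => ?_) (hgA _).1 (hgA _).2.1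
    rw [(hgA _).2.2]
    have h1 : Φ (ε⁻¹ * 0, p) = id := by
      funext u
      simp [Φ, D₀]
    simp only [h1]
    by_cases hx : x ∈ e.source
    · rw [chartMap_of_mem hx]
      exact e.left_inv hx
    · rw [chartMap_of_notMem hx]
      rfl
  · have h2 : ∀ᶠ s in 𝓝 (0 : ℝ), β (ε⁻¹ * s) = 1 := by
      have h3 : Filter.Tendsto (fun s : ℝ => ε⁻¹ * s) (𝓝 0) (𝓝 0) := by
        have : Continuous (fun s : ℝ => ε⁻¹ * s) := by fun_prop
        simpa using this.tendsto 0
      exact h3.eventually β.eventuallyEq_one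
    filter_upwards [h2] with s hs
    rw [(hgA _).2.2]
    have hp' : β p = 1 := hp
    have h4 : Φ (ε⁻¹ * s, p) = fun u => u + s • C p u := by
      funext u
      simp only [Φ, D₀, hs, hp', mul_one]
      rw [smul_smul, mul_inv_cancel_left₀ hε.ne']
    rw [h4]

/-- Existence of curves with given tangent vectors, for vector fields supported in a chart. -/
theorem exists_curves_of_chart (he : e ∈ IsManifold.maximalAtlas (𝓡 d) ∞ M) {χ : Smooth d M}
    (hχ : IsCompact (tsupport χ)) (hχe : tsupport χ ⊆ e.source) {c : Fin d → Smooth d M}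
    (hc : ∀ x ∈ tsupport χ, ∀ᶠ y in 𝓝 x, ∀ i, c i y = e y i) {V : ℝ → LieGc d n M}
    (hV : IsSmoothLieFamily V) :
    ∃ g : ℝ × ℝ → Gc d n M, IsSmoothSymFamily g ∧
      ∀ᶠ p in 𝓝 (0 : ℝ), IsTangent (fun s => g (s, p)) (LieGc.smulVector χ (V p)) := by
  let w : Fin d → ℝ → Smooth d M := fun j p => χ * (V p).v (c j)
  have hw : ∀ j, ContMDiff (𝓘(ℝ, ℝ).prod (𝓡 d)) 𝓘(ℝ) ∞ (fun q : ℝ × M => w j q.1 q.2) := fun j =>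
    (χ.contMDiff.comp contMDiff_snd).mul (hV.v (c j))
  have hwK : ∀ j p, ∀ x ∉ tsupport χ, w j p x = 0 := fun j p x hx => by
    change χ x * _ = 0
    rw [image_eq_zero_of_notMem_tsupport hx, zero_mul]
  let C : ℝ → EuclideanSpace ℝ (Fin d) → EuclideanSpace ℝ (Fin d) := fun p u =>
    WithLp.toLp 2 fun j => open Classical in if u ∈ e.target then w j p (e.symm u) else 0
  have hC : ContDiff ℝ ∞ (fun q : ℝ × EuclideanSpace ℝ (Fin d) => C q.1 q.2) := by
    rw [contDiff_euclidean]
    exact fun j => contDiff_chart_extend he (hw j) hχ hχe (hwK j)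
  have hK : IsCompact (e '' tsupport χ) := hχ.image_of_continuousOn (e.continuousOn.mono hχe)
  have hKe : e '' tsupport χ ⊆ e.target := by
    rintro _ ⟨x, hx, rfl⟩
    exact e.map_source (hχe hx)
  have hCK : ∀ p, ∀ u ∉ e '' tsupport χ, C p u = 0 := fun p u hu => by
    classical
    ext j
    change (if u ∈ e.target then w j p (e.symm u) else 0) = (0 : ℝ)
    split_ifs with h
    · exact hwK j p _ fun h1 => hu ⟨_, h1, e.right_inv h⟩
    · rfl
  obtain ⟨g, hg, hgA, hgρ⟩ := exists_flow_of_chart (n := n) he hC hK hKe hCK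
  refine ⟨g, hg, ?_⟩
  filter_upwards [hgρ] with p hp
  refine ⟨hp.1, fun x => ⟨fun i j => ?_, fun i => ?_, fun f => ?_⟩⟩
  · simp only [(hgA _).1]
    exact hasDerivAt_const _ _
  · simp only [(hgA _).2]
    exact hasDerivAt_const _ _
  · change HasDerivAt _ (χ x * (V p).v f x) 0
    by_cases hx : x ∈ e.source
    · have h1 : (fun s => f ((g (s, p)).ρ x)) =ᶠ[𝓝 0]
          fun s => (fun u => f (e.symm u)) (e x + s • C p (e x)) := by
        filter_upwards [hp.2 x] with s hs
        rw [hs, chartMap_of_mem hx]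
      refine HasDerivAt.congr_of_eventuallyEq ?_ h1
      have h2 : DifferentiableAt ℝ (fun u => f (e.symm u)) (e x) := by
        have h3 : ContMDiffAt 𝓘(ℝ, EuclideanSpace ℝ (Fin d)) (𝓡 d) ∞ e.symm (e x) :=
          contMDiffAt_symm_of_mem_maximalAtlas he (e.map_source hx)
        have h4 : ContMDiffAt 𝓘(ℝ, EuclideanSpace ℝ (Fin d)) 𝓘(ℝ) ∞ (fun u => f (e.symm u)) (e x) :=
          f.contMDiff.contMDiffAt.comp _ h3
        exact (contMDiffAt_iff_contDiffAt.1 h4).differentiableAt (by simp)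
      have h5 : HasDerivAt (fun s : ℝ => e x + s • C p (e x)) ((1 : ℝ) • C p (e x)) 0 :=
        ((hasDerivAt_id (0 : ℝ)).smul_const _).const_add _
      have h6 : HasFDerivAt (fun u => f (e.symm u)) (fderiv ℝ (fun u => f (e.symm u)) (e x))
          (e x + (0 : ℝ) • C p (e x)) := by
        rw [zero_smul, add_zero]
        exact h2.hasFDerivAt
      have h7 := h6.comp_hasDerivAt (0 : ℝ) h5
      have h8 : fderiv ℝ (fun u => f (e.symm u)) (e x) ((1 : ℝ) • C p (e x)) =
          χ x * (V p).v f x := by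
        have h9 : ∀ j, C p (e x) j = χ x * (V p).v (c j) x := fun j => by
          classical
          change (if e x ∈ e.target then w j p (e.symm (e x)) else 0) = _
          rw [if_pos (e.map_source hx), e.left_inv hx]
          rfl
        have hL : ∀ L : EuclideanSpace ℝ (Fin d) →L[ℝ] ℝ, L (C p (e x)) =
            ∑ j, C p (e x) j * L (EuclideanSpace.single j 1) := fun L => by
          conv_lhs => rw [euclidean_eq_sum_single (C p (e x)), map_sum]
          refine Finset.sum_congr rfl fun j _ => ?_
          rw [map_smul, smul_eq_mul]
        rw [one_smul, hL]
        -- The functions `c` are coordinates only near the support of `χ`; off the support both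
        -- sides carry the factor `χ x = 0`.
        by_cases hxχ : x ∈ tsupport χ
        · rw [derivation_apply_eq_sum (V p).v he hx (hc x hxχ) f, Finset.mul_sum]
          refine Finset.sum_congr rfl fun j _ => ?_
          rw [h9, coordDeriv]
          ring
        · have h10 : χ x = 0 := image_eq_zero_of_notMem_tsupport hxχ
          simp only [h9, h10, zero_mul, Finset.sum_const_zero]
      rw [← h8]
      exact h7
    · have h1 : (fun s => f ((g (s, p)).ρ x)) =ᶠ[𝓝 0] fun s => f x := by
        filter_upwards [hp.2 x] with s hs
        rw [hs, chartMap_of_notMem hx]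
      have h2 : χ x = 0 := image_eq_zero_of_notMem_tsupport fun h => hx (hχe h)
      rw [h2, zero_mul]
      exact (hasDerivAt_const _ _).congr_of_eventuallyEq h1

end ChartCurves

/-! ### The matrix exponential -/

section Exponential

variable {n : ℕ}

open scoped Matrix.Norms.Operator in
theorem contDiff_matrix_exp (i j : Fin n) :
    ContDiff ℝ ∞ (fun a : Fin n → Fin n → ℝ => NormedSpace.exp (Matrix.of a) i j) := by
  have h1 : ContDiff ℝ ∞ (NormedSpace.exp : Matrix (Fin n) (Fin n) ℝ → _) := by
    have : AnalyticOnNhd ℝ (NormedSpace.exp : Matrix (Fin n) (Fin n) ℝ → _) Set.univ :=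
      fun x _ => NormedSpace.exp_analytic x
    exact this.contDiff
  let L : (Fin n → Fin n → ℝ) →ₗ[ℝ] Matrix (Fin n) (Fin n) ℝ := (Matrix.ofLinearEquiv ℝ).toLinearMap
  let L' : Matrix (Fin n) (Fin n) ℝ →ₗ[ℝ] ℝ := Matrix.entryLinearMap ℝ ℝ i j
  have h2 : ContDiff ℝ ∞ L := L.toContinuousLinearMap.contDiff
  have h3 : ContDiff ℝ ∞ L' := L'.toContinuousLinearMap.contDiff
  exact h3.comp (h1.comp h2)

open scoped Matrix.Norms.Operator in
theorem hasDerivAt_matrix_exp (a : Matrix (Fin n) (Fin n) ℝ) (i j : Fin n) :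
    HasDerivAt (fun s : ℝ => NormedSpace.exp (s • a) i j) (a i j) 0 := by
  have h1 := hasDerivAt_exp_smul_const a (0 : ℝ)
  rw [zero_smul, NormedSpace.exp_zero, one_mul] at h1
  let L' : Matrix (Fin n) (Fin n) ℝ →ₗ[ℝ] ℝ := Matrix.entryLinearMap ℝ ℝ i j
  exact (L'.toContinuousLinearMap.hasFDerivAt).comp_hasDerivAt (0 : ℝ) h1

theorem matrix_exp_mul_exp_neg (a : Matrix (Fin n) (Fin n) ℝ) :
    NormedSpace.exp a * NormedSpace.exp (-a) = 1 := by
  rw [← Matrix.exp_add_of_commute _ _ (Commute.neg_right (Commute.refl a)), add_neg_cancel,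
    NormedSpace.exp_zero]

end Exponential

/-! ### Every smooth family of infinitesimal symmetries is tangent to curves -/

section Curves

variable {d n : ℕ} {M : Type*} [TopologicalSpace M] [ChartedSpace (EuclideanSpace ℝ (Fin d)) M]

namespace LieGc

theorem ext_apply {X Y : LieGc d n M} (ha : ∀ i j x, X.a i j x = Y.a i j x)
    (hp : ∀ i x, X.p i x = Y.p i x) (hv : ∀ f x, X.v f x = Y.v f x) : X = Y := by
  refine Subtype.ext (Prod.ext ?_ (Prod.ext ?_ ?_))
  · exact Matrix.ext fun i j => ContMDiffMap.ext (ha i j)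
  · exact funext fun i => ContMDiffMap.ext (hp i)
  · exact Derivation.ext fun f => ContMDiffMap.ext (hv f)

/-- Evaluation of the matrix part. -/
def evalA (i j : Fin n) (x : M) : LieGc d n M →ₗ[ℝ] ℝ where
  toFun X := X.a i j x
  map_add' _ _ := rfl
  map_smul' _ _ := rfl

/-- Evaluation of the translation part. -/
def evalP (i : Fin n) (x : M) : LieGc d n M →ₗ[ℝ] ℝ where
  toFun X := X.p i x
  map_add' _ _ := rfl
  map_smul' _ _ := rfl

/-- Evaluation of the vector field. -/
def evalV (f : Smooth d M) (x : M) : LieGc d n M →ₗ[ℝ] ℝ where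
  toFun X := X.v f x
  map_add' _ _ := rfl
  map_smul' _ _ := rfl

/-- Translations and matrix exponentials provide global curves for the first two parts. Only the
vector field has to be cut into pieces supported in charts, and the pieces need to sum to `1` only
on its support. -/
theorem eq_add_sum {X : LieGc d n M} {K : Set M} (hX : ∀ x ∉ K, ∀ f, X.v f x = 0)
    {ι : Type*} (t : Finset ι) (χ : ι → Smooth d M) (hχ : ∀ x ∈ K, ∑ i ∈ t, χ i x = 1) :
    X = X.linearPart + (X.translationPart + ∑ i ∈ t, X.smulVector (χ i)) := by
  refine ext_apply (fun i j x => ?_) (fun i x => ?_) fun f x => ?_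
  · change evalA i j x X =
      evalA i j x (X.linearPart + (X.translationPart + ∑ i ∈ t, X.smulVector (χ i)))
    rw [map_add, map_add, map_sum]
    change X.a i j x = X.a i j x + (0 + ∑ _ ∈ t, 0)
    simp
  · change evalP i x X =
      evalP i x (X.linearPart + (X.translationPart + ∑ i ∈ t, X.smulVector (χ i)))
    rw [map_add, map_add, map_sum]
    change X.p i x = 0 + (X.p i x + ∑ _ ∈ t, 0)
    simp
  · change evalV f x X =
      evalV f x (X.linearPart + (X.translationPart + ∑ i ∈ t, X.smulVector (χ i)))
    rw [map_add, map_add, map_sum]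
    change X.v f x = 0 + (0 + ∑ i ∈ t, χ i x * X.v f x)
    rw [← Finset.sum_mul, zero_add, zero_add]
    by_cases hx : x ∈ K
    · rw [hχ x hx, one_mul]
    · rw [hX x hx, mul_zero]

end LieGc

/-- The infinitesimal symmetries `V p`, `p` near `0`, are the tangent vectors of a smooth family
of curves of symmetries. -/
def HasCurves (V : ℝ → LieGc d n M) : Prop :=
  ∃ g : ℝ × ℝ → Gc d n M, IsSmoothSymFamily g ∧
    ∀ᶠ p in 𝓝 (0 : ℝ), IsTangent (fun s => g (s, p)) (V p)

/-- The product of two curves through the unit is tangent to the sum. -/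
theorem HasCurves.add {V W : ℝ → LieGc d n M} (hV : HasCurves V) (hW : HasCurves W) :
    HasCurves (fun p => V p + W p) := by
  obtain ⟨g, hg, hgV⟩ := hV
  obtain ⟨h, hh, hhW⟩ := hW
  refine ⟨fun q => g q * h q, hg.mul hh, ?_⟩
  filter_upwards [hgV, hhW] with p h1 h2
  have hs : ContDiff ℝ ∞ (fun s : ℝ => (s, p)) := contDiff_id.prodMk contDiff_const
  exact h1.mul h2 (hg.comp hs) (hh.comp hs)

theorem HasCurves.sum {ι : Type*} (t : Finset ι) {V : ι → ℝ → LieGc d n M}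
    (hV : ∀ i ∈ t, HasCurves (V i)) : HasCurves (fun p => ∑ i ∈ t, V i p) := by
  classical
  induction t using Finset.induction_on with
  | empty =>
    exact ⟨fun _ => 1, IsSmoothSymFamily.const 1, Filter.Eventually.of_forall fun p => isTangent_one⟩
  | insert a t ha ih =>
    simp only [Finset.sum_insert ha]
    exact (hV a (Finset.mem_insert_self a t)).add
      (ih fun i hi => hV i (Finset.mem_insert_of_mem hi))

theorem isSmoothSymFamily_of_mul_eq_one {P : Type} [NormedAddCommGroup P] [NormedSpace ℝ P]
    {g h : P → Gc d n M} (hgK : HasCommonSupport g) (hg : HasSmoothComponents g)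
    (hh : HasSmoothComponents h) (hgh : ∀ s, g s * h s = 1) : IsSmoothSymFamily g := by
  refine isSmoothSymFamily_iff.2 ⟨hgK, hg, ?_⟩
  have : (fun s => (g s)⁻¹) = h := funext fun s => inv_eq_of_mul_eq_one_right (hgh s)
  rwa [this]

/-- The translation `φ ↦ φ + ψ`. -/
def Gc.translation (ψ : Conf d n M) (h : CompactlySupported ψ) : Gc d n M where
  ρ := Diffeomorph.refl (𝓡 d) M ∞
  A := 1
  ψ := ψ
  compact := by
    obtain ⟨K, hK, h⟩ := h
    exact ⟨K, hK, fun x hx => ⟨rfl, (Gc.evalGL_eq_one_iff x _).1 (map_one _), h x hx⟩⟩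

theorem hasCurves_translationPart {V : ℝ → LieGc d n M} (hV : IsSmoothLieFamily V) :
    HasCurves (fun p => (V p).translationPart) := by
  obtain ⟨K, hK, hVK⟩ := hV.support
  have hcs : ∀ (s p x), x ∉ K → ∀ i, (s • (V p).p) i x = 0 := fun s p x hx i => by
    change s * (V p).p i x = 0
    rw [(hVK p x hx).2.1 i, mul_zero]
  -- The constant `c` takes the values `1` and `-1`, giving the curve and its inverse at once;
  -- smoothness of inverses is part of the notion of a smooth family.
  let g : ℝ → ℝ × ℝ → Gc d n M := fun c q =>
    Gc.translation ((c * q.1) • (V q.2).p) ⟨K, hK, fun x hx => hcs _ _ x hx⟩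
  have hg : ∀ c, HasSmoothComponents (g c) := fun c => by
    refine ⟨contMDiff_snd, fun i j =>
      (((1 : GL (Fin n) (Smooth d M)).val i j)).contMDiff.comp contMDiff_snd, fun i => ?_⟩
    change ContMDiff _ _ _ (fun q : (ℝ × ℝ) × M => (c * q.1.1) * (V q.1.2).p i q.2)
    have h1 : ContDiff ℝ ∞ (fun q : ℝ × ℝ => c * q.1) := contDiff_const.mul contDiff_fst
    exact (h1.contMDiff.comp contMDiff_fst).mul ((hV.p i).comp
      ((contDiff_snd.contMDiff.comp contMDiff_fst).prodMk contMDiff_snd))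
  have hmul : ∀ q, g 1 q * g (-1) q = 1 := fun q => by
    refine Gc.ext (Diffeomorph.ext fun x => rfl) ?_ ?_
    · rw [Gc.mul_A]
      change Gc.pullGL _ 1 * 1 = 1
      rw [map_one, one_mul]
    · funext j
      refine ContMDiffMap.ext fun x => ?_
      rw [Gc.mul_ψ_apply]
      change ∑ i, (1 * q.1) * (V q.2).p i x * (1 : GL (Fin n) (Smooth d M)).val i j x +
        (-1 * q.1) * (V q.2).p j x = 0
      simp only [Gc.one_A_apply, Matrix.one_apply]
      simp
  refine ⟨g 1, isSmoothSymFamily_of_mul_eq_one ⟨K, hK, fun q x hx => ⟨rfl, Gc.one_A_apply x,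
    fun i => hcs _ _ x hx i⟩⟩ (hg 1) (hg (-1)) hmul, Filter.Eventually.of_forall fun p =>
    ⟨?_, fun x => ⟨fun i j => hasDerivAt_const (0 : ℝ) ((1 : GL (Fin n) (Smooth d M)).val i j x),
      fun i => ?_, fun f => hasDerivAt_const (0 : ℝ) (f x)⟩⟩⟩
  · refine Gc.ext rfl rfl ?_
    funext i
    refine ContMDiffMap.ext fun x => ?_
    change (1 * 0) * (V p).p i x = 0
    ring
  · change HasDerivAt (fun s : ℝ => (1 * s) * (V p).p i x) ((V p).p i x) 0
    simpa using ((hasDerivAt_id (0 : ℝ)).const_mul 1).mul_const ((V p).p i x)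

/-- The exponential of a matrix of functions. -/
def expMatrix (a : Matrix (Fin n) (Fin n) (Smooth d M)) : Matrix (Fin n) (Fin n) (Smooth d M) :=
  Matrix.of fun i j => ⟨fun x => NormedSpace.exp (Matrix.of fun k l => a k l x) i j,
    (contMDiff_iff_contDiff.2 (contDiff_matrix_exp i j)).comp
      (contMDiff_pi_space.2 fun k => contMDiff_pi_space.2 fun l => (a k l).contMDiff)⟩

theorem expMatrix_apply (a : Matrix (Fin n) (Fin n) (Smooth d M)) (i j : Fin n) (x : M) :
    expMatrix a i j x = NormedSpace.exp (Matrix.of fun k l => a k l x) i j := rfl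

theorem expMatrix_mul_neg (a : Matrix (Fin n) (Fin n) (Smooth d M)) :
    expMatrix a * expMatrix (-a) = 1 := by
  refine Matrix.ext fun i j => ContMDiffMap.ext fun x => ?_
  rw [Gc.matMul_apply]
  simp only [expMatrix_apply]
  have h1 : (Matrix.of fun k l => (-a) k l x) = -(Matrix.of fun k l => a k l x) := rfl
  rw [h1, ← Matrix.mul_apply, matrix_exp_mul_exp_neg]
  exact (Gc.one_A_apply x i j).symm

/-- The exponential of a matrix of functions, as an invertible matrix. -/
def expGL (a : Matrix (Fin n) (Fin n) (Smooth d M)) : GL (Fin n) (Smooth d M) where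
  val := expMatrix a
  inv := expMatrix (-a)
  val_inv := expMatrix_mul_neg a
  inv_val := by simpa using expMatrix_mul_neg (-a)

theorem expMatrix_eq_one {a : Matrix (Fin n) (Fin n) (Smooth d M)} {x : M}
    (h : ∀ i j, a i j x = 0) (i j : Fin n) :
    expMatrix a i j x = (1 : Matrix (Fin n) (Fin n) ℝ) i j := by
  have h1 : (Matrix.of fun k l => a k l x) = 0 := Matrix.ext h
  rw [expMatrix_apply, h1, NormedSpace.exp_zero]

/-- The transformation `φ ↦ φ exp(a)`. -/
def Gc.linear (a : Matrix (Fin n) (Fin n) (Smooth d M))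
    (h : ∃ K : Set M, IsCompact K ∧ ∀ x ∉ K, ∀ i j, a i j x = 0) : Gc d n M where
  ρ := Diffeomorph.refl (𝓡 d) M ∞
  A := expGL a
  ψ := 0
  compact := by
    obtain ⟨K, hK, h⟩ := h
    exact ⟨K, hK, fun x hx => ⟨rfl, expMatrix_eq_one (h x hx), fun _ => rfl⟩⟩

theorem hasCurves_linearPart {V : ℝ → LieGc d n M} (hV : IsSmoothLieFamily V) :
    HasCurves (fun p => (V p).linearPart) := by
  obtain ⟨K, hK, hVK⟩ := hV.support
  have hcs : ∀ (s p x), x ∉ K → ∀ i j, (s • (V p).a) i j x = 0 := fun s p x hx i j => by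
    change s * (V p).a i j x = 0
    rw [(hVK p x hx).1 i j, mul_zero]
  -- Again `c = -1` gives the inverse curve, since `exp(a) exp(-a) = 1`.
  let g : ℝ → ℝ × ℝ → Gc d n M := fun c q =>
    Gc.linear ((c * q.1) • (V q.2).a) ⟨K, hK, fun x hx => hcs _ _ x hx⟩
  have hg : ∀ c, HasSmoothComponents (g c) := fun c => by
    refine ⟨contMDiff_snd, fun i j => ?_, fun i => contMDiff_const⟩
    refine (contMDiff_iff_contDiff.2 (contDiff_matrix_exp i j)).comp
      (contMDiff_pi_space.2 fun k => contMDiff_pi_space.2 fun l => ?_)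
    change ContMDiff _ _ _ (fun q : (ℝ × ℝ) × M => (c * q.1.1) * (V q.1.2).a k l q.2)
    have h1 : ContDiff ℝ ∞ (fun q : ℝ × ℝ => c * q.1) := contDiff_const.mul contDiff_fst
    exact (h1.contMDiff.comp contMDiff_fst).mul ((hV.a k l).comp
      ((contDiff_snd.contMDiff.comp contMDiff_fst).prodMk contMDiff_snd))
  have hmul : ∀ q, g 1 q * g (-1) q = 1 := fun q => by
    refine Gc.ext (Diffeomorph.ext fun x => rfl) (Units.ext ?_) ?_
    · change expMatrix ((1 * q.1) • (V q.2).a) * expMatrix ((-1 * q.1) • (V q.2).a) = 1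
      rw [one_mul, neg_one_mul, neg_smul, expMatrix_mul_neg]
    · funext j
      refine ContMDiffMap.ext fun x => ?_
      rw [Gc.mul_ψ_apply]
      change ∑ i, (0 : ℝ) * _ + 0 = 0
      simp
  refine ⟨g 1, isSmoothSymFamily_of_mul_eq_one ⟨K, hK, fun q x hx => ⟨rfl,
    expMatrix_eq_one (hcs _ _ x hx), fun i => rfl⟩⟩ (hg 1) (hg (-1)) hmul,
    Filter.Eventually.of_forall fun p =>
    ⟨?_, fun x => ⟨fun i j => ?_, fun i => hasDerivAt_const _ _, fun f => hasDerivAt_const (0 : ℝ) (f x)⟩⟩⟩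
  · refine Gc.ext rfl (Units.ext ?_) rfl
    refine Matrix.ext fun i j => ContMDiffMap.ext fun x => ?_
    change expMatrix ((1 * 0 : ℝ) • (V p).a) i j x = _
    rw [expMatrix_eq_one (fun i j => ?_)]
    · exact (Gc.one_A_apply x i j).symm
    · change (1 * 0 : ℝ) * (V p).a i j x = 0
      ring
  · have h1 : (fun s : ℝ => (g 1 (s, p)).A.val i j x) =
        fun s : ℝ => NormedSpace.exp (s • (Matrix.of fun k l => (V p).a k l x)) i j := by
      funext s
      change expMatrix ((1 * s : ℝ) • (V p).a) i j x = _
      rw [one_mul, expMatrix_apply]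
      rfl
    rw [h1]
    exact hasDerivAt_matrix_exp _ i j

variable [IsManifold (𝓡 d) ∞ M] [T2Space M] [SecondCountableTopology M]

/-- Smooth families of infinitesimal symmetries are tangent to smooth families of curves. -/
theorem hasCurves_of_isSmoothLieFamily {V : ℝ → LieGc d n M} (hV : IsSmoothLieFamily V) :
    HasCurves V := by
  obtain ⟨K, hK, hVK⟩ := id hV.support
  have : LocallyCompactSpace M := Manifold.locallyCompact_of_finiteDimensional (𝓡 d)
  let e : M → OpenPartialHomeomorph M (EuclideanSpace ℝ (Fin d)) := fun x => chartAt _ x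
  have he : ∀ x, e x ∈ IsManifold.maximalAtlas (𝓡 d) ∞ M := fun x =>
    IsManifold.chart_mem_maximalAtlas x
  choose c hc using fun x : M => exists_coordinates (he x) (mem_chart_source _ x)
  -- Compact neighbourhoods inside the chart on which global functions realize the coordinates, also
  -- near each of their points.
  have hN : ∀ x : M, ∃ C ∈ 𝓝 x, C ⊆ {z | (∀ᶠ y in 𝓝 z, ∀ i, c x i y = e x y i) ∧ z ∈ (e x).source} ∧
      IsCompact C := fun x => local_compact_nhds (by
    filter_upwards [eventually_eventually_nhds.2 (hc x),
      (e x).open_source.mem_nhds (mem_chart_source _ x)] with z h1 h2 using ⟨h1, h2⟩)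
  choose C hCx hCs hC using hN
  obtain ⟨f, hf⟩ := SmoothPartitionOfUnity.exists_isSubordinate (𝓡 d) hK.isClosed
    (fun x : M => interior (C x)) (fun x => isOpen_interior)
    (fun x _ => Set.mem_iUnion.2 ⟨x, mem_interior_iff_mem_nhds.2 (hCx x)⟩)
  -- Only finitely many members of the partition meet the compact set `K`, so the decomposition is a
  -- finite sum.
  have hfin : {i | (Function.support (f i) ∩ K).Nonempty}.Finite :=
    f.locallyFinite.finite_nonempty_inter_compact hK
  have hsum : ∀ x ∈ K, ∑ i ∈ hfin.toFinset, f i x = 1 := fun x hx => by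
    rw [← f.sum_eq_one hx]
    refine (finsum_eq_sum_of_support_subset _ fun i hi => ?_).symm
    simp only [Set.Finite.coe_toFinset, Set.mem_ofPred_eq]
    exact ⟨x, hi, hx⟩
  have hpiece : ∀ i, HasCurves (fun p => (V p).smulVector (f i)) := fun i => by
    have hsub : tsupport (f i) ⊆ C i := (hf i).trans interior_subset
    exact exists_curves_of_chart (he i)
      ((hC i).of_isClosed_subset (isClosed_tsupport _) hsub) (fun x hx => (hCs i (hsub hx)).2)
      (fun x hx => (hCs i (hsub hx)).1) hV
  have := (hasCurves_linearPart hV).add ((hasCurves_translationPart hV).add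
    (HasCurves.sum hfin.toFinset fun i _ => hpiece i))
  convert this using 2 with p
  exact LieGc.eq_add_sum (fun x hx => (hVK p x hx).2.2) _ _ hsum

theorem exists_isTangent (X : LieGc d n M) :
    ∃ g : ℝ → Gc d n M, IsSmoothSymFamily g ∧ IsTangent g X := by
  obtain ⟨g, hg, h⟩ := hasCurves_of_isSmoothLieFamily (isSmoothLieFamily_const (P := ℝ) X)
  exact ⟨fun s => g (s, 0), hg.comp (contDiff_id.prodMk contDiff_const), h.self_of_nhds⟩

end Curves

/-! ### Algebra of difference quotients -/

section DifferenceQuotients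

theorem dslope_zero_add {f h : ℝ → ℝ} (hf : DifferentiableAt ℝ f 0) (hh : DifferentiableAt ℝ h 0)
    (t : ℝ) : dslope (fun t => f t + h t) 0 t = dslope f 0 t + dslope h 0 t := by
  rcases eq_or_ne t 0 with rfl | ht
  · simp only [dslope_same]
    exact deriv_fun_add hf hh
  · simp only [dslope_of_ne _ ht, slope_def_field]
    ring

theorem dslope_zero_const_mul {f : ℝ → ℝ} (hf : DifferentiableAt ℝ f 0) (c t : ℝ) :
    dslope (fun t => c * f t) 0 t = c * dslope f 0 t := by
  rcases eq_or_ne t 0 with rfl | ht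
  · simp only [dslope_same]
    exact deriv_const_mul c hf
  · simp only [dslope_of_ne _ ht, slope_def_field]
    ring

theorem dslope_zero_fun (t : ℝ) : dslope (fun _ : ℝ => (0 : ℝ)) 0 t = 0 := by
  rcases eq_or_ne t 0 with rfl | ht
  · simp [dslope_same]
  · simp [dslope_of_ne _ ht, slope_def_field]

theorem eq_add_mul_dslope (f : ℝ → ℝ) (s : ℝ) : f s = f 0 + s * dslope f 0 s := by
  have := sub_smul_dslope f 0 s
  simp only [sub_zero, smul_eq_mul] at this
  linarith

/-- Only continuity of `c` at `0` is needed; hence the later product rules ask for continuity of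
remainder terms, not for their derivatives. -/
theorem hasDerivAt_add_mul {a : ℝ} {c : ℝ → ℝ} (hc : ContinuousAt c 0) :
    HasDerivAt (fun t => a + t * c t) (c 0) 0 := by
  rw [hasDerivAt_iff_tendsto_slope]
  refine (hc.tendsto.mono_left nhdsWithin_le_nhds).congr' ?_
  filter_upwards [self_mem_nhdsWithin] with t ht
  have ht' : t ≠ 0 := ht
  simp only [slope_def_field]
  field_simp
  ring

end DifferenceQuotients

/-! ### Smooth families of tangent vectors and their difference quotients -/

section TangentFamilies

variable {d n : ℕ} {M : Type*} [TopologicalSpace M] [ChartedSpace (EuclideanSpace ℝ (Fin d)) M]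
  [IsManifold (𝓡 d) ∞ M] [T2Space M]

/-- A smooth family of smooth functions. -/
def IsSmoothFunFamily {Q : Type*} [NormedAddCommGroup Q] [NormedSpace ℝ Q]
    (f : Q → Smooth d M) : Prop :=
  ContMDiff (𝓘(ℝ, Q).prod (𝓡 d)) 𝓘(ℝ) ∞ (fun q : Q × M => f q.1 q.2)

theorem IsSmoothFunFamily.differentiable {f : ℝ → Smooth d M} (hf : IsSmoothFunFamily f) (x : M)
    (s : ℝ) : DifferentiableAt ℝ (fun s => f s x) s :=
  (contMDiff_slice (f := fun s x => f s x) hf x).differentiable (by simp) s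

/-- The difference quotients of a smooth family of functions. -/
def dslopeFun {f : ℝ → Smooth d M} (h : IsSmoothFunFamily f) (s : ℝ) : Smooth d M :=
  ⟨fun x => dslope (fun s => f s x) 0 s, by
    have h1 : ContMDiff (𝓘(ℝ).prod (𝓡 d)) 𝓘(ℝ) ∞
        (fun q : ℝ × M => dslope (fun s => f s q.2) 0 q.1) :=
      contMDiff_dslope (f := fun s x => f s x) h
    exact h1.comp (contMDiff_const.prodMk contMDiff_id)⟩

theorem isSmoothFunFamily_dslopeFun {f : ℝ → Smooth d M} (h : IsSmoothFunFamily f) :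
    IsSmoothFunFamily (dslopeFun h) :=
  contMDiff_dslope (f := fun s x => f s x) h

theorem eq_add_smul_dslopeFun {f : ℝ → Smooth d M} (h : IsSmoothFunFamily f) (s : ℝ) :
    f s = f 0 + s • dslopeFun h s :=
  ContMDiffMap.ext fun x => eq_add_mul_dslope (fun s => f s x) s

/-- The partial derivative with respect to the first parameter. -/
theorem contMDiff_deriv_fst {f : ℝ × ℝ → M → ℝ}
    (hf : ContMDiff (𝓘(ℝ, ℝ × ℝ).prod (𝓡 d)) 𝓘(ℝ) ∞ (fun q : (ℝ × ℝ) × M => f q.1 q.2)) :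
    ContMDiff (𝓘(ℝ, ℝ).prod (𝓡 d)) 𝓘(ℝ) ∞
      (fun q : ℝ × M => deriv (fun s => f (s, q.1) q.2) 0) := by
  have : IsManifold (𝓡 d) 1 M := IsManifold.of_le (n := ∞) (by simp)
  have h1 := contMDiff_partialDeriv hf ((1 : ℝ), (0 : ℝ))
  have h2 : ContMDiff (𝓘(ℝ, ℝ).prod (𝓡 d)) (𝓘(ℝ, ℝ × ℝ).prod (𝓡 d)) ∞
      (fun q : ℝ × M => (((0 : ℝ), q.1), q.2)) := by
    have h3 : ContDiff ℝ ∞ (fun t : ℝ => ((0 : ℝ), t)) := contDiff_const.prodMk contDiff_id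
    exact (h3.contMDiff.comp contMDiff_fst).prodMk contMDiff_snd
  have h4 := h1.comp h2
  convert h4 using 1
  funext q
  have h5 : HasFDerivAt (fun e => f e q.2) (fderiv ℝ (fun e => f e q.2) (0, q.1)) (0, q.1) :=
    ((contMDiff_slice hf q.2).differentiable (by simp) _).hasFDerivAt
  have h6 : HasDerivAt (fun s : ℝ => (s, q.1)) ((1 : ℝ), (0 : ℝ)) 0 :=
    (hasDerivAt_id _).prodMk (hasDerivAt_const _ _)
  exact (HasFDerivAt.comp_hasDerivAt (0 : ℝ) h5 h6).deriv

variable {G : ℝ × ℝ → Gc d n M}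

theorem isSmoothFunFamily_deriv_A (hG : IsSmoothSymFamily G) (i j : Fin n) :
    ContMDiff (𝓘(ℝ, ℝ).prod (𝓡 d)) 𝓘(ℝ) ∞
      (fun q : ℝ × M => deriv (fun s => (G (s, q.1)).A.val i j q.2) 0) :=
  contMDiff_deriv_fst (f := fun q x => (G q).A.val i j x) (hG.components.2.1 i j)

theorem isSmoothFunFamily_deriv_ψ (hG : IsSmoothSymFamily G) (i : Fin n) :
    ContMDiff (𝓘(ℝ, ℝ).prod (𝓡 d)) 𝓘(ℝ) ∞
      (fun q : ℝ × M => deriv (fun s => (G (s, q.1)).ψ i q.2) 0) :=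
  contMDiff_deriv_fst (f := fun q x => (G q).ψ i x) (hG.components.2.2 i)

theorem isSmoothFunFamily_deriv_ρ (hG : IsSmoothSymFamily G) (f : Smooth d M) :
    ContMDiff (𝓘(ℝ, ℝ).prod (𝓡 d)) 𝓘(ℝ) ∞
      (fun q : ℝ × M => deriv (fun s => f ((G (s, q.1)).ρ q.2)) 0) :=
  contMDiff_deriv_fst (f := fun q x => f ((G q).ρ x)) (f.contMDiff.comp hG.components.1)

theorem contMDiff_slice_fst {f : ℝ → M → ℝ}
    (h : ContMDiff (𝓘(ℝ, ℝ).prod (𝓡 d)) 𝓘(ℝ) ∞ (fun q : ℝ × M => f q.1 q.2)) (t : ℝ) :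
    ContMDiff (𝓡 d) 𝓘(ℝ) ∞ (f t) := by
  have h4 : ContMDiff (𝓡 d) (𝓘(ℝ, ℝ).prod (𝓡 d)) ∞ (fun y : M => (t, y)) :=
    contMDiff_const.prodMk contMDiff_id
  exact h.comp h4

theorem hasDerivAt_slice_ρ (hG : IsSmoothSymFamily G) (f : Smooth d M) (t : ℝ) (x : M) :
    HasDerivAt (fun s => f ((G (s, t)).ρ x)) (deriv (fun s => f ((G (s, t)).ρ x)) 0) 0 :=
  hasDerivAt_of_contDiff ((hG.contDiff_ρ f x).comp (contDiff_id.prodMk contDiff_const)) 0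

/-- The vector field tangent to a family of symmetries. -/
def tangentVector (hG : IsSmoothSymFamily G) (h0 : ∀ t, G (0, t) = 1) (t : ℝ) :
    Derivation ℝ (Smooth d M) (Smooth d M) :=
  Derivation.mk'
    { toFun := fun f => ⟨fun x => deriv (fun s => f ((G (s, t)).ρ x)) 0,
        contMDiff_slice_fst (f := fun t x => deriv (fun s => f ((G (s, t)).ρ x)) 0)
          (isSmoothFunFamily_deriv_ρ hG f) t⟩
      map_add' := fun f h => ContMDiffMap.ext fun x =>
        ((hasDerivAt_slice_ρ hG f t x).add (hasDerivAt_slice_ρ hG h t x)).deriv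
      map_smul' := fun c f => ContMDiffMap.ext fun x =>
        ((hasDerivAt_slice_ρ hG f t x).const_mul c).deriv }
    (fun f h => ContMDiffMap.ext fun x => by
      have h1 := ((hasDerivAt_slice_ρ hG f t x).mul (hasDerivAt_slice_ρ hG h t x)).deriv
      -- The curve starts at the unit, so the product rule takes the values of `f` and `h` at `x`
      -- itself: this is the Leibniz rule.
      have h2 : (G (0, t)).ρ x = x := by rw [h0]; rfl
      rw [h2] at h1
      change deriv (fun s => f ((G (s, t)).ρ x) * h ((G (s, t)).ρ x)) 0 =
        f x * deriv (fun s => h ((G (s, t)).ρ x)) 0 + h x * deriv (fun s => f ((G (s, t)).ρ x)) 0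
      refine h1.trans ?_
      ring)

/-- A smooth family of curves through the unit has a smooth family of tangent vectors. -/
theorem exists_tangentFamily (hG : IsSmoothSymFamily G) (h0 : ∀ t, G (0, t) = 1) :
    ∃ V : ℝ → LieGc d n M, IsSmoothLieFamily V ∧ ∀ t, IsTangent (fun s => G (s, t)) (V t) := by
  obtain ⟨⟨K, hK, hGK⟩, -⟩ := isSmoothSymFamily_iff.1 hG
  have hs : ∀ t : ℝ, ContDiff ℝ ∞ (fun s : ℝ => (s, t)) := fun t => contDiff_id.prodMk contDiff_const
  have hVK : ∀ t, ∀ x ∉ K, (∀ i j, deriv (fun s => (G (s, t)).A.val i j x) 0 = 0) ∧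
      (∀ i, deriv (fun s => (G (s, t)).ψ i x) 0 = 0) ∧
      ∀ f : Smooth d M, deriv (fun s => f ((G (s, t)).ρ x)) 0 = 0 := fun t x hx => by
    have h1 := fun s => hGK (s, t) x hx
    exact ⟨fun i j => by simp only [(h1 _).2.1, deriv_const],
      fun i => by simp only [(h1 _).2.2, deriv_const],
      fun f => by simp only [(h1 _).1, deriv_const]⟩
  let V : ℝ → LieGc d n M := fun t =>
    ⟨(Matrix.of fun i j => ⟨fun x => deriv (fun s => (G (s, t)).A.val i j x) 0,
        contMDiff_slice_fst (f := fun t x => deriv (fun s => (G (s, t)).A.val i j x) 0)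
          (isSmoothFunFamily_deriv_A hG i j) t⟩,
      fun i => ⟨fun x => deriv (fun s => (G (s, t)).ψ i x) 0,
        contMDiff_slice_fst (f := fun t x => deriv (fun s => (G (s, t)).ψ i x) 0)
          (isSmoothFunFamily_deriv_ψ hG i) t⟩,
      tangentVector hG h0 t), K, hK, hVK t⟩
  refine ⟨V, ⟨⟨K, hK, hVK⟩, isSmoothFunFamily_deriv_A hG, isSmoothFunFamily_deriv_ψ hG,
    isSmoothFunFamily_deriv_ρ hG⟩, fun t => ⟨h0 t, fun x => ⟨fun i j => ?_, fun i => ?_,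
    fun f => hasDerivAt_slice_ρ hG f t x⟩⟩⟩
  · exact hasDerivAt_of_contDiff ((hG.contDiff_A i j x).comp (hs t)) 0
  · exact hasDerivAt_of_contDiff ((hG.contDiff_ψ i x).comp (hs t)) 0

variable {V : ℝ → LieGc d n M}

/-- The difference quotients of a smooth family of vector fields. -/
def dslopeVector (hV : IsSmoothLieFamily V) (t : ℝ) : Derivation ℝ (Smooth d M) (Smooth d M) :=
  Derivation.mk'
    { toFun := fun f => dslopeFun (f := fun t => (V t).v f) (hV.v f) t
      map_add' := fun f h => ContMDiffMap.ext fun x => by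
        refine Eq.trans ?_ (dslope_zero_add
          (IsSmoothFunFamily.differentiable (f := fun t => (V t).v f) (hV.v f) x 0)
          (IsSmoothFunFamily.differentiable (f := fun t => (V t).v h) (hV.v h) x 0) t)
        change dslope (fun t => (V t).v (f + h) x) 0 t = _
        simp only [map_add]
        rfl
      map_smul' := fun c f => ContMDiffMap.ext fun x => by
        refine Eq.trans ?_ (dslope_zero_const_mul
          (IsSmoothFunFamily.differentiable (f := fun t => (V t).v f) (hV.v f) x 0) c t)
        change dslope (fun t => (V t).v (c • f) x) 0 t = _
        simp only [Derivation.map_smul]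
        rfl }
    (fun f h => ContMDiffMap.ext fun x => by
      have hf := IsSmoothFunFamily.differentiable (f := fun t => (V t).v f) (hV.v f) x 0
      have hh := IsSmoothFunFamily.differentiable (f := fun t => (V t).v h) (hV.v h) x 0
      change dslope (fun t => (V t).v (f * h) x) 0 t =
        f x * dslope (fun t => (V t).v h x) 0 t + h x * dslope (fun t => (V t).v f x) 0 t
      rw [← dslope_zero_const_mul hf, ← dslope_zero_const_mul hh,
        ← dslope_zero_add (hh.const_mul _) (hf.const_mul _)]
      simp only [derivation_mul_apply])

/-- Hadamard's lemma for families of infinitesimal symmetries. -/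
theorem exists_eq_add_smul (hV : IsSmoothLieFamily V) :
    ∃ W : ℝ → LieGc d n M, IsSmoothLieFamily W ∧ ∀ t, V t = V 0 + t • W t := by
  obtain ⟨K, hK, hVK⟩ := id hV.support
  have hWK : ∀ t, ∀ x ∉ K, (∀ i j, dslope (fun t => (V t).a i j x) 0 t = 0) ∧
      (∀ i, dslope (fun t => (V t).p i x) 0 t = 0) ∧
      ∀ f : Smooth d M, dslope (fun t => (V t).v f x) 0 t = 0 := fun t x hx => by
    have h1 := fun s => hVK s x hx
    exact ⟨fun i j => by simp only [(h1 _).1, dslope_zero_fun],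
      fun i => by simp only [(h1 _).2.1, dslope_zero_fun],
      fun f => by simp only [(h1 _).2.2, dslope_zero_fun]⟩
  refine ⟨fun t => ⟨(Matrix.of fun i j => dslopeFun (f := fun t => (V t).a i j) (hV.a i j) t,
      fun i => dslopeFun (f := fun t => (V t).p i) (hV.p i) t, dslopeVector hV t), K, hK, hWK t⟩,
    ⟨⟨K, hK, hWK⟩, fun i j => isSmoothFunFamily_dslopeFun (f := fun t => (V t).a i j) (hV.a i j),
      fun i => isSmoothFunFamily_dslopeFun (f := fun t => (V t).p i) (hV.p i),
      fun f => isSmoothFunFamily_dslopeFun (f := fun t => (V t).v f) (hV.v f)⟩, fun t => ?_⟩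
  refine LieGc.ext_apply (fun i j x => ?_) (fun i x => ?_) fun f x => ?_
  · exact eq_add_mul_dslope (fun t => (V t).a i j x) t
  · exact eq_add_mul_dslope (fun t => (V t).p i x) t
  · exact eq_add_mul_dslope (fun t => (V t).v f x) t

/-- Smoothness of the values of a family of vector fields on a family of functions. -/
theorem IsSmoothLieFamily.continuous_apply {W : ℝ → LieGc d n M} (hW : IsSmoothLieFamily W)
    {f : ℝ → Smooth d M} (hf : IsSmoothFunFamily f) (x : M) :
    Continuous (fun t => (W t).v (f t) x) := by
  let e := chartAt (EuclideanSpace ℝ (Fin d)) x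
  have he : e ∈ IsManifold.maximalAtlas (𝓡 d) ∞ M := IsManifold.chart_mem_maximalAtlas x
  have hx : x ∈ e.source := mem_chart_source _ x
  obtain ⟨c, hc⟩ := exists_coordinates he hx
  -- Both the vector field and the function depend on `t`. In coordinates the two dependences
  -- separate into a finite sum of products of continuous functions.
  have h1 : (fun t => (W t).v (f t) x) =
      fun t => ∑ j, coordDeriv e j (f t) x * (W t).v (c j) x :=
    funext fun t => derivation_apply_eq_sum _ he hx hc _
  rw [h1]
  refine continuous_finsetSum _ fun j _ => Continuous.mul ?_ ?_
  · rw [continuous_iff_continuousAt]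
    intro t
    have h2 := (contMDiffAt_coordDeriv he hx (f := fun q => f q) (q := t) hf.contMDiffAt j).continuousAt
    exact ContinuousAt.comp (f := fun t => (t, x)) (x := t) h2 (by fun_prop)
  · exact (contMDiff_slice (f := fun t x => (W t).v (c j) x) (hW.v (c j)) x).continuous

end TangentFamilies

/-! ### The derivative of the adjoint action is the bracket -/

section Conjugation

variable {d n : ℕ} {M : Type*} [TopologicalSpace M] [ChartedSpace (EuclideanSpace ℝ (Fin d)) M]
  [IsManifold (𝓡 d) ∞ M] [T2Space M]

/-- The linear part `η ↦ η a + v^μ ∂_μ η` of the action of `X`. -/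
def LieGc.linApply (X : LieGc d n M) (η : Conf d n M) (j : Fin n) (x : M) : ℝ :=
  ∑ i, η i x * X.a i j x + X.v (η j) x

theorem LieGc.act_eq_linApply (X : LieGc d n M) (η : Conf d n M) (j : Fin n) (x : M) :
    X.act η j x = X.linApply η j x + X.p j x := X.act_apply η j x

theorem LieGc.linApply_add_smul (X : LieGc d n M) (η η' : Conf d n M) (t : ℝ) (j : Fin n) (x : M) :
    X.linApply (η + t • η') j x = X.linApply η j x + t * X.linApply η' j x := by
  simp only [LieGc.linApply]
  have h1 : X.v ((η + t • η') j) x = X.v (η j) x + t * X.v (η' j) x := by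
    rw [Pi.add_apply, Pi.smul_apply, map_add, Derivation.map_smul]
    rfl
  have h2 : ∀ i, (η + t • η') i x * X.a i j x = η i x * X.a i j x + t * (η' i x * X.a i j x) :=
    fun i => by
      change (η i x + t * η' i x) * X.a i j x = _
      ring
  rw [h1]
  simp only [h2, Finset.sum_add_distrib, ← Finset.mul_sum]
  ring

theorem LieGc.add_smul_act (X W : LieGc d n M) (η : Conf d n M) (t : ℝ) (j : Fin n) (x : M) :
    (X + t • W).act η j x = X.act η j x + t * W.act η j x := by
  rw [LieGc.act_apply, LieGc.act_apply, LieGc.act_apply]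
  have h1 : ∀ i, η i x * (X + t • W).a i j x = η i x * X.a i j x + t * (η i x * W.a i j x) :=
    fun i => by
      change η i x * (X.a i j x + t * W.a i j x) = _
      ring
  simp only [h1, Finset.sum_add_distrib, ← Finset.mul_sum]
  change _ + (X.v (η j) x + t * W.v (η j) x) + (X.p j x + t * W.p j x) = _
  ring

theorem IsSmoothLieFamily.continuous_linApply {W : ℝ → LieGc d n M} (hW : IsSmoothLieFamily W)
    {η : ℝ → Conf d n M} (hη : IsSmoothConfFamily η) (j : Fin n) (x : M) :
    Continuous (fun t => (W t).linApply (η t) j x) := by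
  refine Continuous.add (continuous_finsetSum _ fun i _ => Continuous.mul ?_ ?_)
    (hW.continuous_apply (f := fun t => η t j) (hη j) x)
  · exact (contMDiff_slice (f := fun t x => η t i x) (hη i) x).continuous
  · exact (contMDiff_slice (f := fun t x => (W t).a i j x) (hW.a i j) x).continuous

theorem IsSmoothLieFamily.continuous_act {W : ℝ → LieGc d n M} (hW : IsSmoothLieFamily W)
    {η : ℝ → Conf d n M} (hη : IsSmoothConfFamily η) (j : Fin n) (x : M) :
    Continuous (fun t => (W t).act (η t) j x) := by
  simp only [LieGc.act_eq_linApply]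
  exact (hW.continuous_linApply hη j x).add
    (contMDiff_slice (f := fun t x => (W t).p j x) (hW.p j) x).continuous

variable {g h : ℝ → Gc d n M} {X Y : LieGc d n M} {W : ℝ → LieGc d n M}

/-- The conjugate acts on `h_t φ` as `g_s` acts on `φ`, followed by `h_t`. The `s`-derivative gives
`(X + t W_t)(h_t φ)` as the linear part of `h_t` applied to `φX`; comparing the `t`-derivatives at
`0` gives the commutator of the affine actions. -/
theorem conj_act_eq (hh : IsSmoothSymFamily h) (hY : IsTangent h Y) (hX : IsTangent g X)
    (hW : IsSmoothLieFamily W)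
    (hH : ∀ t, IsTangent (fun s => (h t)⁻¹ * g s * h t) (X + t • W t)) (φ : Conf d n M)
    (j : Fin n) (x : M) :
    (W 0).act φ j x = Y.linApply (X.act φ) j x - X.linApply (Y.act φ) j x := by
  have h1 : ∀ t, (X + t • W t).act ((h t).act φ) j x =
      (h t).act (X.act φ) j x - (h t).ψ j x := fun t => by
    refine ((hH t).hasDerivAt_act ((h t).act φ) j x).unique ?_
    have h2 : (fun s => ((h t)⁻¹ * g s * h t).act ((h t).act φ) j x) =
        fun s => ∑ i, (g s).act φ i ((h t).ρ x) * (h t).A.val i j x + (h t).ψ j x := by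
      funext s
      rw [← Gc.act_mul, ← mul_assoc, ← mul_assoc, mul_inv_cancel, one_mul, Gc.act_mul,
        Gc.act_apply (h t)]
    rw [h2, Gc.act_apply, add_sub_cancel_right]
    exact (HasDerivAt.fun_sum fun i _ =>
      (hX.hasDerivAt_act φ i ((h t).ρ x)).mul_const _).add_const _
  have hφ : IsSmoothConfFamily (fun t => (h t).act φ) := hh.act (isSmoothConfFamily_const φ)
  have h3 : HasDerivAt (fun t => (h t).act (X.act φ) j x - (h t).ψ j x)
      (Y.act (X.act φ) j x - Y.p j x) 0 :=
    (hY.hasDerivAt_act (X.act φ) j x).sub ((hY.2 x).2.1 j)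
  -- Inserting `h_t φ = φ + t D_t` exhibits the left-hand side as `a + t c(t)` with `c` continuous,
  -- so no differentiability of `W` is needed.
  have h4 : ∀ t, (X + t • W t).act ((h t).act φ) j x = X.act φ j x +
      t * (X.linApply (dslopeConf hφ t) j x + (W t).act ((h t).act φ) j x) := fun t => by
    have e : (h t).act φ = φ + t • dslopeConf hφ t := by
      have e' := eq_add_smul_dslopeConf hφ t
      simpa only [hY.1, Gc.one_act] using e'
    have hlin : X.linApply ((h t).act φ) j x =
        X.linApply φ j x + t * X.linApply (dslopeConf hφ t) j x := by
      rw [e, LieGc.linApply_add_smul]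
    rw [LieGc.add_smul_act, LieGc.act_eq_linApply X ((h t).act φ), hlin,
      LieGc.act_eq_linApply X φ]
    ring
  have h5 := hasDerivAt_add_mul (a := X.act φ j x) (c := fun t =>
    X.linApply (dslopeConf hφ t) j x + (W t).act ((h t).act φ) j x)
    (((isSmoothLieFamily_const X).continuous_linApply (isSmoothConfFamily_dslopeConf hφ) j x).add
      (hW.continuous_act hφ j x)).continuousAt
  simp only [← h4, h1] at h5
  have h6 := h5.unique h3
  have h7 : dslopeConf hφ 0 = Y.act φ := funext fun i => ContMDiffMap.ext fun x => by
    change dslope (fun s => (h s).act φ i x) 0 0 = _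
    rw [dslope_same, (hY.hasDerivAt_act φ i x).deriv]
  rw [h7, hY.1, Gc.one_act, LieGc.act_eq_linApply Y] at h6
  linarith

/-- The same comparison for scalar functions, with `f ∘ ρ_{h_t}` in place of `h_t φ`. It is separate
because the vector field is prescribed on scalar functions and could not be read off for `n = 0`. -/
theorem conj_v_eq (hh : IsSmoothSymFamily h) (hY : IsTangent h Y) (hX : IsTangent g X)
    (hW : IsSmoothLieFamily W)
    (hH : ∀ t, IsTangent (fun s => (h t)⁻¹ * g s * h t) (X + t • W t)) (f : Smooth d M) (x : M) :
    (W 0).v f x = Y.v (X.v f) x - X.v (Y.v f) x := by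
  let F : ℝ → Smooth d M := fun t => pull (h t).ρ f
  have hF : IsSmoothFunFamily F := f.contMDiff.comp hh.components.1
  have hF0 : F 0 = f := by
    change pull (h 0).ρ f = f
    rw [hY.1]
    rfl
  have h1 : ∀ t, (X + t • W t).v (F t) x = X.v f ((h t).ρ x) := fun t => by
    refine (((hH t).2 x).2.2 (F t)).unique ?_
    refine ((hX.2 ((h t).ρ x)).2.2 f).congr_of_eventuallyEq (Filter.Eventually.of_forall fun s => ?_)
    change f ((h t * ((h t)⁻¹ * g s * h t)).ρ x) = f ((g s * h t).ρ x)
    rw [← mul_assoc, ← mul_assoc, mul_inv_cancel, one_mul]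
  have h3 := (hY.2 x).2.2 (X.v f)
  have h4 : ∀ t, (X + t • W t).v (F t) x = X.v f x +
      t * (X.v (dslopeFun hF t) x + (W t).v (F t) x) := fun t => by
    have h5 : X.v (F t) x = X.v f x + t * X.v (dslopeFun hF t) x := by
      conv_lhs => rw [eq_add_smul_dslopeFun hF t, hF0, map_add, Derivation.map_smul]
      rfl
    change X.v (F t) x + t * (W t).v (F t) x = _
    rw [h5]
    ring
  have h5 := hasDerivAt_add_mul (a := X.v f x) (c := fun t =>
    X.v (dslopeFun hF t) x + (W t).v (F t) x)
    (((isSmoothLieFamily_const X).continuous_apply (isSmoothFunFamily_dslopeFun hF) x).add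
      (hW.continuous_apply hF x)).continuousAt
  simp only [← h4, h1] at h5
  have h6 := h5.unique h3
  have h7 : dslopeFun hF 0 = Y.v f := ContMDiffMap.ext fun x => by
    change dslope (fun s => f ((h s).ρ x)) 0 0 = _
    rw [dslope_same, ((hY.2 x).2.2 f).deriv]
  rw [h7, hF0] at h6
  linarith

/-- The derivative of the adjoint action is the Lie bracket. -/
theorem exists_isTangent_conj (hg : IsSmoothSymFamily g) (hX : IsTangent g X)
    (hh : IsSmoothSymFamily h) (hY : IsTangent h Y) :
    ∃ W : ℝ → LieGc d n M, IsSmoothLieFamily W ∧ W 0 = ⁅X, Y⁆ ∧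
      ∀ t, IsTangent (fun s => (h t)⁻¹ * g s * h t) (X + t • W t) := by
  have hG : IsSmoothSymFamily (fun q : ℝ × ℝ => (h q.2)⁻¹ * g q.1 * h q.2) :=
    ((hh.inv.comp contDiff_snd).mul (hg.comp contDiff_fst)).mul (hh.comp contDiff_snd)
  obtain ⟨V, hV, hVt⟩ := exists_tangentFamily hG (fun t => by simp [hX.1])
  have hV0 : V 0 = X := by
    have h1 := hVt 0
    simp only [hY.1, inv_one, one_mul, mul_one] at h1
    exact LieGc.ext_apply (fun i j x => ((h1.2 x).1 i j).unique ((hX.2 x).1 i j))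
      (fun i x => ((h1.2 x).2.1 i).unique ((hX.2 x).2.1 i))
      (fun f x => ((h1.2 x).2.2 f).unique ((hX.2 x).2.2 f))
  obtain ⟨W, hW, hVW⟩ := exists_eq_add_smul hV
  rw [hV0] at hVW
  have hWt : ∀ t, IsTangent (fun s => (h t)⁻¹ * g s * h t) (X + t • W t) := fun t => by
    rw [← hVW]
    exact hVt t
  refine ⟨W, hW, ?_, hWt⟩
  have hv := conj_v_eq hh hY hX hW hWt
  have hact := conj_act_eq hh hY hX hW hWt
  -- At `φ = 0` the action reduces to its translation part.
  have hp : ∀ j x, (W 0).p j x = Y.linApply X.p j x - X.linApply Y.p j x := fun j x => by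
    have h0 : ∀ Z : LieGc d n M, Z.act 0 = Z.p := fun Z => by
      funext j
      refine ContMDiffMap.ext fun x => ?_
      rw [LieGc.act_apply]
      have h2 : Z.v ((0 : Conf d n M) j) x = 0 := by
        rw [Pi.zero_apply, map_zero]
        rfl
      rw [h2]
      change ∑ i, (0 : ℝ) * Z.a i j x + 0 + Z.p j x = _
      simp
    have h1 := hact 0 j x
    rwa [h0, h0, h0] at h1
  refine LieGc.ext_apply (fun i j x => ?_) (fun j x => ?_) fun f x => ?_
  -- On a constant unit configuration the vector field contributes nothing, so the action is the
  -- `i`-th row of the matrix plus the translation part, already known from `hp`.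
  · have h0 : ∀ Z : LieGc d n M, Z.act (Pi.single i 1) = Z.a i + Z.p := fun Z => by
      funext j
      refine ContMDiffMap.ext fun x => ?_
      rw [LieGc.act_apply]
      have h2 : Z.v ((Pi.single i 1 : Conf d n M) j) x = 0 := by
        by_cases hij : j = i
        · subst hij
          rw [Pi.single_eq_same, Derivation.map_one_eq_zero]
          rfl
        · rw [Pi.single_eq_of_ne hij, map_zero]
          rfl
      have h3 : ∀ k, (Pi.single i 1 : Conf d n M) k x * Z.a k j x =
          if k = i then Z.a i j x else 0 := fun k => by
        by_cases hij : k = i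
        · subst hij
          rw [Pi.single_eq_same, if_pos rfl]
          exact one_mul _
        · rw [Pi.single_eq_of_ne hij, if_neg hij]
          exact zero_mul _
      rw [h2]
      simp only [h3, Finset.sum_ite_eq', Finset.mem_univ, if_true, add_zero]
      rfl
    have h1 := hact (Pi.single i 1) j x
    rw [h0, h0, h0] at h1
    have h4 := hp j x
    have h5 : ∀ (Z : LieGc d n M) (η η' : Conf d n M), Z.linApply (η + η') j x =
        Z.linApply η j x + Z.linApply η' j x := fun Z η η' => by
      have := Z.linApply_add_smul η η' 1 j x
      rwa [one_smul, one_mul] at this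
    rw [h5, h5] at h1
    change (W 0).a i j x + (W 0).p j x = _ at h1
    have h6 : (W 0).a i j x = Y.linApply (X.a i) j x - X.linApply (Y.a i) j x := by linarith
    rw [h6]
    change _ = (X.a * Y.a) i j x - (Y.a * X.a) i j x + Y.v (X.a i j) x - X.v (Y.a i j) x
    rw [Gc.matMul_apply, Gc.matMul_apply]
    simp only [LieGc.linApply]
    ring
  · rw [hp]
    change _ = (X.p ᵥ* Y.a) j x - (Y.p ᵥ* X.a) j x + Y.v (X.p j) x - X.v (Y.p j) x
    rw [Gc.vecMul_apply, Gc.vecMul_apply]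
    simp only [LieGc.linApply]
    ring
  · rw [hv]
    change _ = (⁅Y.v, X.v⁆ : Derivation ℝ (Smooth d M) (Smooth d M)) f x
    rw [Derivation.commutator_apply]
    rfl

end Conjugation

/-! ### Formal series and smoothness of the infinitesimal anomaly -/

section Series

variable {d n : ℕ} {M : Type*} [TopologicalSpace M] [ChartedSpace (EuclideanSpace ℝ (Fin d)) M]
  [IsManifold (𝓡 d) ∞ M] [T2Space M] [SecondCountableTopology M]
  [MeasurableSpace M] [BorelSpace M] {S : Spacetime d M}

theorem reduced_smul (c : ℝ) (F : Functional d n M) : reduced (c • F) = c • reduced F :=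
  funext fun φ => (mul_sub c (F φ) (F 0)).symm

theorem reduced_add (F G : Functional d n M) : reduced (F + G) = reduced F + reduced G :=
  funext fun φ => add_sub_add_comm (F φ) (G φ) (F 0) (G 0)

theorem reduced_sum {ι : Type*} (t : Finset ι) (F : ι → Functional d n M) :
    reduced (∑ i ∈ t, F i) = ∑ i ∈ t, reduced (F i) := by
  funext φ
  simp [reduced, Finset.sum_apply, Finset.sum_sub_distrib]

/-- Brings mixed powers into the form of products over `Fin`, in which the smoothness of `ζ` is
formulated. -/
theorem prod_ite_lt (A B : Functional d n M) (a b : ℕ) :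
    ∏ i : Fin (a + b), (if (i : ℕ) < a then A else B) = A ^ a * B ^ b := by
  rw [Fin.prod_univ_add]
  simp

theorem reduced_pow_mul_pow_mem {F G : Functional d n M} (hF : F ∈ Floc n S) (hG : G ∈ Floc n S)
    {a b k : ℕ} (h : a + b = k) : reduced F ^ a * reduced G ^ b ∈ Fnloc n S k := by
  subst h
  rw [← prod_ite_lt]
  refine prod_mem_Fnloc S (fun i => ?_) fun i => ?_
  · split_ifs
    exacts [reduced_mem_Floc S hF, reduced_mem_Floc S hG]
  · split_ifs <;> exact sub_self _

theorem reduced_pow_mul_mem {F G : Functional d n M} (hF : F ∈ Floc n S) (hG : G ∈ Floc n S)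
    (a : ℕ) : reduced F ^ a * reduced G ∈ Fnloc n S (a + 1) := by
  simpa using reduced_pow_mul_pow_mem hF hG (rfl : a + 1 = a + 1)

namespace FormalSeries

theorem app_of_mem (z : FormalSeries n S) {k : ℕ} {G : Functional d n M} (h : G ∈ Fnloc n S k) :
    z.app k G = z k ⟨G, h⟩ := dif_pos h

theorem app_mem_Floc (z : FormalSeries n S) (k : ℕ) (G : Functional d n M) :
    z.app k G ∈ Floc n S := by
  rw [app]
  split_ifs
  exacts [Subtype.property _, zero_mem _]

theorem comp_mem_Floc (z : FormalSeries n S) (k : ℕ) (F : Functional d n M) :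
    z.comp k F ∈ Floc n S := Submodule.smul_mem _ _ (z.app_mem_Floc k _)

theorem app_smul (z : FormalSeries n S) {k : ℕ} {G : Functional d n M} (h : G ∈ Fnloc n S k)
    (c : ℝ) : z.app k (c • G) = c • z.app k G := by
  rw [z.app_of_mem h, z.app_of_mem (Submodule.smul_mem _ c h)]
  exact congrArg Subtype.val ((z k).map_smul c ⟨G, h⟩)

theorem app_sum (z : FormalSeries n S) {k : ℕ} {ι : Type*} (t : Finset ι)
    {G : ι → Functional d n M} (h : ∀ i ∈ t, G i ∈ Fnloc n S k) :
    z.app k (∑ i ∈ t, G i) = ∑ i ∈ t, z.app k (G i) := by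
  classical
  induction t using Finset.induction_on with
  | empty =>
    rw [Finset.sum_empty, Finset.sum_empty, z.app_of_mem (zero_mem _)]
    exact congrArg Subtype.val (z k).map_zero
  | insert a t ha ih =>
    have h1 := h a (Finset.mem_insert_self a t)
    have h2 : ∀ i ∈ t, G i ∈ Fnloc n S k := fun i hi => h i (Finset.mem_insert_of_mem hi)
    have h3 : ∑ i ∈ t, G i ∈ Fnloc n S k := Submodule.sum_mem _ h2
    rw [Finset.sum_insert ha, Finset.sum_insert ha, ← ih h2, z.app_of_mem h1, z.app_of_mem h3,
      z.app_of_mem (add_mem h1 h3)]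
    exact congrArg Subtype.val ((z k).map_add ⟨_, h1⟩ ⟨_, h3⟩)

/-- Homogeneity turns the order in `F` into a power of the expansion parameter, so identities order
by order become comparisons of Taylor coefficients. -/
theorem comp_smul (z : FormalSeries n S) {F : Functional d n M} (hF : F ∈ Floc n S) (c : ℝ)
    (k : ℕ) : z.comp k (c • F) = c ^ k • z.comp k F := by
  rw [comp, comp, reduced_smul, smul_pow, z.app_smul (reduced_pow_mem_Fnloc S hF k), smul_comm]

theorem comp_of_eq_zero {z : FormalSeries n S} (hz : z = 0) (k : ℕ) (F : Functional d n M) :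
    z.comp k F = 0 := by
  rw [comp, app, hz]
  split_ifs <;> exact smul_zero _

end FormalSeries

variable {ζ : Gc d n M → Rc n S} {Δ : LieGc d n M → LieRc n S}
variable {P : Type} [NormedAddCommGroup P] [NormedSpace ℝ P] [FiniteDimensional ℝ P]

theorem IsSmoothAnomaly.isLocalFamily_app (hs : IsSmoothAnomaly ζ) {g : P → Gc d n M}
    (hg : IsSmoothSymFamily g) {F G : P → Functional d n M} (hF : IsLocalFamily S F)
    (hG : IsLocalFamily S G) {a b k : ℕ} (h : a + b = k) :
    IsLocalFamily S (fun s => (ζ (g s)).pert.app k (reduced (F s) ^ a * reduced (G s) ^ b)) := by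
  subst h
  simp only [← prod_ite_lt]
  refine hs P g hg (a + b)
    (fun i s => if (i : ℕ) < a then reduced (F s) else reduced (G s)) (fun i => ?_) fun i s => ?_
  · by_cases hi : (i : ℕ) < a
    · simpa only [hi, if_true] using hF.reduced
    · simpa only [hi, if_false] using hG.reduced
  · split_ifs <;> exact sub_self _

theorem IsSmoothAnomaly.isLocalFamily_comp (hs : IsSmoothAnomaly ζ) {g : P → Gc d n M}
    (hg : IsSmoothSymFamily g) {F : P → Functional d n M} (hF : IsLocalFamily S F) (k : ℕ) :
    IsLocalFamily S (fun s => (ζ (g s)).pert.comp k (F s)) := by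
  have h := hs.isLocalFamily_app hg hF hF (add_zero k)
  simp only [pow_zero, mul_one] at h
  exact h.smul contDiff_const

theorem IsLocalFamily.contDiff_eval_diag {F : P → Functional d n M} (hF : IsLocalFamily S F)
    {φ : P → Conf d n M} (hφ : IsSmoothConfFamily φ) : ContDiff ℝ ∞ (fun p => F p (φ p)) :=
  (hF.contDiff_eval hφ).comp (contDiff_id.prodMk contDiff_id)

/-- No smoothness of `Δ` is assumed. It is inherited from `ζ`: the values are `s`-derivatives at `0`
of functions that are jointly smooth in `s` and `p`. -/
theorem contDiff_infinitesimal_app (hs : IsSmoothAnomaly ζ) (hΔ : IsInfinitesimalAnomaly ζ Δ)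
    {H : ℝ × P → Gc d n M} (hH : IsSmoothSymFamily H) {X : P → LieGc d n M}
    (hX : ∀ p, IsTangent (fun s => H (s, p)) (X p)) {F G : P → Functional d n M}
    (hF : IsLocalFamily S F) (hG : IsLocalFamily S G) {φ : P → Conf d n M}
    (hφ : IsSmoothConfFamily φ) {a b k : ℕ} (h : a + b = k) :
    ContDiff ℝ ∞
      (fun p => (Δ (X p)).series.app k (reduced (F p) ^ a * reduced (G p) ^ b) (φ p)) := by
  have h1 := (hs.isLocalFamily_app hH (hF.comp contDiff_snd) (hG.comp contDiff_snd) h).contDiff_eval_diag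
    (hφ.comp contDiff_snd)
  have h2 := contDiff_deriv_zero (f := fun s p => (ζ (H (s, p))).pert.app k
    (reduced (F p) ^ a * reduced (G p) ^ b) (φ p)) h1
  have hsm : ∀ p : P, ContDiff ℝ ∞ (fun s : ℝ => (s, p)) := fun p =>
    contDiff_id.prodMk contDiff_const
  convert h2 using 2 with p
  exact (hΔ (X p) _ (hH.comp (hsm p)) (hX p) k _
    (reduced_pow_mul_pow_mem (hF.mem_Floc S p) (hG.mem_Floc S p) h) (φ p)).deriv.symm

theorem contDiff_infinitesimal_comp (hs : IsSmoothAnomaly ζ) (hΔ : IsInfinitesimalAnomaly ζ Δ)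
    {H : ℝ × P → Gc d n M} (hH : IsSmoothSymFamily H) {X : P → LieGc d n M}
    (hX : ∀ p, IsTangent (fun s => H (s, p)) (X p)) {F : P → Functional d n M}
    (hF : IsLocalFamily S F) {φ : P → Conf d n M} (hφ : IsSmoothConfFamily φ) (k : ℕ) :
    ContDiff ℝ ∞ (fun p => (Δ (X p)).series.comp k (F p) (φ p)) := by
  have h := contDiff_infinitesimal_app hs hΔ hH hX hF hF hφ (add_zero k)
  simp only [pow_zero, mul_one] at h
  exact contDiff_const.mul h

/-- The derivative of `ζ` along a curve through the unit, the argument and the configuration being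
allowed to vary as well. -/
theorem deriv_comp_of_isTangent (hone : (ζ 1).pert = 0) (hs : IsSmoothAnomaly ζ)
    (hΔ : IsInfinitesimalAnomaly ζ Δ) {g : ℝ → Gc d n M} (hg : IsSmoothSymFamily g)
    {X : LieGc d n M} (hX : IsTangent g X) {F : ℝ → Functional d n M} (hF : IsLocalFamily S F)
    {φ : ℝ → Conf d n M} (hφ : IsSmoothConfFamily φ) (k : ℕ) :
    deriv (fun s => (ζ (g s)).pert.comp k (F s) (φ s)) 0 = (Δ X).series.comp k (F 0) (φ 0) := by
  have h1 : ContDiff ℝ ∞ (fun q : ℝ × ℝ => (ζ (g q.1)).pert.comp k (F q.2) (φ q.2)) :=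
    (hs.isLocalFamily_comp (hg.comp contDiff_fst) (hF.comp contDiff_snd) k).contDiff_eval_diag
      (hφ.comp contDiff_snd)
  rw [deriv_diag (f := fun s t => (ζ (g s)).pert.comp k (F t) (φ t)) h1]
  -- At the unit the perturbation part vanishes identically, so varying the argument and the
  -- configuration does not contribute.
  have h2 : (fun t => (ζ (g 0)).pert.comp k (F t) (φ t)) = fun _ => 0 := by
    funext t
    rw [hX.1, FormalSeries.comp_of_eq_zero hone]
    rfl
  rw [h2, deriv_const, add_zero]
  exact ((hΔ X g hg hX k _ (reduced_pow_mem_Fnloc S (hF.mem_Floc S 0) k) (φ 0)).const_mul _).deriv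

/-- The product rule for `z(V_t)`, `z` an infinitesimal anomaly. -/
theorem hasDerivAt_infinitesimal_comp (hs : IsSmoothAnomaly ζ) (hΔ : IsInfinitesimalAnomaly ζ Δ)
    (X : LieGc d n M) {V : ℝ → Functional d n M} (hV : IsLocalFamily S V) {V' : Functional d n M}
    (hV' : ∀ φ, V' φ = deriv (fun t => V t φ) 0) (i : ℕ) (φ : Conf d n M) :
    HasDerivAt (fun t => (Δ X).series.comp (i + 1) (V t) φ)
      ((i.factorial : ℝ)⁻¹ * (Δ X).series.app (i + 1) (reduced (V 0) ^ i * reduced V') φ) 0 := by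
  obtain ⟨g, hg, hX⟩ := exists_isTangent X
  set z := (Δ X).series
  let D : ℝ → Functional d n M := fun t φ => dslope (fun s => V s φ) 0 t
  have hD : IsLocalFamily S D := hV.dslope
  have hD0 : D 0 = V' := funext fun φ => by
    rw [hV']
    exact dslope_same _ _
  -- With `V_t = V_0 + t D_t` the power expands binomially, and linearity of the coefficient map
  -- `z_(i+1)` extracts the powers of `t`; no continuity of that map is used.
  have hVD : ∀ t, reduced (V t) = t • reduced (D t) + reduced (V 0) := fun t => by
    rw [← reduced_smul, ← reduced_add]
    congr 1
    funext φ
    change V t φ = t * dslope (fun s => V s φ) 0 t + V 0 φ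
    rw [eq_add_mul_dslope (fun s => V s φ) t, add_comm]
  let c : ℕ → ℝ → ℝ := fun m t =>
    z.app (i + 1) (reduced (D t) ^ m * reduced (V 0) ^ (i + 1 - m)) φ
  have hc : ∀ m ≤ i + 1, ContDiff ℝ ∞ (c m) := fun m hm =>
    contDiff_infinitesimal_app hs hΔ (hg.comp contDiff_fst) (X := fun _ : ℝ => X) (fun _ => hX) hD
      (isLocalFamily_const S (hV.mem_Floc S 0)) (isSmoothConfFamily_const φ)
      (Nat.add_sub_cancel' hm)
  have hsum : ∀ t, z.app (i + 1) (reduced (V t) ^ (i + 1)) φ = c 0 0 +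
      t * ∑ m ∈ Finset.range (i + 1), ((i + 1).choose (m + 1) : ℝ) * t ^ m * c (m + 1) t := by
    intro t
    have h1 : reduced (V t) ^ (i + 1) = ∑ m ∈ Finset.range (i + 1 + 1),
        (((i + 1).choose m : ℝ) * t ^ m) • (reduced (D t) ^ m * reduced (V 0) ^ (i + 1 - m)) := by
      rw [hVD, add_pow]
      refine Finset.sum_congr rfl fun m _ => ?_
      rw [smul_pow]
      funext φ
      simp only [Pi.mul_apply, Pi.smul_apply, smul_eq_mul, Pi.pow_apply, Pi.natCast_apply]
      ring
    have hmem : ∀ m ∈ Finset.range (i + 1 + 1),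
        reduced (D t) ^ m * reduced (V 0) ^ (i + 1 - m) ∈ Fnloc n S (i + 1) := fun m hm =>
      reduced_pow_mul_pow_mem (hD.mem_Floc S t) (hV.mem_Floc S 0)
        (Nat.add_sub_cancel' (Nat.lt_succ_iff.1 (Finset.mem_range.1 hm)))
    rw [h1, z.app_sum _ fun m hm => Submodule.smul_mem _ _ (hmem m hm), Finset.sum_apply]
    have h2 : ∀ m ∈ Finset.range (i + 1 + 1), z.app (i + 1) ((((i + 1).choose m : ℝ) * t ^ m) •
        (reduced (D t) ^ m * reduced (V 0) ^ (i + 1 - m))) φ =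
        ((i + 1).choose m : ℝ) * t ^ m * c m t := fun m hm => by
      rw [z.app_smul (hmem m hm)]
      rfl
    rw [Finset.sum_congr rfl h2, Finset.sum_range_succ', add_comm, Finset.mul_sum]
    congr 1
    · simp [c]
    · exact Finset.sum_congr rfl fun m _ => by ring
  have h3 : ContinuousAt (fun t : ℝ => ∑ m ∈ Finset.range (i + 1),
      ((i + 1).choose (m + 1) : ℝ) * t ^ m * c (m + 1) t) 0 :=
    (continuous_finsetSum _ fun m hm => (continuous_const.mul (continuous_pow m)).mul
      (hc (m + 1) (Nat.succ_le_of_lt (Finset.mem_range.1 hm))).continuous).continuousAt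
  have h4 := (hasDerivAt_add_mul (a := c 0 0) h3).const_mul (((i + 1).factorial : ℝ)⁻¹)
  simp only [← hsum] at h4
  refine h4.congr_deriv ?_
  -- At `t = 0` only the term linear in `D` survives; its binomial coefficient `i + 1` turns
  -- `1/(i+1)!` into `1/i!`.
  rw [Finset.sum_range_succ', Finset.sum_eq_zero fun m _ => by simp]
  have h5 : ((i + 1).factorial : ℝ) = (i + 1) * i.factorial := by
    rw [Nat.factorial_succ]
    push_cast
    ring
  have h6 : (i.factorial : ℝ) ≠ 0 := by positivity
  have h7 : ((i : ℝ) + 1) ≠ 0 := by positivity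
  simp only [c, hD0, zero_add, pow_one, pow_zero, mul_one, Nat.choose_one_right,
    Nat.add_sub_cancel, h5, mul_comm (reduced V')]
  push_cast
  field_simp

end Series

/-! ### Mixed derivatives -/

section MixedDerivative

/-- The mixed derivative `∂_t ∂_s f(s, t)` at the origin. -/
def mixedDeriv (f : ℝ → ℝ → ℝ) : ℝ := deriv (fun t => deriv (fun s => f s t) 0) 0

variable {f h : ℝ → ℝ → ℝ}

theorem contDiff_slice_left (hf : ContDiff ℝ ∞ (fun q : ℝ × ℝ => f q.1 q.2)) (t : ℝ) :
    ContDiff ℝ ∞ (fun s => f s t) := hf.comp (contDiff_id.prodMk contDiff_const)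

theorem mixedDeriv_sub (hf : ContDiff ℝ ∞ (fun q : ℝ × ℝ => f q.1 q.2))
    (hh : ContDiff ℝ ∞ (fun q : ℝ × ℝ => h q.1 q.2)) :
    mixedDeriv (fun s t => f s t - h s t) = mixedDeriv f - mixedDeriv h := by
  have h1 : ∀ t, deriv (fun s => f s t - h s t) 0 =
      deriv (fun s => f s t) 0 - deriv (fun s => h s t) 0 := fun t =>
    ((hasDerivAt_of_contDiff (contDiff_slice_left hf t) 0).sub
      (hasDerivAt_of_contDiff (contDiff_slice_left hh t) 0)).deriv
  simp only [mixedDeriv, h1]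
  exact ((hasDerivAt_of_contDiff (contDiff_deriv_zero hf) 0).sub
    (hasDerivAt_of_contDiff (contDiff_deriv_zero hh) 0)).deriv

theorem mixedDeriv_sum {ι : Type*} (I : Finset ι) {f : ι → ℝ → ℝ → ℝ}
    (hf : ∀ i, ContDiff ℝ ∞ (fun q : ℝ × ℝ => f i q.1 q.2)) :
    mixedDeriv (fun s t => ∑ i ∈ I, f i s t) = ∑ i ∈ I, mixedDeriv (f i) := by
  have h1 : ∀ t, deriv (fun s => ∑ i ∈ I, f i s t) 0 = ∑ i ∈ I, deriv (fun s => f i s t) 0 :=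
    fun t => (HasDerivAt.fun_sum fun i _ =>
      hasDerivAt_of_contDiff (contDiff_slice_left (hf i) t) 0).deriv
  simp only [mixedDeriv, h1]
  exact (HasDerivAt.fun_sum fun i _ =>
    hasDerivAt_of_contDiff (contDiff_deriv_zero (hf i)) 0).deriv

theorem mixedDeriv_const_mul (c : ℝ) (f : ℝ → ℝ → ℝ) :
    mixedDeriv (fun s t => c * f s t) = c * mixedDeriv f := by
  simp only [mixedDeriv, deriv_const_mul_field']

theorem mixedDeriv_swap (hf : ContDiff ℝ ∞ (fun q : ℝ × ℝ => f q.1 q.2)) :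
    mixedDeriv (fun s t => f t s) = mixedDeriv f := deriv_deriv_comm hf

end MixedDerivative

/-! ### Comparison of coefficients -/

section Coefficients

open Polynomial in
/-- Comparison of coefficients in an identity up to terms of higher order. -/
theorem coeff_eq_of_isBigO (N k : ℕ) (hk : k < N) (a b : ℕ → ℝ) (c : ℕ → ℕ → ℝ)
    (h : (fun x : ℝ => ∑ i ∈ Finset.range (N + 1), a i * x ^ i -
      ∑ i ∈ Finset.range (N + 1), b i * x ^ i -
      ∑ i ∈ Finset.range N, ∑ l ∈ Finset.range (N + 1), c i l * x ^ (i + l))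
      =O[𝓝 0] fun x => x ^ (k + 1)) :
    a k = b k + ∑ p ∈ Finset.HasAntidiagonal.antidiagonal k, c p.1 p.2 := by
  let p : ℝ[X] := ∑ i ∈ Finset.range (N + 1), C (a i) * X ^ i -
    ∑ i ∈ Finset.range (N + 1), C (b i) * X ^ i -
    ∑ i ∈ Finset.range N, ∑ l ∈ Finset.range (N + 1), C (c i l) * X ^ (i + l)
  have hp := coeff_eq_zero_of_isBigO p k (by
    refine h.congr_left fun x => ?_
    simp [p, eval_finsetSum]) k le_rfl
  have h1 : ∀ a : ℕ → ℝ,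
      (∑ i ∈ Finset.range (N + 1), C (a i) * (X : ℝ[X]) ^ i).coeff k = a k := fun a => by
    simp only [finsetSum_coeff, coeff_C_mul, coeff_X_pow, mul_ite, mul_one, mul_zero]
    rw [Finset.sum_ite_eq, if_pos (Finset.mem_range.2 (by omega))]
  have h2 : (∑ i ∈ Finset.range N, ∑ l ∈ Finset.range (N + 1),
      C (c i l) * (X : ℝ[X]) ^ (i + l)).coeff k =
      ∑ p ∈ Finset.HasAntidiagonal.antidiagonal k, c p.1 p.2 := by
    simp only [finsetSum_coeff, coeff_C_mul, coeff_X_pow, mul_ite, mul_one, mul_zero]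
    -- As `k < N`, every pair with `i + l = k` lies in the ranges of summation, so the truncation
    -- does not cut the antidiagonal.
    rw [← Finset.sum_product', ← Finset.sum_filter]
    refine Finset.sum_congr (Finset.ext fun p => ?_) fun _ _ => rfl
    simp only [Finset.mem_filter, Finset.mem_product, Finset.mem_range,
      Finset.HasAntidiagonal.mem_antidiagonal]
    omega
  rw [coeff_sub, coeff_sub, h1, h1, h2] at hp
  linarith

end Coefficients

/-! ### The product rule for truncated series -/

section WessZumino

variable {d n : ℕ} {M : Type*} [TopologicalSpace M] [ChartedSpace (EuclideanSpace ℝ (Fin d)) M]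
  [IsManifold (𝓡 d) ∞ M] [T2Space M] [SecondCountableTopology M]
  [MeasurableSpace M] [BorelSpace M] {S : Spacetime d M}
  {ζ : Gc d n M → Rc n S} {Δ : LieGc d n M → LieRc n S}

theorem FormalSeries.der_apply (z : FormalSeries n S) (F : Functional d n M)
    (G : ℕ → Functional d n M) (k : ℕ) (φ : Conf d n M) :
    z.der F G k φ = ∑ p ∈ Finset.HasAntidiagonal.antidiagonal k,
      (p.1.factorial : ℝ)⁻¹ * z.app (p.1 + 1) (reduced F ^ p.1 * reduced (G p.2)) φ := by
  rw [FormalSeries.der, Finset.sum_apply]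
  rfl

/-- Elements of the Lie algebra have no term of order `0`. Hence sums over orders up to `N` start at
`1` and are indexed by `i + 1` with `i < N`. -/
theorem LieRc.comp_zero (z : LieRc n S) (F : Functional d n M) : z.series.comp 0 F = 0 := by
  rw [FormalSeries.comp, FormalSeries.app, z.zero]
  split_ifs <;> exact smul_zero _

/-- The product rule for `z(V_t)`, summed up to a finite order, with the expansion of `V` in the
expansion parameter `κ`. -/
theorem hasDerivAt_sum_infinitesimal_comp (hs : IsSmoothAnomaly ζ)
    (hΔ : IsInfinitesimalAnomaly ζ Δ) (X : LieGc d n M) {V : ℝ → Functional d n M}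
    (hV : IsLocalFamily S V) {F : Functional d n M} (hF : F ∈ Floc n S) {κ : ℝ}
    (hV0 : V 0 = κ • F) {N : ℕ} {G : ℕ → Functional d n M} (hG : ∀ l, G l ∈ Floc n S)
    (hVG : ∀ φ, deriv (fun t => V t φ) 0 = ∑ l ∈ Finset.range (N + 1), κ ^ l * G l φ)
    (φ : Conf d n M) :
    HasDerivAt (fun t => ∑ j ∈ Finset.range (N + 1), (Δ X).series.comp j (V t) φ)
      (∑ i ∈ Finset.range N, ∑ l ∈ Finset.range (N + 1), (i.factorial : ℝ)⁻¹ *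
        (Δ X).series.app (i + 1) (reduced F ^ i * reduced (G l)) φ * κ ^ (i + l)) 0 := by
  have hsum : ∀ t, ∑ j ∈ Finset.range (N + 1), (Δ X).series.comp j (V t) φ =
      ∑ i ∈ Finset.range N, (Δ X).series.comp (i + 1) (V t) φ := fun t => by
    rw [Finset.sum_range_succ', LieRc.comp_zero, Pi.zero_apply, add_zero]
  simp only [hsum]
  have hV' : ∀ φ, (∑ l ∈ Finset.range (N + 1), κ ^ l • G l) φ = deriv (fun t => V t φ) 0 :=
    fun φ => by
      rw [hVG, Finset.sum_apply]
      rfl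
  refine (HasDerivAt.fun_sum fun i _ =>
    hasDerivAt_infinitesimal_comp hs hΔ X hV hV' i φ).congr_deriv ?_
  refine Finset.sum_congr rfl fun i _ => ?_
  have h1 : reduced (V 0) ^ i * reduced (∑ l ∈ Finset.range (N + 1), κ ^ l • G l) =
      ∑ l ∈ Finset.range (N + 1), κ ^ (i + l) • (reduced F ^ i * reduced (G l)) := by
    rw [hV0, reduced_smul, reduced_sum, Finset.mul_sum]
    refine Finset.sum_congr rfl fun l _ => ?_
    rw [reduced_smul, smul_pow, smul_mul_smul_comm, pow_add]
  rw [h1, FormalSeries.app_sum _ _ fun l _ =>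
    Submodule.smul_mem _ _ (reduced_pow_mul_mem hF (hG l) i), Finset.sum_apply,
    Finset.mul_sum]
  refine Finset.sum_congr rfl fun l _ => ?_
  rw [FormalSeries.app_smul _ (reduced_pow_mul_mem hF (hG l) i)]
  simp only [Pi.smul_apply, smul_eq_mul]
  ring

end WessZumino

/-! ### First order: linearity of the infinitesimal anomaly -/

section WessZumino

variable {d n : ℕ} {M : Type*} [TopologicalSpace M] [ChartedSpace (EuclideanSpace ℝ (Fin d)) M]
  [IsManifold (𝓡 d) ∞ M] [T2Space M] [SecondCountableTopology M]
  [MeasurableSpace M] [BorelSpace M] {S : Spacetime d M}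
  {ζ : Gc d n M → Rc n S} {Δ : LieGc d n M → LieRc n S}

theorem actL_one (m : ℝ) (F : Functional d n M) : actL S m 1 F = F := by
  funext φ
  simp [actL, deltaL, Gc.one_act]

variable (m : ℝ) (ζ) in
/-- The perturbation part of `h_L⁻¹ ζ_g h_L (F)` up to order `N`. -/
def conjugatedPert (N : ℕ) (g h : Gc d n M) (F : Functional d n M) : Functional d n M :=
  fun φ => ∑ i ∈ Finset.range (N + 1), (ζ g).pert.comp i (actL S m h F) (h⁻¹.act φ)

variable {m : ℝ}

/-- This and `conjugatedPert_of_right` are the values when one factor is the unit. They make the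
defect of the cocycle relation vanish on both parameter axes. -/
theorem conjugatedPert_of_left (hone : (ζ 1).pert = 0) (N : ℕ) (h : Gc d n M)
    (F : Functional d n M) : conjugatedPert ζ m N 1 h F = 0 := by
  funext φ
  simp [conjugatedPert, FormalSeries.comp_of_eq_zero hone]

theorem conjugatedPert_of_right (N : ℕ) (g : Gc d n M) (F : Functional d n M) (φ : Conf d n M) :
    conjugatedPert ζ m N g 1 F φ = ∑ i ∈ Finset.range (N + 1), (ζ g).pert.comp i F φ := by
  simp [conjugatedPert, actL_one, Gc.one_act]

variable {P : Type} [NormedAddCommGroup P] [NormedSpace ℝ P] [FiniteDimensional ℝ P]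

theorem IsSmoothAnomaly.isLocalFamily_conjugatedPert (hs : IsSmoothAnomaly ζ) (m : ℝ) (N : ℕ)
    {g h : P → Gc d n M} (hg : IsSmoothSymFamily g) (hh : IsSmoothSymFamily h)
    {F : P → Functional d n M} (hF : IsLocalFamily S F) :
    IsLocalFamily S (fun p => conjugatedPert ζ m N (g p) (h p) (F p)) := by
  have h1 := (IsLocalFamily.sum (Finset.range (N + 1)) fun i _ =>
    hs.isLocalFamily_comp hg (IsLocalFamily.actL S m hh hF) i).act S hh.inv
  convert h1 using 3
  simp [conjugatedPert, Finset.sum_apply]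

/-- The cocycle relation after cancelling `κF` on both sides: by affinity of the action the inner
expression is `κF + U`. -/
theorem IsCocycle.isBigO (hc : IsCocycle m ζ) {g h : P → Gc d n M} (hg : IsSmoothSymFamily g)
    (hh : IsSmoothSymFamily h) (h0 : h 0 = 1) {F : Functional d n M} (hF : F ∈ Floc n S)
    (φ : Conf d n M) (N : ℕ) :
    (fun q : P × ℝ =>
      ∑ i ∈ Finset.range (N + 1), (ζ (g q.1 * h q.1)).pert.comp i (q.2 • F) φ -
      conjugatedPert ζ m N (g q.1) (h q.1) (q.2 • F) φ -
      ∑ i ∈ Finset.range (N + 1), (ζ (h q.1)).pert.comp i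
        (q.2 • F + conjugatedPert ζ m N (g q.1) (h q.1) (q.2 • F)) φ)
      =O[𝓝 0] (fun q => ‖q‖ ^ (N + 1)) := by
  refine (hc P g h hg hh h0 F hF φ N).congr_left fun q => ?_
  have h1 : actL S m (h q.1)⁻¹ ((ζ (g q.1)).partialSum N (actL S m (h q.1) (q.2 • F))) =
      q.2 • F + conjugatedPert ζ m N (g q.1) (h q.1) (q.2 • F) := by
    funext φ
    rw [Rc.partialSum, actL_inv_actL_add, Finset.sum_apply]
    rfl
  rw [h1]
  simp only [Rc.partialSum, Pi.add_apply, Finset.sum_apply]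
  ring

theorem IsLocalFamily.smul_const {F : Functional d n M} (hF : F ∈ Floc n S) {c : P → ℝ}
    (hc : ContDiff ℝ ∞ c) : IsLocalFamily S (fun p => c p • F) :=
  (isLocalFamily_const S hF).smul hc

/-- Smoothness of the truncated defect, without which its order of vanishing would say nothing about
its derivatives. -/
theorem contDiff_cocycle (hs : IsSmoothAnomaly ζ) {g h : P → Gc d n M}
    (hg : IsSmoothSymFamily g) (hh : IsSmoothSymFamily h) {F : P → Functional d n M}
    (hF : IsLocalFamily S F) (φ : Conf d n M) (N : ℕ) :
    ContDiff ℝ ∞ (fun p => ∑ i ∈ Finset.range (N + 1), (ζ (g p * h p)).pert.comp i (F p) φ -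
      conjugatedPert ζ m N (g p) (h p) (F p) φ -
      ∑ i ∈ Finset.range (N + 1), (ζ (h p)).pert.comp i
        (F p + conjugatedPert ζ m N (g p) (h p) (F p)) φ) := by
  have hU := hs.isLocalFamily_conjugatedPert m N hg hh hF
  exact ((ContDiff.sum fun i _ => (hs.isLocalFamily_comp (hg.mul hh) hF i).contDiff_apply φ).sub
    (hU.contDiff_apply φ)).sub
    (ContDiff.sum fun i _ => (hs.isLocalFamily_comp hh (hF.add hU) i).contDiff_apply φ)

theorem deriv_sum_comp_of_isTangent (hone : (ζ 1).pert = 0) (hs : IsSmoothAnomaly ζ)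
    (hΔ : IsInfinitesimalAnomaly ζ Δ) {g : ℝ → Gc d n M} (hg : IsSmoothSymFamily g)
    {X : LieGc d n M} (hX : IsTangent g X) {F : ℝ → Functional d n M} (hF : IsLocalFamily S F)
    {φ : ℝ → Conf d n M} (hφ : IsSmoothConfFamily φ) (N : ℕ) :
    deriv (fun s => ∑ i ∈ Finset.range (N + 1), (ζ (g s)).pert.comp i (F s) (φ s)) 0 =
      ∑ i ∈ Finset.range (N + 1), (Δ X).series.comp i (F 0) (φ 0) := by
  simp only [← deriv_comp_of_isTangent hone hs hΔ hg hX hF hφ]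
  exact (HasDerivAt.fun_sum fun i _ => hasDerivAt_of_contDiff
    ((hs.isLocalFamily_comp hg hF i).contDiff_eval_diag hφ) 0).deriv

/-- The curve `h` enters only through its value at `0`, since `ζ_e` has no perturbation part. -/
theorem deriv_conjugatedPert (hone : (ζ 1).pert = 0) (hs : IsSmoothAnomaly ζ)
    (hΔ : IsInfinitesimalAnomaly ζ Δ) {g h : ℝ → Gc d n M} (hg : IsSmoothSymFamily g)
    {X : LieGc d n M} (hX : IsTangent g X) (hh : IsSmoothSymFamily h) {F : Functional d n M}
    (hF : F ∈ Floc n S) (N : ℕ) (φ : Conf d n M) :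
    deriv (fun s => conjugatedPert ζ m N (g s) (h s) F φ) 0 =
      ∑ i ∈ Finset.range (N + 1), (Δ X).series.comp i (actL S m (h 0) F) ((h 0)⁻¹.act φ) :=
  deriv_sum_comp_of_isTangent hone hs hΔ hg hX
    (IsLocalFamily.actL S m hh (isLocalFamily_const S hF)) (hh.inv.act (isSmoothConfFamily_const φ)) N

theorem FormalSeries.sum_comp_smul (z : FormalSeries n S) {F : Functional d n M}
    (hF : F ∈ Floc n S) (c : ℝ) (N : ℕ) (φ : Conf d n M) :
    ∑ i ∈ Finset.range (N + 1), z.comp i (c • F) φ =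
      ∑ i ∈ Finset.range (N + 1), z.comp i F φ * c ^ i :=
  Finset.sum_congr rfl fun i _ => by
    rw [z.comp_smul hF, mul_comm]
    rfl

/-- The derivative of the cocycle relation along `g_s h_s`, whose tangent vector is `X + Y`. To
first order neither the action of `h` nor the inner shift `U` contributes, as both meet a factor
that vanishes at `s = 0`. -/
theorem infinitesimal_add (hone : (ζ 1).pert = 0) (hs : IsSmoothAnomaly ζ) (hc : IsCocycle m ζ)
    (hΔ : IsInfinitesimalAnomaly ζ Δ) (X Y : LieGc d n M) {F : Functional d n M}
    (hF : F ∈ Floc n S) (k : ℕ) :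
    (Δ (X + Y)).series.comp k F = (Δ X).series.comp k F + (Δ Y).series.comp k F := by
  obtain ⟨g, hg, hX⟩ := exists_isTangent X
  obtain ⟨h, hh, hY⟩ := exists_isTangent Y
  funext φ
  set N := 2 * k + 1 with hN
  have hs1 : ContDiff ℝ ∞ (fun q : ℝ × ℝ => q.1) := contDiff_fst
  have h1 := contDiff_cocycle (m := m) hs (hg.comp hs1) (hh.comp hs1)
    (IsLocalFamily.smul_const hF (contDiff_snd (E := ℝ) (F := ℝ))) φ N
  have h2 := isBigO_deriv_of_isBigO (f := fun s x =>
      ∑ i ∈ Finset.range (N + 1), (ζ (g s * h s)).pert.comp i (x • F) φ -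
      conjugatedPert ζ m N (g s) (h s) (x • F) φ -
      ∑ i ∈ Finset.range (N + 1), (ζ (h s)).pert.comp i
        (x • F + conjugatedPert ζ m N (g s) (h s) (x • F)) φ) h1
    (fun x => by
      simp only [hX.1, hY.1, mul_one, conjugatedPert_of_left hone,
        FormalSeries.comp_of_eq_zero hone]
      simp) k (N + 1) (by omega) (hc.isBigO hg hh hY.1 hF φ N)
  have h3 : ∀ x : ℝ, deriv (fun s =>
      ∑ i ∈ Finset.range (N + 1), (ζ (g s * h s)).pert.comp i (x • F) φ -
      conjugatedPert ζ m N (g s) (h s) (x • F) φ -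
      ∑ i ∈ Finset.range (N + 1), (ζ (h s)).pert.comp i
        (x • F + conjugatedPert ζ m N (g s) (h s) (x • F)) φ) 0 =
      ∑ i ∈ Finset.range (N + 1), (Δ (X + Y)).series.comp i F φ * x ^ i -
      ∑ i ∈ Finset.range (N + 1), ((Δ X).series.comp i F φ + (Δ Y).series.comp i F φ) * x ^ i -
      ∑ i ∈ Finset.range N, ∑ l ∈ Finset.range (N + 1), 0 * x ^ (i + l) := fun x => by
    have hxF : IsLocalFamily S (fun _ : ℝ => x • F) :=
      isLocalFamily_const S (Submodule.smul_mem _ x hF)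
    have hU := hs.isLocalFamily_conjugatedPert m N hg hh hxF
    have e1 := deriv_sum_comp_of_isTangent hone hs hΔ (hg.mul hh) (hX.mul hY hg hh) hxF
      (isSmoothConfFamily_const φ) N
    have e2 := deriv_conjugatedPert (m := m) hone hs hΔ hg hX hh
      (Submodule.smul_mem _ x hF) N φ
    have e3 := deriv_sum_comp_of_isTangent hone hs hΔ hh hY (hxF.add hU)
      (isSmoothConfFamily_const φ) N
    have d1 : ContDiff ℝ ∞ (fun s => ∑ i ∈ Finset.range (N + 1),
        (ζ (g s * h s)).pert.comp i (x • F) φ) :=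
      ContDiff.sum fun i _ => (hs.isLocalFamily_comp (hg.mul hh) hxF i).contDiff_apply φ
    have d3 : ContDiff ℝ ∞ (fun s => ∑ i ∈ Finset.range (N + 1), (ζ (h s)).pert.comp i
        (x • F + conjugatedPert ζ m N (g s) (h s) (x • F)) φ) :=
      ContDiff.sum fun i _ => (hs.isLocalFamily_comp hh (hxF.add hU) i).contDiff_apply φ
    rw [(((hasDerivAt_of_contDiff d1 0).fun_sub
      (hasDerivAt_of_contDiff (hU.contDiff_apply φ) 0)).fun_sub
      (hasDerivAt_of_contDiff d3 0)).deriv, e1, e2, e3]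
    simp only [hX.1, hY.1, conjugatedPert_of_left hone, actL_one, inv_one, Gc.one_act, add_zero,
      FormalSeries.sum_comp_smul _ hF, add_mul, Finset.sum_add_distrib, zero_mul,
      Finset.sum_const_zero]
    ring
  simp only [h3] at h2
  have h4 := coeff_eq_of_isBigO N k (by omega) (fun i => (Δ (X + Y)).series.comp i F φ)
    (fun i => (Δ X).series.comp i F φ + (Δ Y).series.comp i F φ) (fun _ _ => 0) h2
  simpa using h4

theorem infinitesimal_smul (hΔ : IsInfinitesimalAnomaly ζ Δ) (c : ℝ) (X : LieGc d n M)
    {F : Functional d n M} (hF : F ∈ Floc n S) (k : ℕ) :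
    (Δ (c • X)).series.comp k F = c • (Δ X).series.comp k F := by
  obtain ⟨g, hg, hX⟩ := exists_isTangent X
  funext φ
  have hmem := reduced_pow_mem_Fnloc S hF k
  have h1 := hΔ _ _ (hg.comp (contDiff_const.mul contDiff_id)) (hX.comp_mul c) k _ hmem φ
  have h2 : HasDerivAt (fun s : ℝ => c * s) c 0 := by
    simpa using (hasDerivAt_id (0 : ℝ)).const_mul c
  have h3 := HasDerivAt.comp_of_eq (0 : ℝ) (hΔ X g hg hX k _ hmem φ) h2 (by simp)
  have h4 := h1.unique h3
  simp only [FormalSeries.comp, Pi.smul_apply, smul_eq_mul, h4]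
  ring

end WessZumino

/-! ### Second order: the extended Wess–Zumino condition -/

section WessZumino

variable {d n : ℕ} {M : Type*} [TopologicalSpace M] [ChartedSpace (EuclideanSpace ℝ (Fin d)) M]
  [IsManifold (𝓡 d) ∞ M] [T2Space M] [SecondCountableTopology M]
  [MeasurableSpace M] [BorelSpace M] {S : Spacetime d M}
  {ζ : Gc d n M → Rc n S} {Δ : LieGc d n M → LieRc n S} {m : ℝ}

variable {K : ℝ → Gc d n M} {H : ℝ → ℝ → Gc d n M} {X : ℝ → LieGc d n M} {Y : LieGc d n M}

theorem IsTangent.partialXFL_mem_Floc {h : ℝ → Gc d n M} {Z : LieGc d n M} (hZ : IsTangent h Z)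
    (hh : IsSmoothSymFamily h) (m : ℝ) {F : Functional d n M} (hF : F ∈ Floc n S) (l : ℕ) :
    partialXFL S m Z F l ∈ Floc n S := by
  rw [partialXFL]
  split_ifs
  exacts [hZ.partialXL_mem_Floc hh m, hZ.partialX_mem_Floc hh hF, zero_mem _]

theorem IsTangent.deriv_actL {h : ℝ → Gc d n M} {Z : LieGc d n M} (hZ : IsTangent h Z)
    (hh : IsSmoothSymFamily h) {F : Functional d n M} (hF : F ∈ Floc n S) (x : ℝ) {N : ℕ}
    (hN : 1 ≤ N) (φ : Conf d n M) :
    deriv (fun s => actL S m (h s) (x • F) φ) 0 =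
      ∑ l ∈ Finset.range (N + 1), x ^ l * partialXFL S m Z F l φ := by
  have h1 := hasDerivAt_of_contDiff ((IsLocalFamily.deltaL S m hh).contDiff_apply φ) 0
  have h2 := hasDerivAt_of_contDiff (contDiff_comp_act hh (isLocalFamily_const S hF) φ) 0
  rw [hZ.deriv_deltaL hh] at h1
  rw [hZ.deriv_comp_act hh hF] at h2
  have h3 := (h1.fun_add (h2.const_mul x)).deriv
  refine h3.trans ?_
  -- With `N ≥ 1` the truncated sum contains both nonzero terms, `∂_Z L` of order `0` and `∂_Z F` of
  -- order `1`.
  obtain ⟨N, rfl⟩ := Nat.exists_eq_add_of_le' hN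
  rw [Finset.sum_range_succ', Finset.sum_range_succ', Finset.sum_eq_zero fun l _ => by
    simp [partialXFL]]
  simp [partialXFL]
  ring

theorem hasDerivAt_sum_comp_inv_act (z : FormalSeries n S) {h : ℝ → Gc d n M} {Z : LieGc d n M}
    (hZ : IsTangent h Z) (hh : IsSmoothSymFamily h) {F : Functional d n M} (hF : F ∈ Floc n S)
    (x : ℝ) (N : ℕ) (φ : Conf d n M) :
    HasDerivAt (fun s => ∑ i ∈ Finset.range (N + 1), z.comp i (x • F) ((h s)⁻¹.act φ))
      (- ∑ i ∈ Finset.range (N + 1), partialX Z (z.comp i F) φ * x ^ i) 0 := by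
  simp only [z.sum_comp_smul hF, ← Finset.sum_neg_distrib, ← neg_mul]
  refine HasDerivAt.fun_sum fun i _ => HasDerivAt.mul_const ?_ _
  rw [← hZ.deriv_comp_inv_act hh (z.comp_mem_Floc i F)]
  exact hasDerivAt_of_contDiff
    (contDiff_comp_act hh.inv (isLocalFamily_const S (z.comp_mem_Floc i F)) φ) 0

/-- The `t`-derivative is taken first, since `K 0 = e` turns `ζ_K` into `ΔY`. The subsequent
`s`-derivative meets `H` in the argument, giving `∂_X(F+L)`, and in the inverse action, giving minus
`∂_X`. -/
theorem mixedDeriv_conjugatedPert (hone : (ζ 1).pert = 0) (hs : IsSmoothAnomaly ζ)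
    (hΔ : IsInfinitesimalAnomaly ζ Δ) (hK : IsSmoothSymFamily K) (hY : IsTangent K Y)
    (hH : IsSmoothSymFamily (fun q : ℝ × ℝ => H q.1 q.2))
    (hX : ∀ t, IsTangent (fun s => H s t) (X t)) {F : Functional d n M} (hF : F ∈ Floc n S)
    (x : ℝ) {N : ℕ} (hN : 1 ≤ N) (φ : Conf d n M) :
    mixedDeriv (fun s t => conjugatedPert ζ m N (K t) (H s t) (x • F) φ) =
      ∑ i ∈ Finset.range N, ∑ l ∈ Finset.range (N + 1), (i.factorial : ℝ)⁻¹ *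
        (Δ Y).series.app (i + 1) (reduced F ^ i * reduced (partialXFL S m (X 0) F l)) φ *
          x ^ (i + l) -
      ∑ i ∈ Finset.range (N + 1), partialX (X 0) ((Δ Y).series.comp i F) φ * x ^ i := by
  have hxF : x • F ∈ Floc n S := Submodule.smul_mem _ x hF
  have hU := hs.isLocalFamily_conjugatedPert (P := ℝ × ℝ) m N (hK.comp contDiff_snd) hH
    (isLocalFamily_const S hxF)
  rw [← mixedDeriv_swap (hU.contDiff_apply φ), mixedDeriv]
  have hsl : ∀ s, IsSmoothSymFamily (fun t => H s t) := fun s =>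
    hH.comp (contDiff_const.prodMk contDiff_id)
  have hH0 : IsSmoothSymFamily (fun s => H s 0) := hH.comp (contDiff_id.prodMk contDiff_const)
  have h1 : ∀ s, deriv (fun t => conjugatedPert ζ m N (K t) (H s t) (x • F) φ) 0 = _ := fun s =>
    deriv_conjugatedPert hone hs hΔ hK hY (hsl s) hxF N φ
  simp only [h1]
  have hG : IsLocalFamily S (fun s => actL S m (H s 0) (x • F)) :=
    IsLocalFamily.actL S m hH0 (isLocalFamily_const S hxF)
  have h2 : ContDiff ℝ ∞ (fun q : ℝ × ℝ => ∑ i ∈ Finset.range (N + 1),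
      (Δ Y).series.comp i (actL S m (H q.1 0) (x • F)) ((H q.2 0)⁻¹.act φ)) :=
    ContDiff.sum fun i _ => contDiff_infinitesimal_comp hs hΔ (hK.comp contDiff_fst)
      (X := fun _ => Y) (fun _ => hY) (hG.comp contDiff_fst)
      ((hH0.inv.comp contDiff_snd).act (isSmoothConfFamily_const φ)) i
  -- The two occurrences of `H` are varied separately, one parameter for the argument and one for
  -- the configuration.
  rw [deriv_diag (f := fun r s => ∑ i ∈ Finset.range (N + 1),
      (Δ Y).series.comp i (actL S m (H r 0) (x • F)) ((H s 0)⁻¹.act φ)) h2]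
  have h00 : H 0 0 = 1 := (hX 0).1
  simp only [h00, inv_one, Gc.one_act, actL_one]
  rw [(hasDerivAt_sum_infinitesimal_comp hs hΔ Y hG hF (by simp only [h00, actL_one])
      (fun l => (hX 0).partialXFL_mem_Floc hH0 m hF l) ((hX 0).deriv_actL hH0 hF x hN) φ).deriv,
    (hasDerivAt_sum_comp_inv_act _ (hX 0) hH0 hF x N φ).deriv, sub_eq_add_neg]

/-- Here the `s`-derivative comes first, since `H 0 t = e` turns `ζ_H` into `Δ(X_t)`. Then `t`
occurs in `X_t`, which reproduces the mixed derivative of `ζ_H(F)`, and in the argument, whose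
derivative is `ΔY(κF)`. -/
theorem mixedDeriv_sum_comp (hone : (ζ 1).pert = 0) (hs : IsSmoothAnomaly ζ)
    (hΔ : IsInfinitesimalAnomaly ζ Δ) (hK : IsSmoothSymFamily K) (hY : IsTangent K Y)
    (hH : IsSmoothSymFamily (fun q : ℝ × ℝ => H q.1 q.2))
    (hX : ∀ t, IsTangent (fun s => H s t) (X t)) {F : Functional d n M} (hF : F ∈ Floc n S)
    (x : ℝ) (N : ℕ) (φ : Conf d n M) :
    mixedDeriv (fun s t => ∑ i ∈ Finset.range (N + 1), (ζ (H s t)).pert.comp i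
        (x • F + conjugatedPert ζ m N (K t) (H s t) (x • F)) φ) =
      ∑ i ∈ Finset.range (N + 1),
        mixedDeriv (fun s t => (ζ (H s t)).pert.comp i F φ) * x ^ i +
      ∑ i ∈ Finset.range N, ∑ l ∈ Finset.range (N + 1), (i.factorial : ℝ)⁻¹ *
        (Δ (X 0)).series.app (i + 1) (reduced F ^ i * reduced ((Δ Y).series.comp l F)) φ *
          x ^ (i + l) := by
  have hxF : x • F ∈ Floc n S := Submodule.smul_mem _ x hF
  have hU := hs.isLocalFamily_conjugatedPert (P := ℝ × ℝ) m N (hK.comp contDiff_snd) hH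
    (isLocalFamily_const S hxF)
  have hV := (isLocalFamily_const S hxF (P := ℝ × ℝ)).add hU
  have hsl : ∀ t : ℝ, ContDiff ℝ ∞ (fun s : ℝ => (s, t)) := fun t =>
    contDiff_id.prodMk contDiff_const
  have hV0 : IsLocalFamily S (fun t => x • F + conjugatedPert ζ m N (K t) (H 0 t) (x • F)) :=
    hV.comp (f := fun t => ((0 : ℝ), t)) (contDiff_const.prodMk contDiff_id)
  rw [mixedDeriv]
  have h1 : ∀ t, deriv (fun s => ∑ i ∈ Finset.range (N + 1), (ζ (H s t)).pert.comp i
      (x • F + conjugatedPert ζ m N (K t) (H s t) (x • F)) φ) 0 = _ := fun t =>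
    deriv_sum_comp_of_isTangent hone hs hΔ (hH.comp (hsl t)) (hX t) (hV.comp (hsl t))
      (isSmoothConfFamily_const φ) N
  simp only [h1]
  have h2 : ContDiff ℝ ∞ (fun q : ℝ × ℝ => ∑ i ∈ Finset.range (N + 1), (Δ (X q.1)).series.comp i
      (x • F + conjugatedPert ζ m N (K q.2) (H 0 q.2) (x • F)) φ) :=
    ContDiff.sum fun i _ => contDiff_infinitesimal_comp hs hΔ
      (H := fun p : ℝ × ℝ × ℝ => H p.1 p.2.1)
      (hH.comp (contDiff_fst.prodMk (contDiff_fst.comp contDiff_snd)))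
      (X := fun q => X q.1) (fun q => hX q.1) (hV0.comp contDiff_snd) (isSmoothConfFamily_const φ) i
  rw [deriv_diag (f := fun r t => ∑ i ∈ Finset.range (N + 1), (Δ (X r)).series.comp i
      (x • F + conjugatedPert ζ m N (K t) (H 0 t) (x • F)) φ) h2]
  have hU0 : x • F + conjugatedPert ζ m N (K 0) (H 0 0) (x • F) = x • F := by
    rw [hY.1, conjugatedPert_of_left hone, add_zero]
  have hd : ∀ φ', deriv (fun t => (x • F + conjugatedPert ζ m N (K t) (H 0 t) (x • F)) φ') 0 =
      ∑ l ∈ Finset.range (N + 1), x ^ l * (Δ Y).series.comp l F φ' := fun φ' => by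
    have h3 := deriv_conjugatedPert (m := m) hone hs hΔ hK hY (h := fun t => H 0 t)
      (hH.comp (contDiff_const.prodMk contDiff_id)) hxF N φ'
    simp only [(hX 0).1, actL_one, inv_one, Gc.one_act, FormalSeries.sum_comp_smul _ hF] at h3
    simp only [Pi.add_apply, deriv_const_add]
    rw [h3]
    exact Finset.sum_congr rfl fun l _ => mul_comm _ _
  rw [(hasDerivAt_sum_infinitesimal_comp hs hΔ (X 0) hV0 hF hU0
    (fun l => (Δ Y).series.comp_mem_Floc l F) hd φ).deriv]
  simp only [hU0, FormalSeries.sum_comp_smul _ hF]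
  congr 1
  have h4 : ∀ i t, deriv (fun s => (ζ (H s t)).pert.comp i F φ) 0 =
      (Δ (X t)).series.comp i F φ := fun i t =>
    deriv_comp_of_isTangent hone hs hΔ (hH.comp (hsl t)) (hX t) (isLocalFamily_const S hF)
      (isSmoothConfFamily_const φ) i
  simp only [mixedDeriv, h4]
  exact (HasDerivAt.fun_sum fun i _ => (hasDerivAt_of_contDiff (contDiff_infinitesimal_comp hs hΔ hH
    hX (isLocalFamily_const S hF) (isSmoothConfFamily_const φ) i) 0).mul_const _).deriv

/-- The mixed derivative of the cocycle relation. -/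
theorem mixedDeriv_cocycle (hone : (ζ 1).pert = 0) (hs : IsSmoothAnomaly ζ) (hc : IsCocycle m ζ)
    (hΔ : IsInfinitesimalAnomaly ζ Δ) (hK : IsSmoothSymFamily K) (hY : IsTangent K Y)
    (hH : IsSmoothSymFamily (fun q : ℝ × ℝ => H q.1 q.2))
    (hX : ∀ t, IsTangent (fun s => H s t) (X t)) {F : Functional d n M} (hF : F ∈ Floc n S)
    (k : ℕ) (φ : Conf d n M) :
    mixedDeriv (fun s t => (ζ (K t * H s t)).pert.comp k F φ) =
      mixedDeriv (fun s t => (ζ (H s t)).pert.comp k F φ) +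
      (Δ (X 0)).series.der F (fun l => (Δ Y).series.comp l F) k φ +
      (Δ Y).series.der F (partialXFL S m (X 0) F) k φ -
      partialX (X 0) ((Δ Y).series.comp k F) φ := by
  -- The defect is then of order `N + 1 = 3k + 3`, as `isBigO_deriv_deriv_of_isBigO` requires.
  set N := 3 * k + 2 with hN
  let E : ℝ → ℝ → ℝ → ℝ := fun s t x =>
    ∑ i ∈ Finset.range (N + 1), (ζ (K t * H s t)).pert.comp i (x • F) φ -
      conjugatedPert ζ m N (K t) (H s t) (x • F) φ -
      ∑ i ∈ Finset.range (N + 1), (ζ (H s t)).pert.comp i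
        (x • F + conjugatedPert ζ m N (K t) (H s t) (x • F)) φ
  have h1 : ContDiff ℝ ∞ (fun q : ℝ × ℝ × ℝ => E q.1 q.2.1 q.2.2) :=
    contDiff_cocycle hs (hK.comp (contDiff_fst.comp contDiff_snd))
      (hH.comp (contDiff_fst.prodMk (contDiff_fst.comp contDiff_snd)))
      (IsLocalFamily.smul_const hF (contDiff_snd.comp contDiff_snd)) φ N
  have h2 : (fun q : (ℝ × ℝ) × ℝ => E q.1.1 q.1.2 q.2) =O[𝓝 0] fun q => ‖q‖ ^ (N + 1) :=
    hc.isBigO (P := ℝ × ℝ) (hK.comp contDiff_snd) hH (hX 0).1 hF φ N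
  have h3 := isBigO_deriv_deriv_of_isBigO h1
    (fun t x => by
      simp only [E, (hX t).1, mul_one, conjugatedPert_of_right,
        FormalSeries.comp_of_eq_zero hone]
      simp)
    (fun s x => by
      simp only [E, hY.1, one_mul, conjugatedPert_of_left hone, add_zero]
      simp) k (N + 1) (by omega) h2
  -- The mixed derivative of the defect is a polynomial in the expansion parameter; terms of order
  -- `0` in one factor and all orders in the other are collected by the total power `i + l`.
  have h4 : ∀ x, deriv (fun t => deriv (fun s => E s t x) 0) 0 =
      ∑ i ∈ Finset.range (N + 1),
        mixedDeriv (fun s t => (ζ (K t * H s t)).pert.comp i F φ) * x ^ i -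
      ∑ i ∈ Finset.range (N + 1), (mixedDeriv (fun s t => (ζ (H s t)).pert.comp i F φ) -
        partialX (X 0) ((Δ Y).series.comp i F) φ) * x ^ i -
      ∑ i ∈ Finset.range N, ∑ l ∈ Finset.range (N + 1), ((i.factorial : ℝ)⁻¹ *
        (Δ (X 0)).series.app (i + 1) (reduced F ^ i * reduced ((Δ Y).series.comp l F)) φ +
        (i.factorial : ℝ)⁻¹ * (Δ Y).series.app (i + 1)
          (reduced F ^ i * reduced (partialXFL S m (X 0) F l)) φ) * x ^ (i + l) := fun x => by
    have hxF : IsLocalFamily S (fun _ : ℝ × ℝ => x • F) :=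
      isLocalFamily_const S (Submodule.smul_mem _ x hF)
    have hKH : IsSmoothSymFamily (fun q : ℝ × ℝ => K q.2 * H q.1 q.2) :=
      (hK.comp contDiff_snd).mul hH
    have hU := hs.isLocalFamily_conjugatedPert (P := ℝ × ℝ) m N (hK.comp contDiff_snd) hH hxF
    have d1 : ContDiff ℝ ∞ (fun q : ℝ × ℝ => ∑ i ∈ Finset.range (N + 1),
        (ζ (K q.2 * H q.1 q.2)).pert.comp i (x • F) φ) :=
      ContDiff.sum fun i _ => (hs.isLocalFamily_comp hKH hxF i).contDiff_apply φ
    have d3 : ContDiff ℝ ∞ (fun q : ℝ × ℝ => ∑ i ∈ Finset.range (N + 1),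
        (ζ (H q.1 q.2)).pert.comp i
          (x • F + conjugatedPert ζ m N (K q.2) (H q.1 q.2) (x • F)) φ) :=
      ContDiff.sum fun i _ => (hs.isLocalFamily_comp hH (hxF.add hU) i).contDiff_apply φ
    have e1 : mixedDeriv (fun s t => ∑ i ∈ Finset.range (N + 1),
        (ζ (K t * H s t)).pert.comp i (x • F) φ) = ∑ i ∈ Finset.range (N + 1),
        mixedDeriv (fun s t => (ζ (K t * H s t)).pert.comp i F φ) * x ^ i := by
      rw [mixedDeriv_sum _ fun i => (hs.isLocalFamily_comp hKH hxF i).contDiff_apply φ]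
      refine Finset.sum_congr rfl fun i _ => ?_
      simp only [FormalSeries.comp_smul _ hF, Pi.smul_apply, smul_eq_mul]
      rw [mixedDeriv_const_mul, mul_comm]
    have e4 : deriv (fun t => deriv (fun s => E s t x) 0) 0 = mixedDeriv (fun s t => E s t x) := rfl
    rw [e4, mixedDeriv_sub (d1.sub (hU.contDiff_apply φ)) d3, mixedDeriv_sub d1
      (hU.contDiff_apply φ), e1, mixedDeriv_conjugatedPert hone hs hΔ hK hY hH hX hF x (by omega) φ,
      mixedDeriv_sum_comp hone hs hΔ hK hY hH hX hF x N φ]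
    simp only [add_mul, sub_mul, Finset.sum_add_distrib, Finset.sum_sub_distrib]
    ring
  simp only [h4] at h3
  have h5 := coeff_eq_of_isBigO N k (by omega) _ _ (fun i l => (i.factorial : ℝ)⁻¹ *
    (Δ (X 0)).series.app (i + 1) (reduced F ^ i * reduced ((Δ Y).series.comp l F)) φ +
    (i.factorial : ℝ)⁻¹ * (Δ Y).series.app (i + 1)
      (reduced F ^ i * reduced (partialXFL S m (X 0) F l)) φ) h3
  rw [h5, FormalSeries.der_apply, FormalSeries.der_apply, Finset.sum_add_distrib]
  ring

/-- The derivative of the infinitesimal anomaly along the adjoint action. -/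
theorem deriv_infinitesimal_add_smul (hone : (ζ 1).pert = 0) (hs : IsSmoothAnomaly ζ)
    (hc : IsCocycle m ζ) (hΔ : IsInfinitesimalAnomaly ζ Δ) (Z : LieGc d n M)
    {W : ℝ → LieGc d n M} (hW : IsSmoothLieFamily W) {F : Functional d n M} (hF : F ∈ Floc n S)
    (k : ℕ) (φ : Conf d n M) :
    deriv (fun t => (Δ (Z + t • W t)).series.comp k F φ) 0 = (Δ (W 0)).series.comp k F φ := by
  obtain ⟨g, hg, hgW⟩ := hasCurves_of_isSmoothLieFamily hW
  -- By linearity this has the form `a + t c(t)`, so only continuity of `c(t) = Δ(W_t)` at `0` is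
  -- missing.
  have h1 : ∀ t, (Δ (Z + t • W t)).series.comp k F φ =
      (Δ Z).series.comp k F φ + t * (Δ (W t)).series.comp k F φ := fun t => by
    rw [infinitesimal_add hone hs hc hΔ _ _ hF, infinitesimal_smul hΔ _ _ hF]
    rfl
  simp only [h1]
  refine (hasDerivAt_add_mul ?_).deriv
  have hsm : ∀ t : ℝ, ContDiff ℝ ∞ (fun s : ℝ => (s, t)) := fun t =>
    contDiff_id.prodMk contDiff_const
  -- Continuity in `t` comes from the curves tangent to `W_t`, which exist as one smooth family:
  -- near `0` the value of `Δ(W_t)` is a smooth function of `t`.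
  have h2 := contDiff_deriv_zero (f := fun s t => (ζ (g (s, t))).pert.comp k F φ)
    ((hs.isLocalFamily_comp hg (isLocalFamily_const S hF) k).contDiff_apply φ)
  refine h2.continuous.continuousAt.congr ?_
  filter_upwards [hgW] with t ht
  exact deriv_comp_of_isTangent hone hs hΔ (hg.comp (hsm t)) ht (isLocalFamily_const S hF)
    (isSmoothConfFamily_const φ) k

/-- The extended Wess–Zumino condition. -/
theorem wessZumino (hone : (ζ 1).pert = 0) (hs : IsSmoothAnomaly ζ) (hc : IsCocycle m ζ)
    (hΔ : IsInfinitesimalAnomaly ζ Δ) (X Y : LieGc d n M) {F : Functional d n M}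
    (hF : F ∈ Floc n S) (k : ℕ) :
    (Δ ⁅X, Y⁆).series.comp k F =
      (Δ Y).series.der F (fun l => (Δ X).series.comp l F) k
      - (Δ X).series.der F (fun l => (Δ Y).series.comp l F) k
      + partialX X ((Δ Y).series.comp k F) - partialX Y ((Δ X).series.comp k F)
      - (Δ Y).series.der F (partialXFL S m X F) k
      + (Δ X).series.der F (partialXFL S m Y F) k := by
  obtain ⟨g, hg, hX⟩ := exists_isTangent X
  obtain ⟨h, hh, hY⟩ := exists_isTangent Y
  obtain ⟨W, hW, hW0, hWt⟩ := exists_isTangent_conj hg hX hh hY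
  funext φ
  have hg1 : IsSmoothSymFamily (fun q : ℝ × ℝ => g q.1) := hg.comp contDiff_fst
  have hh2 : IsSmoothSymFamily (fun q : ℝ × ℝ => h q.2) := hh.comp contDiff_snd
  have hH : IsSmoothSymFamily (fun q : ℝ × ℝ => (h q.2)⁻¹ * g q.1 * h q.2) :=
    (hh2.inv.mul hg1).mul hh2
  have hsm : ∀ t : ℝ, ContDiff ℝ ∞ (fun s : ℝ => (s, t)) := fun t =>
    contDiff_id.prodMk contDiff_const
  -- First factorization: `g_s h_t` as the product of `h_t` and the conjugate of `g_s`.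
  have h1 := mixedDeriv_cocycle hone hs hc hΔ hh hY (H := fun s t => (h t)⁻¹ * g s * h t) hH hWt
    hF k φ
  -- Second factorization: `g` times `h` as it stands, the parameter of `h` now being the first one.
  -- The second factor does not depend on the other parameter, so it has no mixed derivative.
  have h2 := mixedDeriv_cocycle hone hs hc hΔ hg hX (H := fun s _ => h s) (hh.comp contDiff_fst)
    (X := fun _ => Y) (fun _ => hY) hF k φ
  have h3 : mixedDeriv (fun s t => (ζ ((h t)⁻¹ * g s * h t)).pert.comp k F φ) =
      (Δ ⁅X, Y⁆).series.comp k F φ := by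
    rw [← hW0, ← deriv_infinitesimal_add_smul hone hs hc hΔ X hW hF k φ, mixedDeriv]
    congr 1
    funext t
    exact deriv_comp_of_isTangent hone hs hΔ (hH.comp (hsm t)) (hWt t) (isLocalFamily_const S hF)
      (isSmoothConfFamily_const φ) k
  have h4 : mixedDeriv (fun s (_ : ℝ) => (ζ (h s)).pert.comp k F φ) = 0 := by
    simp [mixedDeriv]
  -- The two computations differentiate the same function of the parameters in opposite orders.
  have h5 := mixedDeriv_swap (f := fun s t => (ζ (g s * h t)).pert.comp k F φ)
    ((hs.isLocalFamily_comp (hg1.mul hh2) (isLocalFamily_const S hF) k).contDiff_apply φ)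
  have h6 : ∀ s t, h t * ((h t)⁻¹ * g s * h t) = g s * h t := fun s t => by
    rw [← mul_assoc, ← mul_assoc, mul_inv_cancel, one_mul]
  simp only [h6, h3, zero_smul, add_zero] at h1
  rw [h4] at h2
  simp only [Pi.add_apply, Pi.sub_apply]
  linarith

end WessZumino

end AMWI

end

theorem theorem5p1 {d n : ℕ} {M : Type*} [TopologicalSpace M]
    [ChartedSpace (EuclideanSpace ℝ (Fin d)) M] [IsManifold (𝓡 d) ∞ M]
    [T2Space M] [SecondCountableTopology M] [Nonempty M] [MeasurableSpace M] [BorelSpace M]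
    (S : AMWI.Spacetime d M) (m : ℝ)
    (ζ : AMWI.Gc d n M → AMWI.Rc n S)
    (hone : (ζ 1).pert = 0)
    (hsmooth : AMWI.IsSmoothAnomaly ζ)
    (hcocycle : AMWI.IsCocycle m ζ)
    (Δ : AMWI.LieGc d n M → AMWI.LieRc n S)
    (hΔ : AMWI.IsInfinitesimalAnomaly ζ Δ) :
    (∀ (b c : ℝ) (X Y : AMWI.LieGc d n M), ∀ F ∈ AMWI.Floc n S, ∀ k,
      (Δ (b • X + c • Y)).series.comp k F =
        b • (Δ X).series.comp k F + c • (Δ Y).series.comp k F) ∧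
    (∀ (X Y : AMWI.LieGc d n M), ∀ F ∈ AMWI.Floc n S, ∀ k,
      (Δ ⁅X, Y⁆).series.comp k F =
        - AMWI.lieBracket (Δ X).series (Δ Y).series F k
        + AMWI.covDer m X (Δ Y).series F k - AMWI.covDer m Y (Δ X).series F k) ∧
    (∀ (X Y : AMWI.LieGc d n M), ∀ F ∈ AMWI.Floc n S, ∀ k,
      (Δ ⁅X, Y⁆).series.comp k F =
        (Δ Y).series.der F (fun l => (Δ X).series.comp l F) k
        - (Δ X).series.der F (fun l => (Δ Y).series.comp l F) k
        + AMWI.partialX X ((Δ Y).series.comp k F) - AMWI.partialX Y ((Δ X).series.comp k F)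
        - (Δ Y).series.der F (AMWI.partialXFL S m X F) k
        + (Δ X).series.der F (AMWI.partialXFL S m Y F) k) := by
  have hWZ := fun X Y F (hF : F ∈ AMWI.Floc n S) k =>
    AMWI.wessZumino hone hsmooth hcocycle hΔ X Y hF k
  refine ⟨fun b c X Y F hF k => ?_, fun X Y F hF k => ?_, hWZ⟩
  · rw [AMWI.infinitesimal_add hone hsmooth hcocycle hΔ _ _ hF,
      AMWI.infinitesimal_smul hΔ _ _ hF, AMWI.infinitesimal_smul hΔ _ _ hF]
  · rw [hWZ X Y F hF k, AMWI.lieBracket, AMWI.covDer, AMWI.covDer]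
    abel
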